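/- Let $n\ge 2$, let $M$ be a triangulated space (e.g. a triangulated manifold), and let $E_0\to M$ and $E_1\to M$ be oriented topological $S^{n-1}$-bundles, i.e. locally trivial bundles with fiber $S^{n-1}$ whose transition functions take values in the orientation-preserving homeomorphisms of $S^{n-1}$. A fiberwise bordism between $E_0$ and $E_1$ is an $S^{n-1}\times[0,1]$-bundle $E\to M$, with transition functions that map $S^{n-1}\times\{i\}$ to itself for $i=0,1$, such that for $i=0,1$ the sub-bundle of $E$ with fiber $S^{n-1}\times\{i\}$ is isomorphic to $E_i$. Suppose that there is a fiberwise bordism $E$ that is compatible with the orientations: for each $x\in M$, the orientations of the fibers $(E_0)_x$ and $(E_1)_x$ correspond to each other under the isomorphisms $\pi_{n-1}((E_0)_x)\cong\pi_{n-1}(E_x)\cong\pi_{n-1}((E_1)_x)$ induced by the inclusions. Then $E_0$ and $E_1$ have the same Euler class in the simplicial cohomology group $H^n(M;\pi_{n-1}(S^{n-1}))$. Here the Euler class of an oriented $S^{n-1}$-bundle over $M$ is its primary obstruction class: the bundle has a section $\sigma$ over the $(n-1)$-skeleton of $M$; the cochain that assigns to each $n$-simplex $\Delta$ the element of $\pi_{n-1}(S^{n-1})$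 represented by $\sigma|_{\partial\Delta}$ (using the orientation and the triviality of the bundle over $\Delta$) is a cocycle; and the Euler class is the cohomology class of this cocycle, which does not depend on the choice of $\sigma$. -/

import Mathlib

open scoped unitInterval Topology

noncomputable section

namespace EulerBordism

/-! ### Simplicial complexes: geometric realization, skeleta, simplicial cohomology -/

section Complex

variable {V : Type*}

/-- The geometric realization `|K|` in barycentric coordinates: functions on the vertices with
non-negative values of sum `1`, supported on a simplex of `K`. -/
def Realization (K : AbstractSimplicialComplex V) : Type _ :=
  {x : V → ℝ // (∀ v, 0 ≤ x v) ∧ ∃ s ∈ K.faces, (∀ v, v ∉ s → x v = 0) ∧ ∑ v ∈ s, x v = 1}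

/-- The characteristic map of the simplex `s`: extension of barycentric coordinates by zero. -/
def simplexMap (K : AbstractSimplicialComplex V) (s : {s : Finset V // s ∈ K.faces})
    (x : stdSimplex ℝ s.1) : Realization K :=
  open Classical in
  ⟨fun v => if h : v ∈ s.1 then x.1 ⟨v, h⟩ else 0, by
    refine ⟨fun v => ?_, s.1, s.2, fun v hv => dif_neg hv, ?_⟩
    · dsimp only
      split_ifs with h
      · exact x.2.1 ⟨v, h⟩
      · exact le_rfl
    · rw [← x.2.2, ← Finset.sum_attach, ← Finset.univ_eq_attach]
      exact Finset.sum_congr rfl fun v _ => dif_pos v.2⟩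

/-- The weak topology: the finest topology for which all characteristic maps of simplices are
continuous. -/
instance (K : AbstractSimplicialComplex V) : TopologicalSpace (Realization K) :=
  ⨆ s : {s : Finset V // s ∈ K.faces}, TopologicalSpace.coinduced (simplexMap K s) inferInstance

/-- The closed simplex `|s|` in `|K|`. -/
def closedSimplex (K : AbstractSimplicialComplex V) (s : Finset V) : Set (Realization K) :=
  {x | ∀ v, v ∉ s → x.1 v = 0}

/-- The `m`-skeleton of `|K|`: the union of the closed simplices with at most `m + 1` vertices. -/
def skeleton (K : AbstractSimplicialComplex V) (m : ℕ) : Set (Realization K) :=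
  {x | ∃ s ∈ K.faces, s.card ≤ m + 1 ∧ x ∈ closedSimplex K s}

/-- The `m`-simplices of `K`. -/
def Simplices (K : AbstractSimplicialComplex V) (m : ℕ) : Type _ :=
  {s : Finset V // s ∈ K.faces ∧ s.card = m + 1}

variable [LinearOrder V]

/-- The `i`-th vertex of an `m`-simplex, in the order of the vertices. -/
def vertex {K : AbstractSimplicialComplex V} {m : ℕ} (s : Simplices K m) (i : Fin (m + 1)) : V :=
  s.1.orderEmbOfFin s.2.2 i

lemma vertex_mem {K : AbstractSimplicialComplex V} {m : ℕ} (s : Simplices K m) (i : Fin (m + 1)) :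
    vertex s i ∈ s.1 :=
  s.1.orderEmbOfFin_mem s.2.2 i

/-- The face of an `(m+1)`-simplex opposite to its `i`-th vertex. -/
def oppositeFace {K : AbstractSimplicialComplex V} {m : ℕ} (s : Simplices K (m + 1))
    (i : Fin (m + 2)) : Simplices K m :=
  ⟨s.1.erase (vertex s i), by
    have hc : (s.1.erase (vertex s i)).card = m + 1 := by
      rw [Finset.card_erase_of_mem (vertex_mem s i), s.2.2]; rfl
    exact ⟨(K.isRelLowerSet_faces s.2.1).2 (Finset.erase_subset _ _)
      (Finset.card_pos.1 (by omega)), hc⟩⟩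

variable (K : AbstractSimplicialComplex V) (A : Type*) [AddCommGroup A]

/-- The simplicial coboundary `(δ f)[v₀, …, v_{m+1}] = ∑ i, (-1)^i f[v₀, …, v̂_i, …, v_{m+1}]`,
where simplices are oriented by the order of their vertices. -/
def coboundary (m : ℕ) : (Simplices K m → A) →+ (Simplices K (m + 1) → A) where
  toFun f s := ∑ i : Fin (m + 2), (-1 : ℤ) ^ (i : ℕ) • f (oppositeFace s i)
  map_zero' := by ext s; simp
  map_add' f g := by ext s; simp [Finset.sum_add_distrib]

/-- Simplicial `m`-cocycles with values in `A`. -/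
abbrev cocycles (m : ℕ) : AddSubgroup (Simplices K m → A) := (coboundary K A m).ker

/-- Simplicial `m`-coboundaries with values in `A`. -/
def coboundaries : (m : ℕ) → AddSubgroup (Simplices K m → A)
  | 0 => ⊥
  | m + 1 => (coboundary K A m).range

/-- The simplicial cohomology group `H^m(K; A)`. -/
abbrev Cohomology (m : ℕ) : Type _ :=
  cocycles K A m ⧸ (coboundaries K A m).addSubgroupOf (cocycles K A m)

end Complex

/-! ### The standard parametrization of an ordered simplex by a cube -/

/-- The map from the cube to the simplex,
`y ↦ (1 - y₀, y₀(1 - y₁), …, y₀⋯y_{m-2}(1 - y_{m-1}), y₀⋯y_{m-1})`. It is a homeomorphism of the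
interiors that preserves the standard orientations, and it maps boundary to boundary; on boundaries
it has degree one. -/
def cubeCoord {m : ℕ} (y : Fin m → I) (i : Fin (m + 1)) : ℝ :=
  (∏ j : Fin m with j.castSucc < i, (y j : ℝ)) * if h : (i : ℕ) < m then 1 - (y ⟨i, h⟩ : ℝ) else 1

lemma cubeCoord_nonneg {m : ℕ} (y : Fin m → I) (i : Fin (m + 1)) : 0 ≤ cubeCoord y i := by
  refine mul_nonneg (Finset.prod_nonneg fun j _ => (y j).2.1) ?_
  split_ifs with h
  · exact sub_nonneg.2 (y ⟨i, h⟩).2.2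
  · exact zero_le_one

lemma cubeCoord_zero {m : ℕ} (y : Fin (m + 1) → I) : cubeCoord y 0 = 1 - (y 0 : ℝ) := by
  simp [cubeCoord]

lemma cubeCoord_succ {m : ℕ} (y : Fin (m + 1) → I) (i : Fin (m + 1)) :
    cubeCoord y i.succ = (y 0 : ℝ) * cubeCoord (fun j => y j.succ) i := by
  unfold cubeCoord
  rw [Finset.prod_filter, Fin.prod_univ_succ, Finset.prod_filter]
  simp [mul_assoc]

lemma sum_cubeCoord : ∀ {m : ℕ} (y : Fin m → I), ∑ i, cubeCoord y i = 1
  | 0, y => by simp [cubeCoord]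
  | m + 1, y => by
    rw [Fin.sum_univ_succ, cubeCoord_zero]
    simp_rw [cubeCoord_succ, ← Finset.mul_sum, sum_cubeCoord]
    ring

/-- The parametrization of the closed `m`-simplex `s` of `|K|` by the cube `I^m`. -/
def cubeMap {V : Type*} [LinearOrder V] {K : AbstractSimplicialComplex V} {m : ℕ}
    (s : Simplices K m) (y : Fin m → I) : Realization K :=
  simplexMap K ⟨s.1, s.2.1⟩
    ⟨fun v => cubeCoord y ((s.1.orderIsoOfFin s.2.2).symm v), fun _ => cubeCoord_nonneg y _, by
      rw [← sum_cubeCoord y]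
      exact (s.1.orderIsoOfFin s.2.2).symm.toEquiv.sum_comp (cubeCoord y)⟩

/-! ### Spheres and the coefficient group -/

/-- The unit sphere `S^{n-1}` in `ℝ^n`. -/
abbrev Sph (n : ℕ) : Type := Metric.sphere (0 : EuclideanSpace ℝ (Fin n)) 1

/-- The base point `(1, 0, …, 0)`. -/
def basePt (k : ℕ) : Sph (k + 1) := ⟨EuclideanSpace.single 0 1, by simp⟩

/-- The homotopy groups of a space that has a continuous multiplication for which the base point is
a strict unit are commutative. -/
lemma homotopyGroup_mul_comm {N X : Type*} [DecidableEq N] [Nonempty N] [TopologicalSpace X] {e : X}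
    (m : C(X × X, X)) (hl : ∀ x, m (e, x) = x) (hr : ∀ x, m (x, e) = x)
    (a b : HomotopyGroup N X e) : a * b = b * a := by
  let op : GenLoop N X e → GenLoop N X e → GenLoop N X e := fun f g =>
    ⟨m.comp (f.1.prodMk g.1), fun y hy => by
      change m (f.1 y, g.1 y) = e
      rw [f.2 y hy, g.2 y hy, hl]⟩
  have hop : ∀ f g y, op f g y = m (f y, g y) := fun _ _ _ => rfl
  let op' : HomotopyGroup N X e → HomotopyGroup N X e → HomotopyGroup N X e :=
    Quotient.map₂ op (by
      rintro f f' ⟨F⟩ g g' ⟨G⟩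
      refine ⟨⟨⟨m.comp (F.toContinuousMap.prodMk G.toContinuousMap), fun y => ?_, fun y => ?_⟩,
        fun t y hy => ?_⟩⟩
      · change m (F (0, y), G (0, y)) = _
        rw [F.apply_zero, G.apply_zero]; rfl
      · change m (F (1, y), G (1, y)) = _
        rw [F.apply_one, G.apply_one]; rfl
      · change m (F (t, y), G (t, y)) = m (f.1 y, g.1 y)
        rw [F.eq_fst t hy, G.eq_fst t hy])
  let i : N := Classical.arbitrary N
  let mk : GenLoop N X e → HomotopyGroup N X e := fun f => Quotient.mk _ f
  have hmk : Function.Surjective mk := Quotient.mk_surjective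
  have hop' : ∀ f g, op' (mk f) (mk g) = mk (op f g) := fun _ _ => rfl
  have hmul : ∀ f g, mk f * mk g = mk (GenLoop.transAt i g f) :=
    fun f g => HomotopyGroup.mul_spec (i := i)
  have h1 : EckmannHilton.IsUnital (fun a b : HomotopyGroup N X e => a * b) 1 :=
    { left_id := one_mul, right_id := mul_one }
  have h2 : EckmannHilton.IsUnital op' (mk GenLoop.const) :=
    { left_id := fun a => by
        obtain ⟨f, rfl⟩ := hmk a
        rw [hop']
        congr 1; ext y; rw [hop]; exact hl _
      right_id := fun a => by
        obtain ⟨f, rfl⟩ := hmk a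
        rw [hop']
        congr 1; ext y; rw [hop]; exact hr _ }
  have hd : ∀ a b c d : HomotopyGroup N X e,
      op' (a * b) (c * d) = op' a c * op' b d := by
    intro a b c d
    obtain ⟨a, rfl⟩ := hmk a
    obtain ⟨b, rfl⟩ := hmk b
    obtain ⟨c, rfl⟩ := hmk c
    obtain ⟨d, rfl⟩ := hmk d
    rw [hop', hop', hmul, hmul, hmul, hop']
    congr 1
    ext y
    simp only [hop, GenLoop.transAt, GenLoop.coe_copy]
    split_ifs <;> rfl
  exact (EckmannHilton.mul_comm h2 h1 hd).comm a b

/-- Complex multiplication on the unit circle in `ℝ²`. -/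
def circleMul : C(Sph 2 × Sph 2, Sph 2) where
  toFun z := ⟨!₂[z.1.1 0 * z.2.1 0 - z.1.1 1 * z.2.1 1, z.1.1 0 * z.2.1 1 + z.1.1 1 * z.2.1 0], by
    have h1 := z.1.2
    have h2 := z.2.2
    rw [mem_sphere_zero_iff_norm, EuclideanSpace.norm_eq, Real.sqrt_eq_one,
      Fin.sum_univ_two] at h1 h2 ⊢
    simp only [Real.norm_eq_abs, sq_abs] at h1 h2 ⊢
    simp only [Matrix.cons_val_zero, Matrix.cons_val_one]
    linear_combination h2 * ((z.1.1 0) ^ 2 + (z.1.1 1) ^ 2) + h1⟩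
  continuous_toFun := by
    refine Continuous.subtype_mk ((PiLp.continuous_toLp 2 _).comp (continuous_pi fun i => ?_)) _
    fin_cases i <;> simp <;> fun_prop

lemma sphere_mul_comm : ∀ (k : ℕ) (a b : π_ (k + 1) (Sph (k + 2)) (basePt (k + 1))), a * b = b * a
  | 0 => homotopyGroup_mul_comm circleMul
      (fun x => by ext i; fin_cases i <;> simp [circleMul, basePt])
      (fun x => by ext i; fin_cases i <;> simp [circleMul, basePt])
  | k + 1 => fun a b => mul_comm a b

/-- The coefficient group `π_{n-1}(S^{n-1})` for `n = k + 2`, written additively. -/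
def SphereCoeff (k : ℕ) : Type := Additive (π_ (k + 1) (Sph (k + 2)) (basePt (k + 1)))

instance (k : ℕ) : AddCommGroup (SphereCoeff k) :=
  { (inferInstance : AddGroup (Additive (π_ (k + 1) (Sph (k + 2)) (basePt (k + 1))))) with
    add_comm := sphere_mul_comm k }

/-- The class in `π_{n-1}(S^{n-1})` of a map of pairs `(I^{n-1}, ∂I^{n-1}) → (S^{n-1}, *)`. -/
def SphereCoeff.mk {k : ℕ} (f : GenLoop (Fin (k + 1)) (Sph (k + 2)) (basePt (k + 1))) :
    SphereCoeff k :=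
  Additive.ofMul (Quotient.mk _ f : π_ (k + 1) (Sph (k + 2)) (basePt (k + 1)))

/-- A map of pairs `(I^d, ∂I^d) → (X, b)` seen as a map on the `d`-sphere `∂I^{d+1}`: it is `f` on
the face `y₀ = 1`, and constant on the other faces. The free homotopy class of the map
`∂I^{d+1} → X` is the one that corresponds to the class of `f` in `π_d(X, b)`. -/
def onCubeBoundary {d : ℕ} {X : Type*} [TopologicalSpace X] {b : X} (f : GenLoop (Fin d) X b)
    (y : Fin (d + 1) → I) : X :=
  open Classical in if y 0 = 1 then f (fun j => y j.succ) else b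

/-! ### Oriented sphere bundles and their Euler classes -/

section Bundles

variable {M E : Type*} [TopologicalSpace M] [TopologicalSpace E]

/-- The inclusion of the fiber over `x` given by a local trivialization. -/
def fiberMap {F : Type*} [TopologicalSpace F] {p : E → M} (e : Bundle.Trivialization F p) (x : M)
    (v : F) : E :=
  e.toOpenPartialHomeomorph.symm (x, v)

/-- The maps `f` and `g` from `F` to the fiber `p⁻¹(x)` are homotopic as maps to `p⁻¹(x)`. -/
def FiberHomotopic {F : Type*} [TopologicalSpace F] (p : E → M) (x : M) (f g : F → E) : Prop :=
  ∃ H : C(I × F, E), (∀ t v, p (H (t, v)) = x) ∧ (∀ v, H (0, v) = f v) ∧ ∀ v, H (1, v) = g v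

/-- An oriented topological `S^{n-1}`-bundle structure on `p : E → M`: an atlas of local
trivializations whose transition maps `S^{n-1} → S^{n-1}` over each point preserve the orientation,
i.e. are homotopic to the identity (equivalently, have degree one). -/
structure OrientedSphereBundle (n : ℕ) (p : E → M) where
  charts : Set (Bundle.Trivialization (Sph n) p)
  exists_chart : ∀ x, ∃ e ∈ charts, x ∈ e.baseSet
  oriented : ∀ e ∈ charts, ∀ e' ∈ charts, ∀ x ∈ e.baseSet ∩ e'.baseSet,
    FiberHomotopic p x (fiberMap e x) (fiberMap e' x)

variable {V : Type*} {K : AbstractSimplicialComplex V} (T : Realization K ≃ₜ M)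

/-- `s` is a section of `p : E → M` over the `m`-skeleton of the triangulation `T` of `M`. (The
values of `s` outside the skeleton are irrelevant.) -/
def IsSkeletonSection (p : E → M) (m : ℕ) (s : Realization K → E) : Prop :=
  ContinuousOn s (skeleton K m) ∧ ∀ x ∈ skeleton K m, p (s x) = T x

variable [LinearOrder V] {k : ℕ} {p : E → M} (ξ : OrientedSphereBundle (k + 2) p)

/-- With `n = k + 2`: `α ∈ π_{n-1}(S^{n-1})` is the obstruction to extending the section `s` over
the `n`-simplex `τ`. That is, if `E|_τ` is the restriction of the bundle to `τ` and `x₀` is the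
leading vertex of `τ`, then `s` restricted to `∂τ` represents the image of `α` under the
bijections `π_{n-1}(S^{n-1}) ≅ [S^{n-1}, S^{n-1}] ≅ [S^{n-1}, E_{x₀}] ≅ [∂τ, E|_τ]`, of which the
second is given by the orientation of the bundle and the third by the inclusion of the fiber. -/
def IsObstruction (s : Realization K → E) (τ : Simplices K (k + 2)) (α : SphereCoeff k) : Prop :=
  ∃ f, SphereCoeff.mk f = α ∧
    ∃ e ∈ ξ.charts, T (cubeMap τ fun _ => 0) ∈ e.baseSet ∧
      ∃ H : C(I × Cube.boundary (Fin (k + 2)), E),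
        (∀ t y, p (H (t, y)) ∈ T '' closedSimplex K τ.1) ∧
        (∀ y, H (0, y) = s (cubeMap τ y)) ∧
        ∀ y, H (1, y) = fiberMap e (T (cubeMap τ fun _ => 0)) (onCubeBoundary f y)

/-- With `n = k + 2`: `z` is the obstruction cochain of the section `s` over the
`(n-1)`-skeleton. -/
def IsObstructionCochain (s : Realization K → E) (z : Simplices K (k + 2) → SphereCoeff k) : Prop :=
  ∀ τ, IsObstruction T ξ s τ (z τ)

/-- With `n = k + 2`: `c ∈ H^n(M; π_{n-1}(S^{n-1}))` is the Euler class of the oriented sphere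
bundle `ξ`, computed in the triangulation `T` of `M`. That is, the bundle has sections over the
`(n-1)`-skeleton, and for each such section `s` the obstruction cochain of `s` exists,
is a cocycle and represents `c`. -/
def IsEulerClass (c : Cohomology K (SphereCoeff k) (k + 2)) : Prop :=
  (∃ s, IsSkeletonSection T p (k + 1) s) ∧
  ∀ s, IsSkeletonSection T p (k + 1) s →
    (∃ z, IsObstructionCochain T ξ s z) ∧
    ∀ z, IsObstructionCochain T ξ s z →
      ∃ hz : z ∈ cocycles K (SphereCoeff k) (k + 2), QuotientAddGroup.mk ⟨z, hz⟩ = c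

end Bundles

/-! ### Fiberwise bordisms -/

section Bordism

variable {M : Type*} [TopologicalSpace M]

/-- An `F × [0,1]`-bundle structure on `q : W → M` with structure group the homeomorphisms of
`F × [0,1]` that map `F × {i}` to itself for `i = 0, 1`. -/
structure IntervalBundle (F : Type*) [TopologicalSpace F] {W : Type*} [TopologicalSpace W]
    (q : W → M) where
  charts : Set (Bundle.Trivialization (F × I) q)
  exists_chart : ∀ x, ∃ e ∈ charts, x ∈ e.baseSet
  preserves_ends : ∀ e ∈ charts, ∀ e' ∈ charts, ∀ w, q w ∈ e.baseSet ∩ e'.baseSet →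
    ((e w).2.2 = 0 ↔ (e' w).2.2 = 0) ∧ ((e w).2.2 = 1 ↔ (e' w).2.2 = 1)

/-- For `i = 0, 1`, the subspace of `W` whose fibers are the copies of `F × {i}`. -/
def IntervalBundle.endSet {F : Type*} [TopologicalSpace F] {W : Type*} [TopologicalSpace W]
    {q : W → M} (ω : IntervalBundle F q) (i : I) : Set W :=
  {w | ∃ e ∈ ω.charts, q w ∈ e.baseSet ∧ (e w).2.2 = i}

variable {E₀ E₁ : Type*} [TopologicalSpace E₀] [TopologicalSpace E₁]

/-- A fiberwise bordism between the `F`-bundles `p₀` and `p₁`: an `F × [0,1]`-bundle `q : W → M`,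
and bundle isomorphisms of `E₀` and `E₁` with the bundles of fibers `F × {0}` and `F × {1}`. -/
structure FiberwiseBordism (F : Type*) [TopologicalSpace F] (p₀ : E₀ → M) (p₁ : E₁ → M)
    {W : Type*} [TopologicalSpace W] (q : W → M) extends IntervalBundle F q where
  iso₀ : E₀ ≃ₜ toIntervalBundle.endSet 0
  iso₁ : E₁ ≃ₜ toIntervalBundle.endSet 1
  proj_iso₀ : ∀ z, q (iso₀ z) = p₀ z
  proj_iso₁ : ∀ z, q (iso₁ z) = p₁ z

/-- The bordism is compatible with the orientations of the two sphere bundles: over each point `x`,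
oriented parametrizations of the two ends of the fiber `W_x ≅ S^{n-1} × [0,1]` are homotopic in
`W_x`. In other words, the orientations correspond to each other under
`π_{n-1}((E₀)_x) ≅ π_{n-1}(W_x) ≅ π_{n-1}((E₁)_x)`. -/
def FiberwiseBordism.IsOriented {n : ℕ} {p₀ : E₀ → M} {p₁ : E₁ → M} {W : Type*}
    [TopologicalSpace W] {q : W → M} (B : FiberwiseBordism (Sph n) p₀ p₁ q)
    (ξ₀ : OrientedSphereBundle n p₀) (ξ₁ : OrientedSphereBundle n p₁) : Prop :=
  ∀ e₀ ∈ ξ₀.charts, ∀ e₁ ∈ ξ₁.charts, ∀ x ∈ e₀.baseSet ∩ e₁.baseSet,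
    FiberHomotopic q x (fun v => (B.iso₀ (fiberMap e₀ x v) : W))
      (fun v => (B.iso₁ (fiberMap e₁ x v) : W))

end Bordism

end EulerBordism

end

open scoped unitInterval Topology

namespace EulerBordism

/-! ### Faces of cubes -/

section Faces

variable {m : ℕ}

/-! Obstruction theory is run in the bordism `W` itself. Its fibers `S^{n-1} × [0,1]` are homotopy
equivalent to the sphere, and compatibility with the orientations says that oriented
parametrizations of the two ends are homotopic inside each fiber, so that together they orient `q :
W → M` (`FiberwiseBordism.IsOriented.isOrientation`, `FiberwiseBordism.IsOriented.hasRetractions`).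
A section of `E₀` or `E₁` over the `(n-1)`-skeleton, pushed into `W`, is a section of `q` with the
same obstruction cochain (`Represents.postcomp`). Obstruction cochains of sections of `q` are
cocycles (`HasRetractions.mem_cocycles`) and any two are cohomologous
(`HasRetractions.sub_mem_coboundaries`). Hence both Euler classes equal the class given by an
arbitrary section of `q`.

Obstructions are measured by a degree of maps `∂I^n → S^{n-1}` with values in `π_{n-1}(S^{n-1})`.
The class of a based map extends to a function `Φ` on all `(n-1)`-cubes in the sphere whose cubical
coboundary vanishes on continuous `n`-cubes (`IsLoopClass.exists_cocycle`). This uses the homotopy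
addition theorem (`IsLoopClass.cubeD_eq_zero`) and the connectivity of the sphere
(`cubeExtension_sphere`). The degree of `g` is the coboundary of `Φ` evaluated on `g`: it vanishes
if `g` is continuous on the whole cube, its own coboundary vanishes formally (`cubeD_cubeD`), and
homotopy invariance follows from these two facts.

If `r` maps the part of the total space over a simplex to the sphere, inverting the oriented maps up
to homotopy, then the obstruction of `s` on `τ` is the degree of `r ∘ s ∘ cubeMap τ`
(`Represents.degree_eq`). Under the cubical parametrization, the faces `yᵢ = 1` are the faces
opposite to the vertices other than the last, the last face `y = 0` is opposite to the last vertex,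
and the other faces `yᵢ = 0` collapse into a lower skeleton and contribute degree zero. Thus the
identity `cubeD degree = 0` becomes the simplicial cocycle condition; on the prism formed by two
sections and a homotopy over the `(n-2)`-skeleton it says that their obstruction cochains differ by
a coboundary. -/

/-- The inclusion of the face `yᵢ = ε` of the cube `I^(m+1)`. -/
def face (i : Fin (m + 1)) (ε : I) (y : Fin m → I) : Fin (m + 1) → I :=
  Fin.insertNth (α := fun _ => I) i ε y

@[simp] lemma face_same (i : Fin (m + 1)) (ε : I) (y : Fin m → I) : face i ε y i = ε :=
  Fin.insertNth_apply_same (α := fun _ => I) i ε y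

@[simp] lemma face_succAbove (i : Fin (m + 1)) (ε : I) (y : Fin m → I) (j : Fin m) :
    face i ε y (i.succAbove j) = y j :=
  Fin.insertNth_apply_succAbove (α := fun _ => I) i ε y j

lemma face_zero (ε : I) (y : Fin m → I) : face 0 ε y = Fin.cons ε y :=
  Fin.insertNth_zero' ε y

@[simp] lemma face_zero_succ (ε : I) (y : Fin m → I) (j : Fin m) : face 0 ε y j.succ = y j := by
  simp [face_zero]

lemma face_succ_zero (i : Fin (m + 1)) (ε : I) (y : Fin (m + 1) → I) :
    face i.succ ε y 0 = y 0 := by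
  conv_lhs => rw [← Fin.succ_succAbove_zero i]
  rw [face_succAbove]

lemma face_succ_succ (i : Fin (m + 1)) (ε : I) (y : Fin (m + 1) → I) (j : Fin (m + 1)) :
    face i.succ ε y j.succ = face i ε (fun l => y l.succ) j := by
  rcases Fin.eq_self_or_eq_succAbove i j with rfl | ⟨l, rfl⟩
  · simp
  · rw [← Fin.succ_succAbove_succ, face_succAbove, face_succAbove]

lemma face_removeNth {i : Fin (m + 1)} {ε : I} {y : Fin (m + 1) → I} (h : y i = ε) :
    face i ε (fun j => y (i.succAbove j)) = y := by
  subst h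
  exact Fin.insertNth_self_removeNth i y

lemma face_injective (i : Fin (m + 1)) (ε : I) : Function.Injective (face i ε) := fun y y' h => by
  ext j
  rw [← face_succAbove i ε y, h, face_succAbove]

@[fun_prop] lemma continuous_face (i : Fin (m + 1)) (ε : I) : Continuous (face i ε) := by
  refine continuous_pi fun j => ?_
  rcases Fin.eq_self_or_eq_succAbove i j with rfl | ⟨l, rfl⟩
  · simpa using continuous_const
  · simpa using continuous_apply l

/-- The cubical identity: fixing two coordinates in either order. The map `(i, l) ↦ (i.succAbove l,
l.predAbove i)` exchanges the two orders. -/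
lemma face_face (i : Fin (m + 2)) (l : Fin (m + 1)) (ε ε' : I) (w : Fin m → I) :
    face i ε (face l ε' w) = face (i.succAbove l) ε' (face (l.predAbove i) ε w) := by
  ext1 j
  rcases Fin.eq_self_or_eq_succAbove i j with rfl | ⟨j, rfl⟩
  · have h := face_succAbove (j.succAbove l) ε' (face (l.predAbove j) ε w) (l.predAbove j)
    rw [Fin.succAbove_succAbove_predAbove, face_same] at h
    rw [face_same, h]
  rw [face_succAbove]
  rcases Fin.eq_self_or_eq_succAbove l j with rfl | ⟨j, rfl⟩
  · simp
  · rw [← Fin.succAbove_succAbove_succAbove_predAbove]; simp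

/-- Faces in different directions meet in a face of codimension two; this reduces the gluing of maps
on faces to compatibility one dimension lower. -/
lemma face_eq_face {i i' : Fin (m + 2)} (h : i ≠ i') {ε ε' : I} {y y' : Fin (m + 1) → I}
    (hy : face i ε y = face i' ε' y') :
    ∃ l w, i' = i.succAbove l ∧ y = face l ε' w ∧ y' = face (l.predAbove i) ε w := by
  obtain ⟨l, rfl⟩ := Fin.exists_succAbove_eq h.symm
  have hl : y l = ε' := by
    rw [← face_succAbove i ε y, hy, face_same]
  refine ⟨l, fun j => y (l.succAbove j), rfl, (face_removeNth hl).symm, ?_⟩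
  apply face_injective (i.succAbove l) ε'
  rw [← face_face, face_removeNth hl, hy]

lemma face_mem_boundary (i : Fin (m + 1)) {ε : I} (hε : ε = 0 ∨ ε = 1) (y : Fin m → I) :
    face i ε y ∈ Cube.boundary (Fin (m + 1)) := ⟨i, by simpa using hε⟩

lemma face_mem_boundary_of_mem (i : Fin (m + 1)) (ε : I) {y : Fin m → I}
    (hy : y ∈ Cube.boundary (Fin m)) : face i ε y ∈ Cube.boundary (Fin (m + 1)) := by
  obtain ⟨j, hj⟩ := hy
  exact ⟨i.succAbove j, by simpa using hj⟩

lemma mem_boundary_succ_iff {y : Fin (m + 1) → I} :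
    y ∈ Cube.boundary (Fin (m + 1)) ↔
      ∃ i, ∃ ε : I, (ε = 0 ∨ ε = 1) ∧ ∃ w, y = face i ε w := by
  constructor
  · rintro ⟨i, hi⟩
    exact ⟨i, y i, hi, _, (face_removeNth rfl).symm⟩
  · rintro ⟨i, ε, hε, w, rfl⟩
    exact face_mem_boundary i hε w

lemma face_zero_mem_boundary_iff {t : I} {y : Fin m → I} :
    face 0 t y ∈ Cube.boundary (Fin (m + 1)) ↔
      (t = 0 ∨ t = 1) ∨ y ∈ Cube.boundary (Fin m) := by
  constructor
  · rintro ⟨i, hi⟩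
    induction i using Fin.cases with
    | zero => exact Or.inl (by simpa using hi)
    | succ j => exact Or.inr ⟨j, by simpa using hi⟩
  · rintro (h | h)
    · exact face_mem_boundary 0 h y
    · exact face_mem_boundary_of_mem 0 t h

lemma isClosed_boundary (m : ℕ) : IsClosed (Cube.boundary (Fin m)) := by
  have : Cube.boundary (Fin m) = ⋃ i, {y : Fin m → I | y i = 0 ∨ y i = 1} := by
    ext y; simp [Cube.boundary]
  rw [this]
  exact isClosed_iUnion_of_finite fun i =>
    (isClosed_eq (continuous_apply i) continuous_const).union
      (isClosed_eq (continuous_apply i) continuous_const)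

lemma continuous_face_zero : Continuous fun z : I × (Fin m → I) => face 0 z.1 z.2 := by
  refine continuous_pi fun j => ?_
  induction j using Fin.cases with
  | zero => simpa using continuous_fst
  | succ j => simpa using (by fun_prop : Continuous fun z : I × (Fin m → I) => z.2 j)

lemma face_zero_tail (y : Fin (m + 1) → I) : face 0 (y 0) (fun j => y j.succ) = y := by
  rw [face_zero]; exact Fin.cons_self_tail y

lemma continuous_tail : Continuous fun y : Fin (m + 1) → I => fun j : Fin m => y j.succ :=
  continuous_pi fun j => continuous_apply j.succ

end Faces

/-! ### Continuity on the boundary of a cube -/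

section BoundaryContinuity

variable {m : ℕ} {X Z : Type*} [TopologicalSpace X] [TopologicalSpace Z]

/-- The boundary is a finite union of closed faces, so continuity can be checked on each face. -/
lemma continuousOn_prod_boundary {G : Z × (Fin (m + 1) → I) → X}
    (h : ∀ i, ∀ ε : I, (ε = 0 ∨ ε = 1) → Continuous fun z : Z × (Fin m → I) =>
      G (z.1, face i ε z.2)) :
    ContinuousOn G (Set.univ ×ˢ Cube.boundary (Fin (m + 1))) := by
  let A : Fin (m + 1) × Bool → Set (Z × (Fin (m + 1) → I)) :=
    fun a => {z | z.2 a.1 = if a.2 then 1 else 0}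
  have hA : (Set.univ : Set Z) ×ˢ Cube.boundary (Fin (m + 1)) = ⋃ a, A a := by
    ext z
    simp [A, Cube.boundary, Prod.exists]
  rw [hA]
  refine (locallyFinite_of_finite A).continuousOn_iUnion (fun a => ?_) fun a => ?_
  · exact isClosed_eq ((continuous_apply a.1).comp continuous_snd) continuous_const
  · have h1 := h a.1 (if a.2 then 1 else 0) (by cases a.2 <;> simp)
    have h2 : Continuous fun z : Z × (Fin (m + 1) → I) =>
        (z.1, fun j => z.2 (a.1.succAbove j)) := by fun_prop
    refine (h1.comp h2).continuousOn.congr fun z hz => ?_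
    change G z = G (z.1, face a.1 _ fun j => z.2 (a.1.succAbove j))
    rw [face_removeNth hz]

lemma continuousOn_boundary {g : (Fin (m + 1) → I) → X}
    (h : ∀ i, ∀ ε : I, (ε = 0 ∨ ε = 1) → Continuous fun y => g (face i ε y)) :
    ContinuousOn g (Cube.boundary (Fin (m + 1))) := by
  have := continuousOn_prod_boundary (Z := Unit) (G := fun z => g z.2)
    fun i ε hε => (h i ε hε).comp continuous_snd
  exact this.comp (f := fun y => ((), y)) (by fun_prop) fun y hy => ⟨trivial, hy⟩

/-- Compatible maps on the faces of a cube can be glued. -/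
lemma exists_glue {X Z : Type*} (u : Fin (m + 1) → I → Z × (Fin m → I) → X)
    (hu : ∀ i i' ε ε' z y y', (ε = 0 ∨ ε = 1) → (ε' = 0 ∨ ε' = 1) →
      face i ε y = face i' ε' y' → u i ε (z, y) = u i' ε' (z, y')) :
    ∃ G : Z × (Fin (m + 1) → I) → X, ∀ i, ∀ ε : I, (ε = 0 ∨ ε = 1) →
      ∀ z y, G (z, face i ε y) = u i ε (z, y) := by
  classical
  -- Values off the boundary are irrelevant; `u 0 0` is used there only to have some element of `X`.
  refine ⟨fun z => if h : ∃ i, ∃ ε : I, (ε = 0 ∨ ε = 1) ∧ ∃ w, z.2 = face i ε w then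
    u h.choose h.choose_spec.choose (z.1, h.choose_spec.choose_spec.2.choose)
    else u 0 0 (z.1, fun j => z.2 j.succ), fun i ε hε z y => ?_⟩
  have h : ∃ i', ∃ ε' : I, (ε' = 0 ∨ ε' = 1) ∧ ∃ w, face i ε y = face i' ε' w :=
    ⟨i, ε, hε, y, rfl⟩
  dsimp only
  rw [dif_pos h]
  exact (hu _ _ _ _ _ _ _ hε h.choose_spec.choose_spec.1
    h.choose_spec.choose_spec.2.choose_spec).symm

end BoundaryContinuity

/-! ### The homotopy extension property of a cube and its boundary -/

section HomotopyExtension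

variable {m : ℕ}

/-- The scaling factor of the radial retraction from `(2, center)`. -/
noncomputable def boxScale (z : I × (Fin m → I)) : ℝ :=
  max ‖fun i => 2 * (z.2 i : ℝ) - 1‖ (1 - (z.1 : ℝ) / 2)

/-- The radial retraction of `I × I^m` onto `{0} × I^m ∪ I × ∂I^m`. -/
noncomputable def boxRetract (z : I × (Fin m → I)) : I × (Fin m → I) :=
  (Set.projIcc 0 1 zero_le_one (2 - (2 - (z.1 : ℝ)) / boxScale z),
    fun i => Set.projIcc 0 1 zero_le_one (((2 * (z.2 i : ℝ) - 1) / boxScale z + 1) / 2))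

lemma boxScale_pos (z : I × (Fin m → I)) : 0 < boxScale z :=
  lt_max_of_lt_right (by have := z.1.2.2; linarith)

lemma continuous_boxRetract : Continuous (boxRetract (m := m)) := by
  have h : Continuous (boxScale (m := m)) := by unfold boxScale; fun_prop
  have h0 := fun z => (boxScale_pos (m := m) z).ne'
  refine Continuous.prodMk (continuous_projIcc.comp ?_)
    (continuous_pi fun i => continuous_projIcc.comp ?_) <;> fun_prop (disch := exact h0)

lemma norm_center_le (y : Fin m → I) : ‖fun i => 2 * (y i : ℝ) - 1‖ ≤ 1 := by
  refine (pi_norm_le_iff_of_nonneg zero_le_one).2 fun i => ?_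
  rw [Real.norm_eq_abs, abs_le]
  have := (y i).2
  constructor <;> linarith [this.1, this.2]

lemma boxRetract_mem (z : I × (Fin m → I)) :
    (boxRetract z).1 = 0 ∨ (boxRetract z).2 ∈ Cube.boundary (Fin m) := by
  -- In the coordinates `2y - 1` the cube is the unit ball of the sup norm. The two terms of the
  -- maximum in `boxScale` decide whether the ray from `(2, center)` leaves through the bottom or
  -- through a side.
  rcases le_or_gt ‖fun i => 2 * (z.2 i : ℝ) - 1‖ (1 - (z.1 : ℝ) / 2) with h | h
  · left
    have hz := z.1.2.2
    have h1 : boxScale z = 1 - (z.1 : ℝ) / 2 := max_eq_right h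
    have h2 : 2 - (2 - (z.1 : ℝ)) / boxScale z = 0 := by
      have h3 := boxScale_pos z
      field_simp
      rw [h1]; ring
    simp only [boxRetract, h2]
    exact Set.projIcc_left zero_le_one
  · right
    have h1 : boxScale z = ‖fun i => 2 * (z.2 i : ℝ) - 1‖ := max_eq_left h.le
    have h0 := boxScale_pos z
    obtain ⟨i, hi⟩ : ∃ i, boxScale z ≤ ‖2 * (z.2 i : ℝ) - 1‖ := by
      by_contra! hc
      have := (pi_norm_lt_iff h0).2 hc
      rw [← h1] at this
      exact lt_irrefl _ this
    refine ⟨i, ?_⟩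
    simp only [boxRetract]
    rw [Real.norm_eq_abs, le_abs] at hi
    rcases hi with hi | hi
    · right
      refine Set.projIcc_of_right_le zero_le_one ?_
      have : 1 ≤ (2 * (z.2 i : ℝ) - 1) / boxScale z := (one_le_div h0).2 hi
      linarith
    · left
      refine Set.projIcc_of_le_left zero_le_one ?_
      have : (2 * (z.2 i : ℝ) - 1) / boxScale z ≤ -1 := by rw [div_le_iff₀ h0]; linarith
      linarith

lemma boxRetract_eq {z : I × (Fin m → I)} (hz : z.1 = 0 ∨ z.2 ∈ Cube.boundary (Fin m)) :
    boxRetract z = z := by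
  have h1 : boxScale z = 1 := by
    have hl := norm_center_le z.2
    have ht := z.1.2.1
    apply le_antisymm (max_le hl (by linarith))
    rcases hz with hz | ⟨i, hi⟩
    · refine le_max_of_le_right ?_
      rw [hz]; simp
    · refine le_max_of_le_left ?_
      refine le_trans ?_ (norm_le_pi_norm (fun i => 2 * (z.2 i : ℝ) - 1) i)
      rcases hi with hi | hi <;> rw [hi] <;> norm_num
  have h2 : 2 - (2 - (z.1 : ℝ)) / 1 = z.1 := by ring
  have h3 : ∀ i, ((2 * (z.2 i : ℝ) - 1) / 1 + 1) / 2 = z.2 i := fun i => by ring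
  ext1
  · simp only [boxRetract, h1, h2, Set.projIcc_val]
  · ext1 i
    simp only [boxRetract, h1, h3, Set.projIcc_val]

/-- The data fit together on `{0} × I^m ∪ I × ∂I^m`, and precomposition with `boxRetract` extends
them. -/
theorem exists_homotopy_extension {X : Type*} [TopologicalSpace X] {g : (Fin m → I) → X}
    (hg : Continuous g) {H : I × (Fin m → I) → X}
    (hH : ContinuousOn H (Set.univ ×ˢ Cube.boundary (Fin m)))
    (h0 : ∀ y ∈ Cube.boundary (Fin m), H (0, y) = g y) :
    ∃ G : I × (Fin m → I) → X, Continuous G ∧ (∀ y, G (0, y) = g y) ∧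
      ∀ t, ∀ y ∈ Cube.boundary (Fin m), G (t, y) = H (t, y) := by
  classical
  let β : I × (Fin m → I) → X := fun z => if z.1 = 0 then g z.2 else H z
  have hβH : Set.EqOn β H (Set.univ ×ˢ Cube.boundary (Fin m)) := by
    rintro ⟨t, y⟩ hy
    simp only [β]
    split_ifs with h
    · rw [h, h0 y hy.2]
    · rfl
  have hβ : ContinuousOn β ({z | z.1 = 0} ∪ Set.univ ×ˢ Cube.boundary (Fin m)) := by
    refine ContinuousOn.union_of_isClosed ?_ (hH.congr hβH)
      (isClosed_eq continuous_fst continuous_const) (isClosed_univ.prod (isClosed_boundary m))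
    exact (hg.comp continuous_snd).continuousOn.congr fun z hz => if_pos hz
  refine ⟨fun z => β (boxRetract z), ?_, fun y => ?_, fun t y hy => ?_⟩
  · exact hβ.comp_continuous continuous_boxRetract fun z =>
      (boxRetract_mem z).imp id fun h => ⟨trivial, h⟩
  · dsimp only
    rw [boxRetract_eq (Or.inl rfl)]
    exact if_pos rfl
  · dsimp only
    rw [boxRetract_eq (Or.inr hy)]
    exact hβH ⟨trivial, hy⟩

end HomotopyExtension

/-! ### The cubical coboundary -/

section CubicalCoboundary

variable {m : ℕ} {X A : Type*} [AddCommGroup A]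

/-- The cubical coboundary of a function on (not necessarily continuous) cubes in `X`. -/
def cubeD (φ : ((Fin m → I) → X) → A) (h : (Fin (m + 1) → I) → X) : A :=
  ∑ i : Fin (m + 1), (-1 : ℤ) ^ (i : ℕ) • (φ (h ∘ face i 1) - φ (h ∘ face i 0))

/-- Faces of codimension two occur twice, once for each order of the two directions, with opposite
signs. Continuity plays no role. -/
lemma cubeD_cubeD (φ : ((Fin m → I) → X) → A) (h : (Fin (m + 2) → I) → X) :
    cubeD (cubeD φ) h = 0 := by
  let b : Fin (m + 2) → Fin (m + 1) → I → I → A := fun i l ε ε' =>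
    φ ((h ∘ face i ε) ∘ face l ε')
  have hb : ∀ i l ε ε', b i l ε ε' = b (i.succAbove l) (l.predAbove i) ε' ε := by
    intro i l ε ε'
    simp only [b]
    congr 1
    ext1 w
    simp only [Function.comp_apply]
    rw [face_face]
  let c : Fin (m + 2) × Fin (m + 1) → A := fun a => (-1 : ℤ) ^ (a.1 + a.2 : ℕ) •
    (b a.1 a.2 1 1 - b a.1 a.2 1 0 - b a.1 a.2 0 1 + b a.1 a.2 0 0)
  have h1 : cubeD (cubeD φ) h = ∑ a, c a := by
    rw [Fintype.sum_prod_type]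
    refine Finset.sum_congr rfl fun i _ => ?_
    rw [cubeD, cubeD, ← Finset.sum_sub_distrib, Finset.smul_sum]
    refine Finset.sum_congr rfl fun l _ => ?_
    rw [← smul_sub, smul_smul, ← pow_add]
    simp only [c, b]
    congr 1
    abel
  rw [h1]
  refine Finset.sum_involution (fun a _ => (a.1.succAbove a.2, a.2.predAbove a.1)) ?_ ?_ ?_ ?_
  · rintro ⟨i, l⟩ -
    simp only [c]
    rw [Fin.neg_one_pow_succAbove_add_predAbove, ← hb i l 1 1, ← hb i l 0 1, ← hb i l 1 0,
      ← hb i l 0 0, neg_smul, ← sub_eq_add_neg, ← smul_sub]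
    rw [show ∀ x y z w : A, x - y - z + w - (x - z - y + w) = 0 by intros; abel, smul_zero]
  · rintro ⟨i, l⟩ - - h
    exact Fin.succAbove_ne i l (Prod.ext_iff.1 h).1
  · simp
  · rintro ⟨i, l⟩ -
    ext1
    · exact Fin.succAbove_succAbove_predAbove i l
    · apply Fin.succAbove_right_injective (p := i)
      have h := Fin.succAbove_succAbove_predAbove (i.succAbove l) (l.predAbove i)
      rwa [Fin.succAbove_succAbove_predAbove i l] at h

end CubicalCoboundary

/-! ### The homotopy addition theorem for cubes -/

section HomotopyAddition

open Function

variable {m d : ℕ} {X A : Type*} [TopologicalSpace X] [AddCommGroup A] {b : X}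

/-- `f` is a continuous map on a cube that is constant with value `b` on the boundary. -/
def IsLoop (b : X) (f : (Fin m → I) → X) : Prop :=
  Continuous f ∧ ∀ y ∈ Cube.boundary (Fin m), f y = b

lemma isLoop_const : IsLoop b fun _ : Fin m → I => b := ⟨continuous_const, fun _ _ => rfl⟩

/-- Concatenation of maps on cubes in the `i`-th direction. -/
noncomputable def concat {X : Type*} (i : Fin m) (f g : (Fin m → I) → X) (y : Fin m → I) : X :=
  if (y i : ℝ) ≤ 1 / 2 then f (update y i (Set.projIcc 0 1 zero_le_one (2 * (y i : ℝ))))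
  else g (update y i (Set.projIcc 0 1 zero_le_one (2 * (y i : ℝ) - 1)))

lemma continuous_concat {i : Fin m} {f g : (Fin m → I) → X} (hf : Continuous f)
    (hg : Continuous g) (h : ∀ y, f (update y i 1) = g (update y i 0)) :
    Continuous (concat i f g) := by
  refine Continuous.if_le (hf.comp ?_) (hg.comp ?_) (by fun_prop) continuous_const ?_
  · exact continuous_id.update i (continuous_projIcc.comp (by fun_prop))
  · exact continuous_id.update i (continuous_projIcc.comp (by fun_prop))
  · intro y hy
    rw [hy, show (2 : ℝ) * (1 / 2) = 1 by norm_num, sub_self, Set.projIcc_left, Set.projIcc_right]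
    exact h y

lemma concat_zero {X : Type*} {i : Fin m} {f g : (Fin m → I) → X} {y : Fin m → I} (h : y i = 0) :
    concat i f g y = f y := by
  have h0 : Set.projIcc (0 : ℝ) 1 zero_le_one (2 * ((0 : I) : ℝ)) = y i := by
    rw [Set.Icc.coe_zero, mul_zero, Set.projIcc_left, h]; rfl
  rw [concat, if_pos (by rw [h]; norm_num), ← h] at *
  rw [h0, update_eq_self]

lemma concat_one {X : Type*} {i : Fin m} {f g : (Fin m → I) → X} {y : Fin m → I} (h : y i = 1) :
    concat i f g y = g y := by
  have h0 : Set.projIcc (0 : ℝ) 1 zero_le_one (2 * ((1 : I) : ℝ) - 1) = y i := by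
    rw [Set.Icc.coe_one, show (2 : ℝ) * 1 - 1 = 1 by norm_num, Set.projIcc_right, h]; rfl
  rw [concat, if_neg (by rw [h]; norm_num), h, h0, update_eq_self]

lemma concat_comp_face_same_zero {X : Type*} (i : Fin (m + 1)) (f g : (Fin (m + 1) → I) → X) :
    concat i f g ∘ face i 0 = f ∘ face i 0 := by
  ext1 y; exact concat_zero (face_same i 0 y)

lemma concat_comp_face_same_one {X : Type*} (i : Fin (m + 1)) (f g : (Fin (m + 1) → I) → X) :
    concat i f g ∘ face i 1 = g ∘ face i 1 := by
  ext1 y; exact concat_one (face_same i 1 y)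

lemma update_face_succAbove (j : Fin (m + 1)) (ε : I) (i : Fin m) (y : Fin m → I) (a : I) :
    update (face j ε y) (j.succAbove i) a = face j ε (update y i a) :=
  (Fin.insertNth_update (α := fun _ => I) j ε i a y).symm

lemma concat_comp_face {X : Type*} (j : Fin (m + 1)) (ε : I) (i : Fin m)
    (f g : (Fin (m + 1) → I) → X) :
    concat (j.succAbove i) f g ∘ face j ε = concat i (f ∘ face j ε) (g ∘ face j ε) := by
  ext1 y
  simp only [concat, comp_apply, face_succAbove, update_face_succAbove]

lemma concat_const {X : Type*} (b : X) (i : Fin m) :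
    concat i (fun _ => b) (fun _ => b) = fun _ => b := by
  ext1 y; simp [concat]

lemma update_mem_boundary {i : Fin m} {a : I} (ha : a = 0 ∨ a = 1) (y : Fin m → I) :
    update y i a ∈ Cube.boundary (Fin m) := ⟨i, by simpa using ha⟩

lemma IsLoop.concat {i : Fin m} {f g : (Fin m → I) → X} (hf : IsLoop b f) (hg : IsLoop b g) :
    IsLoop b (concat i f g) := by
  refine ⟨continuous_concat hf.1 hg.1 fun y => ?_, fun y hy => ?_⟩
  · rw [hf.2 _ (update_mem_boundary (Or.inr rfl) y), hg.2 _ (update_mem_boundary (Or.inl rfl) y)]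
  · obtain ⟨j, hj⟩ := hy
    rcases eq_or_ne j i with rfl | hij
    · rcases hj with hj | hj
      · rw [concat_zero hj, hf.2 _ ⟨j, Or.inl hj⟩]
      · rw [concat_one hj, hg.2 _ ⟨j, Or.inr hj⟩]
    · have : ∀ a : I, update y i a ∈ Cube.boundary (Fin m) :=
        fun a => ⟨j, by rwa [update_of_ne hij]⟩
      rw [EulerBordism.concat, hf.2 _ (this _), hg.2 _ (this _), ite_self]

/-- An additive homotopy invariant of based maps of `d`-cubes. -/
structure IsLoopClass (b : X) (cl : ((Fin d → I) → X) → A) : Prop where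
  const : cl (fun _ => b) = 0
  concat : ∀ i f g, IsLoop b f → IsLoop b g → cl (concat i f g) = cl f + cl g
  symm : ∀ i f, IsLoop b f → cl (fun y => f (update y i (unitInterval.symm (y i)))) = -cl f
  homotopy : ∀ h : I × (Fin d → I) → X, Continuous h →
    (∀ t, ∀ y ∈ Cube.boundary (Fin d), h (t, y) = b) →
    cl (fun y => h (0, y)) = cl (fun y => h (1, y))

/-- All faces of the cube `h` are based maps. -/
def HasLoopFaces (b : X) (h : (Fin (m + 1) → I) → X) : Prop :=
  Continuous h ∧ ∀ i, ∀ ε : I, (ε = 0 ∨ ε = 1) → IsLoop b (h ∘ face i ε)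

lemma HasLoopFaces.concat {i : Fin (m + 1)} {f g : (Fin (m + 1) → I) → X}
    (hf : HasLoopFaces b f) (hg : HasLoopFaces b g) (h : f ∘ face i 1 = g ∘ face i 0) :
    HasLoopFaces b (concat i f g) := by
  refine ⟨continuous_concat hf.1 hg.1 fun y => ?_, fun j ε hε => ?_⟩
  · have := congrFun h fun l => y (i.succAbove l)
    have e : ∀ a, face i a (fun l => y (i.succAbove l)) = update y i a := fun a =>
      Fin.insertNth_removeNth (α := fun _ => I) i a y
    simpa only [comp_apply, e] using this
  · rcases Fin.eq_self_or_eq_succAbove j i with rfl | ⟨l, rfl⟩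
    · rcases hε with rfl | rfl
      · rw [concat_comp_face_same_zero]; exact hf.2 _ _ (Or.inl rfl)
      · rw [concat_comp_face_same_one]; exact hg.2 _ _ (Or.inr rfl)
    · rw [concat_comp_face]
      exact (hf.2 _ _ hε).concat (hg.2 _ _ hε)

variable {cl : ((Fin d → I) → X) → A}

/-- In direction `i` the common face cancels; in every other direction the faces are themselves
concatenated, and `cl` is additive. -/
lemma IsLoopClass.cubeD_concat (hcl : IsLoopClass b cl) {i : Fin (d + 1)}
    {f g : (Fin (d + 1) → I) → X}
    (hf : HasLoopFaces b f) (hg : HasLoopFaces b g) (h : f ∘ face i 1 = g ∘ face i 0) :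
    cubeD cl (EulerBordism.concat i f g) = cubeD cl f + cubeD cl g := by
  unfold cubeD
  rw [← Finset.sum_add_distrib]
  refine Finset.sum_congr rfl fun j _ => ?_
  rw [← smul_add]
  congr 1
  rcases Fin.eq_self_or_eq_succAbove j i with rfl | ⟨l, rfl⟩
  · rw [concat_comp_face_same_zero, concat_comp_face_same_one, h]
    abel
  · rw [concat_comp_face, concat_comp_face,
      hcl.concat _ _ _ (hf.2 _ _ (Or.inl rfl)) (hg.2 _ _ (Or.inl rfl)),
      hcl.concat _ _ _ (hf.2 _ _ (Or.inr rfl)) (hg.2 _ _ (Or.inr rfl))]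
    abel

lemma succ_succAbove_self (i : Fin d) : i.succ.succAbove i = i.castSucc :=
  Fin.succAbove_of_castSucc_lt _ _ Fin.castSucc_lt_succ

lemma castSucc_succAbove_self (i : Fin d) : i.castSucc.succAbove i = i.succ :=
  Fin.succAbove_of_le_castSucc _ _ le_rfl

/-- A cube whose faces in all directions other than `i` and `i + 1` are constant. -/
def slide {X : Type*} (i : Fin d) (w : I × I → I) (f : (Fin d → I) → X) (y : Fin (d + 1) → I) : X :=
  f (update (fun l => y (i.succ.succAbove l)) i (w (y i.castSucc, y i.succ)))

lemma continuous_slide {i : Fin d} {w : I × I → I} (hw : Continuous w) {f : (Fin d → I) → X}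
    (hf : Continuous f) : Continuous (slide i w f) :=
  hf.comp ((continuous_pi fun _ => continuous_apply _).update i
    (hw.comp ((continuous_apply _).prodMk (continuous_apply _))))

lemma slide_comp_face_succ {X : Type*} (i : Fin d) (w : I × I → I) (f : (Fin d → I) → X) (ε : I) :
    slide i w f ∘ face i.succ ε = fun y => f (update y i (w (y i, ε))) := by
  ext1 y
  have h : face i.succ ε y i.castSucc = y i := by
    conv_lhs => rw [← succ_succAbove_self i]
    exact face_succAbove _ _ _ _
  simp only [slide, comp_apply, h, face_same, face_succAbove]

lemma slide_comp_face_castSucc {X : Type*} (i : Fin d) (w : I × I → I)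
    (f : (Fin d → I) → X) (ε : I) :
    slide i w f ∘ face i.castSucc ε = fun y => f (update y i (w (ε, y i))) := by
  ext1 y
  have h : face i.castSucc ε y i.succ = y i := by
    conv_lhs => rw [← castSucc_succAbove_self i]
    exact face_succAbove _ _ _ _
  simp only [slide, comp_apply, h, face_same]
  congr 1
  ext1 l
  rcases eq_or_ne l i with rfl | hl
  · simp
  · rw [update_of_ne hl, update_of_ne hl]
    have : i.succ.succAbove l = i.castSucc.succAbove l := by
      rcases lt_or_gt_of_ne hl with hl | hl <;>
        simp only [Fin.lt_def] at hl
      · rw [Fin.succAbove_of_castSucc_lt _ _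
            (by simp only [Fin.lt_def, Fin.val_castSucc, Fin.val_succ]; omega),
          Fin.succAbove_of_castSucc_lt _ _ (by simp only [Fin.lt_def, Fin.val_castSucc]; omega)]
      · rw [Fin.succAbove_of_le_castSucc _ _
            (by simp only [Fin.le_def, Fin.val_castSucc, Fin.val_succ]; omega),
          Fin.succAbove_of_le_castSucc _ _ (by simp only [Fin.le_def, Fin.val_castSucc]; omega)]
    rw [this, face_succAbove]

lemma slide_comp_face_of_ne {i : Fin d} {w : I × I → I} {f : (Fin d → I) → X} (hf : IsLoop b f)
    {j : Fin (d + 1)} (hj : j ≠ i.succ) (hj' : j ≠ i.castSucc) {ε : I} (hε : ε = 0 ∨ ε = 1) :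
    slide i w f ∘ face j ε = fun _ => b := by
  ext1 y
  obtain ⟨l, rfl⟩ := Fin.exists_succAbove_eq hj
  refine hf.2 _ ⟨l, ?_⟩
  have hl : l ≠ i := by
    rintro rfl
    exact hj' (succ_succAbove_self l)
  rw [update_of_ne hl, face_same]
  exact hε

lemma IsLoop.reverse {i : Fin d} {f : (Fin d → I) → X} (hf : IsLoop b f) :
    IsLoop b fun y => f (update y i (unitInterval.symm (y i))) := by
  refine ⟨hf.1.comp (continuous_id.update i
    (unitInterval.continuous_symm.comp (continuous_apply i))), fun y ⟨j, hj⟩ => hf.2 _ ⟨j, ?_⟩⟩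
  rcases eq_or_ne j i with rfl | h
  · rw [update_self]
    rcases hj with hj | hj <;> simp [hj]
  · rwa [update_of_ne h]

lemma sum_eq_castSucc_add_succ (i : Fin d) (c : Fin (d + 1) → A)
    (h : ∀ j, j ≠ i.succ → j ≠ i.castSucc → c j = 0) :
    ∑ j, c j = c i.castSucc + c i.succ := by
  rw [← Finset.sum_pair (Fin.castSucc_lt_succ (i := i)).ne]
  symm
  refine Finset.sum_subset (Finset.subset_univ _) fun j _ hj => ?_
  simp only [Finset.mem_insert, Finset.mem_singleton, not_or] at hj
  exact h j hj.2 hj.1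

/-- A collar to be glued after a cube in direction `i + 1`: it ends in the constant map and
transfers `f` to direction `i` without changing `cubeD`. -/
lemma IsLoopClass.exists_slide_zero (hcl : IsLoopClass b cl) (i : Fin d) {f : (Fin d → I) → X}
    (hf : IsLoop b f) : ∃ r, HasLoopFaces b r ∧ r ∘ face i.succ 0 = f ∧
      (r ∘ face i.succ 1 = fun _ => b) ∧ cubeD cl r = 0 ∧
      ∀ j, j ≠ i.succ → j ≠ i.castSucc → ∀ ε : I, (ε = 0 ∨ ε = 1) →
        r ∘ face j ε = fun _ => b := by
  -- The slide by `max (a - b) 0` carries `f` on the face `b = 0`, the reversal of `f` on `a = 1`,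
  -- and constants on the other two; the reversal compensates for the opposite position of the
  -- faces.
  let w : I × I → I := fun a => Set.projIcc 0 1 zero_le_one ((a.1 : ℝ) - a.2)
  have hw : Continuous w := continuous_projIcc.comp (by fun_prop)
  have w1 : ∀ a, w (a, 0) = a := fun a => by simp [w]
  have w2 : ∀ a, w (a, 1) = 0 := fun a =>
    Set.projIcc_of_le_left zero_le_one (by have := a.2.2; simp only [Set.Icc.coe_one]; linarith)
  have w3 : ∀ a, w (0, a) = 0 := fun a =>
    Set.projIcc_of_le_left zero_le_one (by have := a.2.1; simp only [Set.Icc.coe_zero]; linarith)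
  have w4 : ∀ a, w (1, a) = unitInterval.symm a := fun a => by
    have := Set.projIcc_val zero_le_one (unitInterval.symm a)
    simpa [w, unitInterval.coe_symm_eq] using this
  have f1 : slide i w f ∘ face i.succ 0 = f := by
    rw [slide_comp_face_succ]; ext1 y; rw [w1, update_eq_self]
  have f2 : slide i w f ∘ face i.succ 1 = fun _ => b := by
    rw [slide_comp_face_succ]; ext1 y; rw [w2, hf.2 _ (update_mem_boundary (Or.inl rfl) y)]
  have f3 : slide i w f ∘ face i.castSucc 0 = fun _ => b := by
    rw [slide_comp_face_castSucc]; ext1 y; rw [w3, hf.2 _ (update_mem_boundary (Or.inl rfl) y)]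
  have f4 : slide i w f ∘ face i.castSucc 1 =
      fun y => f (update y i (unitInterval.symm (y i))) := by
    rw [slide_comp_face_castSucc]; ext1 y; rw [w4]
  refine ⟨slide i w f, ⟨continuous_slide hw hf.1, fun j ε hε => ?_⟩, f1, f2, ?_,
    fun j h1 h2 ε hε => slide_comp_face_of_ne hf h1 h2 hε⟩
  · by_cases h1 : j = i.succ
    · subst h1
      rcases hε with rfl | rfl
      · rwa [f1]
      · rw [f2]; exact isLoop_const
    by_cases h2 : j = i.castSucc
    · subst h2
      rcases hε with rfl | rfl
      · rw [f3]; exact isLoop_const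
      · rw [f4]; exact hf.reverse
    rw [slide_comp_face_of_ne hf h1 h2 hε]
    exact isLoop_const
  · rw [cubeD, sum_eq_castSucc_add_succ i]
    · rw [f1, f2, f3, f4, hcl.symm i f hf, hcl.const, Fin.val_castSucc, Fin.val_succ, pow_succ]
      simp
    · intro j h1 h2
      rw [slide_comp_face_of_ne hf h1 h2 (Or.inl rfl), slide_comp_face_of_ne hf h1 h2 (Or.inr rfl),
        sub_self, smul_zero]

/-- The mirror collar, to be glued before a cube in direction `i + 1`. -/
lemma IsLoopClass.exists_slide_one (hcl : IsLoopClass b cl) (i : Fin d) {f : (Fin d → I) → X}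
    (hf : IsLoop b f) : ∃ r, HasLoopFaces b r ∧ r ∘ face i.succ 1 = f ∧
      (r ∘ face i.succ 0 = fun _ => b) ∧ cubeD cl r = 0 ∧
      ∀ j, j ≠ i.succ → j ≠ i.castSucc → ∀ ε : I, (ε = 0 ∨ ε = 1) →
        r ∘ face j ε = fun _ => b := by
  -- Here `f` appears on the faces `a = 1` and `b = 1`. The signs of the two adjacent directions are
  -- opposite, so no reversal is needed.
  let w : I × I → I := fun a => Set.projIcc 0 1 zero_le_one ((a.1 : ℝ) + a.2 - 1)
  have hw : Continuous w := continuous_projIcc.comp (by fun_prop)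
  have w1 : ∀ a, w (a, 1) = a := fun a => by simp [w]
  have w2 : ∀ a, w (a, 0) = 0 := fun a =>
    Set.projIcc_of_le_left zero_le_one (by have := a.2.2; simp only [Set.Icc.coe_zero]; linarith)
  have w3 : ∀ a, w (0, a) = 0 := fun a =>
    Set.projIcc_of_le_left zero_le_one (by have := a.2.2; simp only [Set.Icc.coe_zero]; linarith)
  have w4 : ∀ a, w (1, a) = a := fun a => by simp [w]
  have f1 : slide i w f ∘ face i.succ 1 = f := by
    rw [slide_comp_face_succ]; ext1 y; rw [w1, update_eq_self]
  have f2 : slide i w f ∘ face i.succ 0 = fun _ => b := by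
    rw [slide_comp_face_succ]; ext1 y; rw [w2, hf.2 _ (update_mem_boundary (Or.inl rfl) y)]
  have f3 : slide i w f ∘ face i.castSucc 0 = fun _ => b := by
    rw [slide_comp_face_castSucc]; ext1 y; rw [w3, hf.2 _ (update_mem_boundary (Or.inl rfl) y)]
  have f4 : slide i w f ∘ face i.castSucc 1 = f := by
    rw [slide_comp_face_castSucc]; ext1 y; rw [w4, update_eq_self]
  refine ⟨slide i w f, ⟨continuous_slide hw hf.1, fun j ε hε => ?_⟩, f1, f2, ?_,
    fun j h1 h2 ε hε => slide_comp_face_of_ne hf h1 h2 hε⟩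
  · by_cases h1 : j = i.succ
    · subst h1
      rcases hε with rfl | rfl
      · rw [f2]; exact isLoop_const
      · rwa [f1]
    by_cases h2 : j = i.castSucc
    · subst h2
      rcases hε with rfl | rfl
      · rw [f3]; exact isLoop_const
      · rwa [f4]
    rw [slide_comp_face_of_ne hf h1 h2 hε]
    exact isLoop_const
  · rw [cubeD, sum_eq_castSucc_add_succ i]
    · rw [f1, f2, f3, f4, hcl.const, Fin.val_castSucc, Fin.val_succ, pow_succ]
      simp
    · intro j h1 h2
      rw [slide_comp_face_of_ne hf h1 h2 (Or.inl rfl), slide_comp_face_of_ne hf h1 h2 (Or.inr rfl),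
        sub_self, smul_zero]

/-- The faces in direction `i + 1` can be moved to direction `i`. -/
lemma IsLoopClass.exists_trivialize_face (hcl : IsLoopClass b cl) (i : Fin d)
    {h : (Fin (d + 1) → I) → X} (hh : HasLoopFaces b h) :
    ∃ h', HasLoopFaces b h' ∧ cubeD cl h' = cubeD cl h ∧
      (∀ ε : I, (ε = 0 ∨ ε = 1) → h' ∘ face i.succ ε = fun _ => b) ∧
      ∀ j, i.succ < j → ∀ ε : I, (ε = 0 ∨ ε = 1) → (h ∘ face j ε = fun _ => b) →
        h' ∘ face j ε = fun _ => b := by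
  obtain ⟨r, hr, r0, r1, rD, rj⟩ := hcl.exists_slide_zero i (hh.2 i.succ 1 (Or.inr rfl))
  have h1 := hh.concat hr r0.symm
  obtain ⟨r', hr', r0', r1', rD', rj'⟩ := hcl.exists_slide_one i (h1.2 i.succ 0 (Or.inl rfl))
  refine ⟨_, hr'.concat h1 r0', ?_, ?_, fun j hj ε hε hc => ?_⟩
  · rw [hcl.cubeD_concat hr' h1 r0', hcl.cubeD_concat hh hr r0.symm, rD, rD', zero_add, add_zero]
  · rintro ε (rfl | rfl)
    · rw [concat_comp_face_same_zero, r1']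
    · rw [concat_comp_face_same_one, concat_comp_face_same_one, r1]
  · have hne : j ≠ i.castSucc := ((Fin.castSucc_lt_succ (i := i)).trans hj).ne'
    have h3 := rj j hj.ne' hne ε hε
    have h4 := rj' j hj.ne' hne ε hε
    obtain ⟨l, hl⟩ := Fin.exists_succAbove_eq hj.ne
    rw [← hl, concat_comp_face, concat_comp_face, h3, h4, hc, concat_const, concat_const]

/-- The nontrivial faces are pushed from each direction into the preceding one without changing
`cubeD`. When only direction `0` is left, the cube is itself a based homotopy between its two
remaining faces. -/
theorem IsLoopClass.cubeD_eq_zero (hcl : IsLoopClass b cl) {h : (Fin (d + 1) → I) → X}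
    (hh : HasLoopFaces b h) : cubeD cl h = 0 := by
  -- The induction parameter `n` bounds the directions whose faces may be nonconstant; `n = d`
  -- imposes no condition.
  suffices H : ∀ n : ℕ, ∀ h : (Fin (d + 1) → I) → X, HasLoopFaces b h →
      (∀ j : Fin (d + 1), n < j → ∀ ε : I, (ε = 0 ∨ ε = 1) → h ∘ face j ε = fun _ => b) →
      cubeD cl h = 0 from
    H d h hh fun j hj => absurd j.2 (by omega)
  intro n
  induction n with
  | zero =>
    intro h hh hj
    rw [cubeD, Fin.sum_univ_succ, Finset.sum_eq_zero, add_zero, Fin.val_zero, pow_zero, one_smul,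
      sub_eq_zero]
    · refine (hcl.homotopy (fun z => h (face 0 z.1 z.2)) (hh.1.comp continuous_face_zero) ?_).symm
      rintro t y ⟨l, hl⟩
      have := hj l.succ (by simp) (y l) hl
      have e : face 0 t y l.succ = y l := face_zero_succ t y l
      rw [← face_removeNth e]
      exact congrFun this _
    · intro l _
      rw [hj l.succ (by simp) 1 (Or.inr rfl), hj l.succ (by simp) 0 (Or.inl rfl), sub_self,
        smul_zero]
  | succ n ih =>
    intro h hh hj
    rcases lt_or_ge n d with hn | hn
    · obtain ⟨h', hh', hD, hi, hgt⟩ := hcl.exists_trivialize_face ⟨n, hn⟩ hh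
      rw [← hD]
      refine ih h' hh' fun j hnj ε hε => ?_
      rcases eq_or_ne (j : ℕ) (n + 1) with e | e
      · have : j = Fin.succ ⟨n, hn⟩ := Fin.ext e
        rw [this]
        exact hi ε hε
      · have hlt : n + 1 < (j : ℕ) := by omega
        exact hgt j (by simpa [Fin.lt_def] using hlt) ε hε (hj j hlt ε hε)
    · exact ih h hh fun j hnj => absurd j.2 (by omega)

end HomotopyAddition

/-! ### Extension of maps into spheres -/

section SphereExtension

/-- Maps from the boundary of the `m`-cube to `X` extend to the cube. -/
def CubeExtension (X : Type*) [TopologicalSpace X] (m : ℕ) : Prop :=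
  ∀ g : (Fin m → I) → X, ContinuousOn g (Cube.boundary (Fin m)) →
    ∃ G, Continuous G ∧ Set.EqOn G g (Cube.boundary (Fin m))

/-- Radial projection to the unit sphere. -/
noncomputable def toSphere {k : ℕ} (x : EuclideanSpace ℝ (Fin (k + 1))) : Sph (k + 1) :=
  open Classical in
  if h : x = 0 then basePt k else ⟨‖x‖⁻¹ • x, by simp [norm_smul, h]⟩

lemma continuousOn_toSphere (k : ℕ) :
    ContinuousOn (toSphere (k := k)) {x | x ≠ 0} := by
  rw [Topology.IsInducing.subtypeVal.continuousOn_iff]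
  have h : ContinuousOn (fun x : EuclideanSpace ℝ (Fin (k + 1)) => ‖x‖⁻¹ • x) {x | x ≠ 0} :=
    ContinuousOn.smul (continuous_norm.continuousOn.inv₀ fun x hx => norm_ne_zero_iff.2 hx)
      continuousOn_id
  refine h.congr fun x hx => ?_
  simp only [Function.comp_apply, toSphere, dif_neg hx]

lemma toSphere_coe {k : ℕ} (x : Sph (k + 1)) :
    toSphere (x : EuclideanSpace ℝ (Fin (k + 1))) = x := by
  have hx : ‖(x : EuclideanSpace ℝ (Fin (k + 1)))‖ = 1 := by simp
  have h0 : (x : EuclideanSpace ℝ (Fin (k + 1))) ≠ 0 := by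
    rw [← norm_ne_zero_iff, hx]; exact one_ne_zero
  ext1
  simp only [toSphere, dif_neg h0, hx, inv_one, one_smul]

/-- A `C¹` approximation `ℝ^m → ℝ^{k+1}` with `m < k + 1` misses a dense set of points. Translating
a missed point to the origin gives a nowhere zero map on the cube, which on the boundary is joined
to `g` by nonvanishing segments. Radial projection and homotopy extension then give an extension of
`g` itself. -/
theorem cubeExtension_sphere {k m : ℕ} (hm : m ≤ k) : CubeExtension (Sph (k + 1)) m := by
  intro g hg
  let E := EuclideanSpace ℝ (Fin (k + 1))
  obtain ⟨f, hf⟩ := ContinuousMap.exists_restrict_eq (isClosed_boundary m)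
    (⟨fun y => (g y : E), continuous_subtype_val.comp hg.domRestrict⟩ :
      C(Cube.boundary (Fin m), E))
  have hfg : ∀ y ∈ Cube.boundary (Fin m), f y = g y := fun y hy =>
    DFunLike.congr_fun hf ⟨y, hy⟩
  let c : (Fin m → ℝ) → (Fin m → I) := fun x i => Set.projIcc 0 1 zero_le_one (x i)
  have hc : Continuous c := continuous_pi fun i => continuous_projIcc.comp (continuous_apply i)
  -- The approximation error and the translation `a` are each less than `1/4`, so `P` differs from
  -- `f` by at most `1/2`, less than the norm `1` of `f` on the boundary.
  obtain ⟨q, hq, hqf, -⟩ := (f.continuous.comp hc).exists_contDiff_approx 1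
    (ε := fun _ => 1 / 4) continuous_const fun _ => by norm_num
  have hd := hq.dense_compl_range_of_finrank_lt_finrank (by simp [E]; omega)
  obtain ⟨a, ha, haq⟩ := hd.exists_mem_open Metric.isOpen_ball
    (⟨0, Metric.mem_ball_self (by norm_num)⟩ : (Metric.ball (0 : E) (1 / 4)).Nonempty)
  let j : (Fin m → I) → (Fin m → ℝ) := fun y i => y i
  have hj : Continuous j := by fun_prop
  have hcj : ∀ y, c (j y) = y := fun y => by
    ext1 i; exact Set.projIcc_val zero_le_one (y i)
  let P : (Fin m → I) → E := fun y => q (j y) - a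
  have hP : Continuous P := (hq.continuous.comp hj).sub continuous_const
  have hP0 : ∀ y, P y ≠ 0 := fun y h => ha ⟨j y, sub_eq_zero.1 h⟩
  have hPf : ∀ y, ‖P y - f y‖ ≤ 1 / 2 := fun y => by
    have h1 := hqf (j y)
    rw [Function.comp_apply, hcj, dist_eq_norm] at h1
    rw [mem_ball_zero_iff] at haq
    calc ‖P y - f y‖ = ‖(q (j y) - f y) - a‖ := by simp only [P]; congr 1; abel
      _ ≤ ‖q (j y) - f y‖ + ‖a‖ := norm_sub_le _ _
      _ ≤ 1 / 2 := by linarith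
  let R : I × (Fin m → I) → E := fun z => P z.2 + (z.1 : ℝ) • (f z.2 - P z.2)
  have hR : Continuous R := by fun_prop
  have hR0 : ∀ z ∈ (Set.univ : Set I) ×ˢ Cube.boundary (Fin m), R z ≠ 0 := by
    rintro ⟨t, y⟩ ⟨-, hy⟩ h
    have h1 : ‖f y‖ = 1 := by
      rw [hfg y hy]; simp
    have h2 : f y = (1 - (t : ℝ)) • (f y - P y) := by
      have : R (t, y) = f y - (1 - (t : ℝ)) • (f y - P y) := by
        simp only [R, sub_smul, one_smul]; abel
      rw [this, sub_eq_zero] at h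
      exact h
    have h3 : ‖f y‖ ≤ 1 * (1 / 2) := by
      rw [h2, norm_smul, norm_sub_rev (f y)]
      refine mul_le_mul ?_ (hPf y) (norm_nonneg _) zero_le_one
      rw [Real.norm_eq_abs, abs_le]
      have := t.2
      constructor <;> linarith [this.1, this.2]
    linarith
  obtain ⟨G, hG, -, hGb⟩ := exists_homotopy_extension (g := fun y => toSphere (P y))
    (H := fun z => toSphere (R z))
    ((continuousOn_toSphere k).comp_continuous hP hP0)
    ((continuousOn_toSphere k).comp hR.continuousOn hR0)
    fun y _ => by simp [R]
  refine ⟨fun y => G (1, y), hG.comp (by fun_prop), fun y hy => ?_⟩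
  have : R (1, y) = g y := by simp [R, hfg y hy]
  change G (1, y) = g y
  rw [hGb 1 y hy, this, toSphere_coe]

lemma CubeExtension.prod {X Y : Type*} [TopologicalSpace X] [TopologicalSpace Y] {m : ℕ}
    (hX : CubeExtension X m) (hY : CubeExtension Y m) : CubeExtension (X × Y) m := by
  intro g hg
  obtain ⟨G, hG, hGg⟩ := hX _ (continuous_fst.comp_continuousOn hg)
  obtain ⟨G', hG', hGg'⟩ := hY _ (continuous_snd.comp_continuousOn hg)
  exact ⟨fun y => (G y, G' y), hG.prodMk hG', fun y hy => Prod.ext (hGg hy) (hGg' hy)⟩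

/-- Tietze extension to `ℝ`, followed by clamping to `[0, 1]`. -/
lemma cubeExtension_unitInterval (m : ℕ) : CubeExtension I m := by
  intro g hg
  obtain ⟨f, hf⟩ := ContinuousMap.exists_restrict_eq (isClosed_boundary m)
    (⟨fun y => (g y : ℝ), continuous_subtype_val.comp hg.domRestrict⟩ : C(Cube.boundary (Fin m), ℝ))
  refine ⟨fun y => Set.projIcc 0 1 zero_le_one (f y), continuous_projIcc.comp f.continuous,
    fun y hy => ?_⟩
  have : f y = g y := DFunLike.congr_fun hf ⟨y, hy⟩
  simp only [this, Set.projIcc_val]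

/-- Extension to a prism of maps on its boundary. -/
lemma CubeExtension.prism {X : Type*} [TopologicalSpace X] {m : ℕ} (hX : CubeExtension X (m + 1))
    {g₀ g₁ : (Fin m → I) → X} (h₀ : Continuous g₀) (h₁ : Continuous g₁)
    {H : I × (Fin m → I) → X} (hH : ContinuousOn H (Set.univ ×ˢ Cube.boundary (Fin m)))
    (H0 : ∀ y ∈ Cube.boundary (Fin m), H (0, y) = g₀ y)
    (H1 : ∀ y ∈ Cube.boundary (Fin m), H (1, y) = g₁ y) :
    ∃ G : I × (Fin m → I) → X, Continuous G ∧ (∀ y, G (0, y) = g₀ y) ∧ (∀ y, G (1, y) = g₁ y) ∧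
      ∀ t, ∀ y ∈ Cube.boundary (Fin m), G (t, y) = H (t, y) := by
  classical
  let β : (Fin (m + 1) → I) → X := fun y => if y 0 = 0 then g₀ (fun j => y j.succ) else
    if y 0 = 1 then g₁ (fun j => y j.succ) else H (y 0, fun j => y j.succ)
  have β0 : ∀ y, y 0 = 0 → β y = g₀ (fun j => y j.succ) := fun y hy => if_pos hy
  have β1 : ∀ y, y 0 = 1 → β y = g₁ (fun j => y j.succ) := fun y hy => by
    simp only [β, hy, one_ne_zero, if_false, if_true]
  have βH : ∀ y : Fin (m + 1) → I, (fun j => y j.succ) ∈ Cube.boundary (Fin m) →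
      β y = H (y 0, fun j => y j.succ) := fun y hy => by
    simp only [β]
    split_ifs with h h
    · rw [h, H0 _ hy]
    · rw [h, H1 _ hy]
    · rfl
  have ht : Continuous fun y : Fin (m + 1) → I => fun j : Fin m => y j.succ := continuous_tail
  have hβ : ContinuousOn β (Cube.boundary (Fin (m + 1))) := by
    have e : Cube.boundary (Fin (m + 1)) = ({y | y 0 = 0} ∪ {y | y 0 = 1}) ∪
        {y | (fun j => y j.succ) ∈ Cube.boundary (Fin m)} := by
      ext y
      rw [← face_zero_tail y, face_zero_mem_boundary_iff]
      simp
    have c0 : IsClosed {y : Fin (m + 1) → I | y 0 = 0} :=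
      isClosed_eq (continuous_apply 0) continuous_const
    have c1 : IsClosed {y : Fin (m + 1) → I | y 0 = 1} :=
      isClosed_eq (continuous_apply 0) continuous_const
    rw [e]
    refine ContinuousOn.union_of_isClosed (ContinuousOn.union_of_isClosed ?_ ?_ c0 c1) ?_
      (c0.union c1) ((isClosed_boundary m).preimage ht)
    · exact (h₀.comp ht).continuousOn.congr β0
    · exact (h₁.comp ht).continuousOn.congr β1
    · refine ContinuousOn.congr ?_ βH
      exact hH.comp ((continuous_apply 0).prodMk ht).continuousOn fun y hy => ⟨trivial, hy⟩
  obtain ⟨G, hG, hGβ⟩ := hX β hβ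
  refine ⟨fun z => G (face 0 z.1 z.2), hG.comp continuous_face_zero, fun y => ?_, fun y => ?_,
    fun t y hy => ?_⟩
  · refine (hGβ (face_zero_mem_boundary_iff.2 (Or.inl (Or.inl rfl)))).trans ?_
    rw [β0 _ (face_same _ _ _)]; simp
  · refine (hGβ (face_zero_mem_boundary_iff.2 (Or.inl (Or.inr rfl)))).trans ?_
    rw [β1 _ (face_same _ _ _)]; simp
  · refine (hGβ (face_zero_mem_boundary_iff.2 (Or.inr hy))).trans ?_
    rw [βH _ (by simpa using hy)]; simp

end SphereExtension

/-! ### The classes of based maps to the sphere -/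

section SphereClass

open Classical in
/-- The class in `π_{n-1}(S^{n-1})` of a based map, and `0` for other maps. -/
noncomputable def loopClass (k : ℕ) (f : (Fin (k + 1) → I) → Sph (k + 2)) : SphereCoeff k :=
  if hf : IsLoop (basePt (k + 1)) f then SphereCoeff.mk ⟨⟨f, hf.1⟩, hf.2⟩ else 0

lemma loopClass_genLoop {k : ℕ} (f : GenLoop (Fin (k + 1)) (Sph (k + 2)) (basePt (k + 1))) :
    loopClass k f = SphereCoeff.mk f := by
  have hf : IsLoop (basePt (k + 1)) f := ⟨f.1.continuous, f.2⟩
  rw [loopClass, dif_pos hf]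
  rfl

lemma isLoopClass_loopClass (k : ℕ) : IsLoopClass (basePt (k + 1)) (loopClass k) where
  const := loopClass_genLoop GenLoop.const
  concat i f g hf hg := by
    let f' : GenLoop (Fin (k + 1)) (Sph (k + 2)) (basePt (k + 1)) := ⟨⟨f, hf.1⟩, hf.2⟩
    let g' : GenLoop (Fin (k + 1)) (Sph (k + 2)) (basePt (k + 1)) := ⟨⟨g, hg.1⟩, hg.2⟩
    have h := loopClass_genLoop (GenLoop.transAt i f' g')
    have h1 := loopClass_genLoop f'
    have h2 := loopClass_genLoop g'
    refine Eq.trans (h.trans ?_) (congrArg₂ (· + ·) h1 h2).symm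
    -- `HomotopyGroup.mul_spec` represents a product by the concatenation in the opposite order, so
    -- commutativity is needed.
    refine Eq.trans ?_ (add_comm (SphereCoeff.mk g') (SphereCoeff.mk f'))
    exact congrArg Additive.ofMul (HomotopyGroup.mul_spec (i := i) (p := g') (q := f')).symm
  symm i f hf := by
    let f' : GenLoop (Fin (k + 1)) (Sph (k + 2)) (basePt (k + 1)) := ⟨⟨f, hf.1⟩, hf.2⟩
    have h := loopClass_genLoop (GenLoop.symmAt i f')
    have h1 := loopClass_genLoop f'
    have e : (GenLoop.symmAt i f' : (Fin (k + 1) → I) → Sph (k + 2)) =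
        fun y => f (Function.update y i (unitInterval.symm (y i))) := by
      ext1 y
      change f _ = f _
      congr 1
      ext1 j
      rw [Function.update_apply]
    rw [e] at h
    refine Eq.trans (h.trans ?_) (congrArg Neg.neg h1).symm
    exact congrArg Additive.ofMul (HomotopyGroup.inv_spec (i := i) (p := f')).symm
  homotopy h hc hb := by
    have h0 : IsLoop (basePt (k + 1)) fun y => h (0, y) := ⟨hc.comp (by fun_prop), hb 0⟩
    have h1 : IsLoop (basePt (k + 1)) fun y => h (1, y) := ⟨hc.comp (by fun_prop), hb 1⟩
    rw [loopClass, loopClass, dif_pos h0, dif_pos h1]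
    refine congrArg Additive.ofMul (Quotient.sound ⟨⟨⟨⟨h, hc⟩, fun y => rfl, fun y => rfl⟩, ?_⟩⟩)
    intro t y hy
    exact (hb t y hy).trans (h0.2 y hy).symm

end SphereClass

/-! ### The fundamental cocycle of a highly connected space -/

section FundamentalCocycle

variable {d : ℕ} {X A : Type*} [TopologicalSpace X] [AddCommGroup A] {b : X}

/-- `G` is a homotopy that starts with `s`, ends with a constant if `j < d`, and is constant if `s`
is the constant cube `b`. -/
def IsContraction (b : X) (d : ℕ) {j : ℕ} (s : (Fin j → I) → X) (G : I × (Fin j → I) → X) : Prop :=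
  Continuous G ∧ (∀ y, G (0, y) = s y) ∧ (j < d → ∀ y, G (1, y) = b) ∧
    ((s = fun _ => b) → G = fun _ => b)

open Classical in
/-- A contraction of all cubes of dimension less than `d` in a `(d-1)`-connected space, compatible
with faces, and a compatible deformation of the `d`-cubes to based maps. -/
noncomputable def contraction (b : X) (d : ℕ) :
    (j : ℕ) → ((Fin j → I) → X) → (I × (Fin j → I) → X)
  | 0, s => if h : ∃ G, IsContraction b d s G then h.choose else fun _ => b
  | j + 1, s => if h : ∃ G, IsContraction b d s G ∧ ∀ i, ∀ ε : I, (ε = 0 ∨ ε = 1) → ∀ t y,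
      G (t, face i ε y) = contraction b d j (s ∘ face i ε) (t, y) then h.choose else fun _ => b

/-- Below dimension `d` both ends of the prism are prescribed, and filling it uses extension in
dimension `j + 1 ≤ d`. In dimension `d` the end is free and homotopy extension suffices. -/
lemma exists_isContraction (hX : ∀ j ≤ d, CubeExtension X j) {j : ℕ} (hj : j ≤ d)
    {s : (Fin j → I) → X} (hs : Continuous s) {H : I × (Fin j → I) → X}
    (hH : ContinuousOn H (Set.univ ×ˢ Cube.boundary (Fin j)))
    (H0 : ∀ y ∈ Cube.boundary (Fin j), H (0, y) = s y)
    (H1 : j < d → ∀ y ∈ Cube.boundary (Fin j), H (1, y) = b)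
    (Hb : (s = fun _ => b) → ∀ t, ∀ y ∈ Cube.boundary (Fin j), H (t, y) = b) :
    ∃ G, IsContraction b d s G ∧ ∀ t, ∀ y ∈ Cube.boundary (Fin j), G (t, y) = H (t, y) := by
  -- The constant cube must keep the constant homotopy, so that the deformation of a based map is a
  -- based homotopy.
  by_cases hsb : s = fun _ => b
  · refine ⟨fun _ => b, ⟨continuous_const, fun y => by rw [hsb], fun _ _ => rfl, fun _ => rfl⟩,
      fun t y hy => (Hb hsb t y hy).symm⟩
  · rcases hj.lt_or_eq with hlt | rfl
    · obtain ⟨G, hG, h0, h1, hb⟩ := (hX (j + 1) hlt).prism hs (continuous_const (y := b)) hH H0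
        (H1 hlt)
      exact ⟨G, ⟨hG, h0, fun _ => h1, fun h => absurd h hsb⟩, hb⟩
    · obtain ⟨G, hG, h0, hb⟩ := exists_homotopy_extension hs hH H0
      exact ⟨G, ⟨hG, h0, fun h => absurd h (lt_irrefl _), fun h => absurd h hsb⟩, hb⟩

/-- Two faces meet in a face of codimension two, where both contractions restrict to the contraction
of that smaller cube. This is the hypothesis of `exists_glue`. -/
lemma contraction_compat {c : (j : ℕ) → ((Fin j → I) → X) → (I × (Fin j → I) → X)} {j : ℕ}
    (hc : ∀ l, l + 1 = j → ∀ s : (Fin (l + 1) → I) → X, Continuous s →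
      ∀ i, ∀ ε : I, (ε = 0 ∨ ε = 1) → ∀ t y,
        c (l + 1) s (t, face i ε y) = c l (s ∘ face i ε) (t, y))
    {s : (Fin (j + 1) → I) → X} (hs : Continuous s) (i i' : Fin (j + 1)) (ε ε' t : I)
    (y y' : Fin j → I) (hε : ε = 0 ∨ ε = 1) (hε' : ε' = 0 ∨ ε' = 1)
    (hy : face i ε y = face i' ε' y') :
    c j (s ∘ face i ε) (t, y) = c j (s ∘ face i' ε') (t, y') := by
  rcases eq_or_ne i i' with rfl | hi
  · have h1 : ε = ε' := by rw [← face_same i ε y, hy, face_same]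
    subst h1
    rw [face_injective i ε hy]
  · cases j with
    | zero => exact absurd (Fin.ext (by omega)) hi
    | succ l =>
      obtain ⟨a, w, rfl, rfl, rfl⟩ := face_eq_face hi hy
      rw [hc l rfl _ (hs.comp (continuous_face _ _)) _ _ hε',
        hc l rfl _ (hs.comp (continuous_face _ _)) _ _ hε]
      congr 1
      ext1 w
      simp only [Function.comp_apply]
      rw [face_face]

/-- The two claims are proved together: compatibility with faces in dimension `j` is what allows the
contractions of the faces of a `(j+1)`-cube to be glued. -/
lemma contraction_spec (hX : ∀ j ≤ d, CubeExtension X j) (j : ℕ) (hj : j ≤ d) :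
    (∀ s : (Fin j → I) → X, Continuous s → IsContraction b d s (contraction b d j s)) ∧
    ∀ l, l + 1 = j → ∀ s : (Fin (l + 1) → I) → X, Continuous s →
      ∀ i, ∀ ε : I, (ε = 0 ∨ ε = 1) → ∀ t y,
        contraction b d (l + 1) s (t, face i ε y) = contraction b d l (s ∘ face i ε) (t, y) := by
  classical
  induction j with
  | zero =>
    refine ⟨fun s hs => ?_, fun l hl => absurd hl (by omega)⟩
    have h : ∃ G, IsContraction b d s G := by
      have he : ∀ y, y ∉ Cube.boundary (Fin 0) := fun y ⟨i, _⟩ => i.elim0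
      obtain ⟨G, hG, -⟩ := exists_isContraction (b := b) hX hj hs (H := fun _ => b)
        continuousOn_const (fun y hy => absurd hy (he y)) (fun _ _ _ => rfl) fun _ _ _ _ => rfl
      exact ⟨G, hG⟩
    rw [contraction, dif_pos h]
    exact h.choose_spec
  | succ j ih =>
    obtain ⟨ih1, ih2⟩ := ih (by omega)
    have key : ∀ s : (Fin (j + 1) → I) → X, Continuous s →
        IsContraction b d s (contraction b d (j + 1) s) ∧
        ∀ i, ∀ ε : I, (ε = 0 ∨ ε = 1) → ∀ t y,
          contraction b d (j + 1) s (t, face i ε y) =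
            contraction b d j (s ∘ face i ε) (t, y) := by
      intro s hs
      have hf : ∀ (i : Fin (j + 1)) (ε : I), Continuous (s ∘ face i ε) := fun i ε =>
        hs.comp (continuous_face i ε)
      have h : ∃ G, IsContraction b d s G ∧ ∀ i, ∀ ε : I, (ε = 0 ∨ ε = 1) → ∀ t y,
          G (t, face i ε y) = contraction b d j (s ∘ face i ε) (t, y) := by
        obtain ⟨H, hH⟩ := exists_glue (fun i ε => contraction b d j (s ∘ face i ε))
          fun i i' ε ε' t y y' => contraction_compat ih2 hs i i' ε ε' t y y'
        have c0 : ContinuousOn H (Set.univ ×ˢ Cube.boundary (Fin (j + 1))) := by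
          refine continuousOn_prod_boundary fun i ε hε => ?_
          simp only [hH i ε hε]
          exact (ih1 _ (hf i ε)).1
        have c1 : ∀ y ∈ Cube.boundary (Fin (j + 1)), H (0, y) = s y := by
          intro y hy
          obtain ⟨i, ε, hε, w, rfl⟩ := mem_boundary_succ_iff.1 hy
          rw [hH i ε hε, (ih1 _ (hf i ε)).2.1, Function.comp_apply]
        have c2 : j + 1 < d → ∀ y ∈ Cube.boundary (Fin (j + 1)), H (1, y) = b := by
          intro hlt y hy
          obtain ⟨i, ε, hε, w, rfl⟩ := mem_boundary_succ_iff.1 hy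
          rw [hH i ε hε, (ih1 _ (hf i ε)).2.2.1 (by omega)]
        have c3 : (s = fun _ => b) → ∀ t, ∀ y ∈ Cube.boundary (Fin (j + 1)), H (t, y) = b := by
          intro hsb t y hy
          obtain ⟨i, ε, hε, w, rfl⟩ := mem_boundary_succ_iff.1 hy
          rw [hH i ε hε, (ih1 _ (hf i ε)).2.2.2 (by rw [hsb]; rfl)]
        obtain ⟨G, hG, hGH⟩ := exists_isContraction hX hj hs c0 c1 c2 c3
        refine ⟨G, hG, fun i ε hε t y => ?_⟩
        rw [hGH t _ (face_mem_boundary i hε y), hH i ε hε]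
      rw [contraction, dif_pos h]
      exact h.choose_spec
    refine ⟨fun s hs => (key s hs).1, fun l hl s hs => ?_⟩
    obtain rfl : l = j := by omega
    exact (key s hs).2

variable {cl : ((Fin d → I) → X) → A}

/-- A based homotopy invariant of maps of `d`-cubes to a `(d-1)`-connected space extends to a
cocycle on all singular cubes. -/
theorem IsLoopClass.exists_cocycle (hcl : IsLoopClass b cl) (hX : ∀ j ≤ d, CubeExtension X j) :
    ∃ Φ : ((Fin d → I) → X) → A, (∀ h, Continuous h → cubeD Φ h = 0) ∧
      ∀ f, IsLoop b f → Φ f = cl f := by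
  obtain ⟨hc1, hc2⟩ := contraction_spec (b := b) hX d le_rfl
  have hlow : ∀ l, l + 1 = d → ∀ s : (Fin l → I) → X, Continuous s → ∀ y,
      contraction b d l s (1, y) = b := fun l hl s hs =>
    ((contraction_spec (b := b) hX l (by omega)).1 s hs).2.2.1 (by omega)
  -- `Φ s` is the class of the end of the deformation of `s`. The deformation of the faces of a
  -- `(d+1)`-cube `h` extends to `h`, and its end has based faces, so homotopy addition applies.
  refine ⟨fun s => cl fun y => contraction b d d s (1, y), fun h hh => ?_, fun f hf => ?_⟩
  · obtain ⟨H, hH⟩ := exists_glue (fun i ε => contraction b d d (h ∘ face i ε))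
      fun i i' ε ε' t y y' => contraction_compat hc2 hh i i' ε ε' t y y'
    have hf : ∀ (i : Fin (d + 1)) (ε : I), Continuous (h ∘ face i ε) := fun i ε =>
      hh.comp (continuous_face i ε)
    obtain ⟨G, hG, -, hGH⟩ := exists_homotopy_extension hh (H := H)
      (continuousOn_prod_boundary fun i ε hε => by
        simp only [hH i ε hε]
        exact (hc1 _ (hf i ε)).1)
      (fun y hy => by
        obtain ⟨i, ε, hε, w, rfl⟩ := mem_boundary_succ_iff.1 hy
        rw [hH i ε hε, (hc1 _ (hf i ε)).2.1]
        rfl)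
    have hGf : ∀ i, ∀ ε : I, (ε = 0 ∨ ε = 1) → (fun y => G (1, y)) ∘ face i ε =
        fun y => contraction b d d (h ∘ face i ε) (1, y) := fun i ε hε => by
      ext1 y
      rw [Function.comp_apply, hGH 1 _ (face_mem_boundary i hε y), hH i ε hε]
    have hloop : HasLoopFaces b fun y => G (1, y) := by
      refine ⟨hG.comp (by fun_prop), fun i ε hε => ?_⟩
      rw [hGf i ε hε]
      refine ⟨(hc1 _ (hf i ε)).1.comp (by fun_prop), fun y hy => ?_⟩
      cases d with
      | zero => exact hy.choose.elim0
      | succ l =>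
        obtain ⟨i', ε', hε', w, rfl⟩ := mem_boundary_succ_iff.1 hy
        dsimp only
        rw [hc2 l rfl _ (hf i ε) i' ε' hε', hlow l rfl _ ((hf i ε).comp (continuous_face _ _))]
    rw [← hcl.cubeD_eq_zero hloop]
    refine Finset.sum_congr rfl fun i _ => ?_
    rw [hGf i 1 (Or.inr rfl), hGf i 0 (Or.inl rfl)]
  · have h0 := (hc1 f hf.1)
    -- All faces of the based map `f` are constant, so its deformation is constant on the boundary
    -- and preserves the class.
    have e : f = fun y => contraction b d d f (0, y) := funext fun y => (h0.2.1 y).symm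
    conv_rhs => rw [e]
    refine (hcl.homotopy _ h0.1 fun t y hy => ?_).symm
    cases d with
    | zero => exact hy.choose.elim0
    | succ l =>
      obtain ⟨i, ε, hε, w, rfl⟩ := mem_boundary_succ_iff.1 hy
      have hb : f ∘ face i ε = fun _ => b := funext fun w => hf.2 _ (face_mem_boundary i hε w)
      rw [hc2 l rfl _ hf.1 i ε hε, hb,
        ((contraction_spec (b := b) hX l (by omega)).1 _ continuous_const).2.2.2 rfl]

end FundamentalCocycle

/-! ### The degree of a map from the boundary of a cube -/

section Degree

variable {k : ℕ}

/-- A fundamental cocycle of the sphere. -/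
noncomputable def fundamentalCocycle (k : ℕ) :
    ((Fin (k + 1) → I) → Sph (k + 2)) → SphereCoeff k :=
  ((isLoopClass_loopClass k).exists_cocycle fun _ hj => cubeExtension_sphere hj).choose

lemma cubeD_fundamentalCocycle {h : (Fin (k + 2) → I) → Sph (k + 2)} (hh : Continuous h) :
    cubeD (fundamentalCocycle k) h = 0 :=
  ((isLoopClass_loopClass k).exists_cocycle fun _ hj => cubeExtension_sphere hj).choose_spec.1 h hh

lemma fundamentalCocycle_loop {f : (Fin (k + 1) → I) → Sph (k + 2)}
    (hf : IsLoop (basePt (k + 1)) f) : fundamentalCocycle k f = loopClass k f :=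
  ((isLoopClass_loopClass k).exists_cocycle fun _ hj => cubeExtension_sphere hj).choose_spec.2 f hf

/-- The degree of a map from the boundary of the `n`-cube to `S^{n-1}`, where `n = k + 2`. -/
noncomputable def degree (g : (Fin (k + 2) → I) → Sph (k + 2)) : SphereCoeff k :=
  cubeD (fundamentalCocycle k) g

lemma degree_eq_zero {g : (Fin (k + 2) → I) → Sph (k + 2)} (hg : Continuous g) : degree g = 0 :=
  cubeD_fundamentalCocycle hg

/-- No continuity of `h` is required; this allows cubes on which a section is controlled only over a
skeleton. -/
lemma cubeD_degree (h : (Fin (k + 3) → I) → Sph (k + 2)) : cubeD degree h = 0 :=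
  cubeD_cubeD _ h

lemma degree_congr {g g' : (Fin (k + 2) → I) → Sph (k + 2)}
    (h : Set.EqOn g g' (Cube.boundary (Fin (k + 2)))) : degree g = degree g' := by
  have e : ∀ i, ∀ ε : I, (ε = 0 ∨ ε = 1) → g ∘ face i ε = g' ∘ face i ε := fun i ε hε =>
    funext fun w => h (face_mem_boundary i hε w)
  unfold degree cubeD
  refine Finset.sum_congr rfl fun i _ => ?_
  rw [e i 1 (Or.inr rfl), e i 0 (Or.inl rfl)]

/-- Viewed as a cube with one more coordinate, `H` is continuous on all faces except the two ends.
Those faces have degree zero, so the vanishing coboundary compares the ends. -/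
lemma degree_homotopy {H : I × (Fin (k + 2) → I) → Sph (k + 2)}
    (hH : ContinuousOn H (Set.univ ×ˢ Cube.boundary (Fin (k + 2)))) :
    degree (fun y => H (0, y)) = degree (fun y => H (1, y)) := by
  have h := cubeD_degree fun y : Fin (k + 3) → I => H (y 0, fun j => y j.succ)
  have h0 : ∀ t : I, (fun y : Fin (k + 3) → I => H (y 0, fun j => y j.succ)) ∘ face 0 t =
      fun y => H (t, y) := fun t => by
    ext1 y; simp
  have h1 : ∀ (i : Fin (k + 2)) (ε : I), (ε = 0 ∨ ε = 1) →
      degree ((fun y : Fin (k + 3) → I => H (y 0, fun j => y j.succ)) ∘ face i.succ ε) = 0 := by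
    intro i ε hε
    refine degree_eq_zero ?_
    have e : (fun y : Fin (k + 3) → I => H (y 0, fun j => y j.succ)) ∘ face i.succ ε =
        fun y => H (y 0, face i ε fun j => y j.succ) := by
      ext1 y
      simp only [Function.comp_apply, face_succ_zero, face_succ_succ]
    rw [e]
    exact hH.comp_continuous
      ((continuous_apply 0).prodMk ((continuous_face i ε).comp continuous_tail))
      fun y => ⟨trivial, face_mem_boundary (m := k + 1) i hε fun j => y j.succ⟩
  rw [cubeD, Fin.sum_univ_succ, Finset.sum_eq_zero, add_zero, Fin.val_zero, pow_zero, one_smul,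
    h0, h0, sub_eq_zero] at h
  · exact h.symm
  · intro i _
    rw [h1 i 1 (Or.inr rfl), h1 i 0 (Or.inl rfl), sub_self, smul_zero]

lemma continuousOn_onCubeBoundary {d : ℕ} {X : Type*} [TopologicalSpace X] {b : X}
    (f : GenLoop (Fin d) X b) : ContinuousOn (onCubeBoundary f) (Cube.boundary (Fin (d + 1))) := by
  refine continuousOn_boundary fun i ε hε => ?_
  have hb : ∀ y, f y = b → (if (1 : I) = 1 then f y else b) = b := fun y h => by rw [if_pos rfl, h]
  induction i using Fin.cases with
  | zero =>
    rcases hε with rfl | rfl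
    · simpa [onCubeBoundary] using continuous_const
    · simpa [onCubeBoundary] using f.1.continuous
  | succ i =>
    have : (fun y => onCubeBoundary f (face i.succ ε y)) = fun _ => b := by
      ext1 y
      rw [onCubeBoundary]
      split_ifs
      · exact f.2 _ ⟨i, by simpa using hε⟩
      · rfl
    rw [this]
    exact continuous_const

/-- Only the face `y₀ = 1` is nonconstant, and it enters with sign `+1`. This fixes the
normalization of the degree. -/
lemma degree_onCubeBoundary (f : GenLoop (Fin (k + 1)) (Sph (k + 2)) (basePt (k + 1))) :
    degree (onCubeBoundary f) = SphereCoeff.mk f := by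
  have h0 : onCubeBoundary f ∘ face 0 1 = f := by ext1 y; simp [onCubeBoundary]
  have h1 : onCubeBoundary f ∘ face 0 0 = fun _ => basePt (k + 1) := by
    ext1 y; simp [onCubeBoundary]
  have h2 : ∀ (i : Fin (k + 1)) (ε : I), (ε = 0 ∨ ε = 1) →
      onCubeBoundary f ∘ face i.succ ε = fun _ => basePt (k + 1) := fun i ε hε => by
    ext1 y
    rw [Function.comp_apply, onCubeBoundary]
    split_ifs
    · exact f.2 _ ⟨i, by simpa using hε⟩
    · rfl
  rw [degree, cubeD, Fin.sum_univ_succ, Finset.sum_eq_zero, add_zero, Fin.val_zero, pow_zero,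
    one_smul, h0, h1, fundamentalCocycle_loop isLoop_const, (isLoopClass_loopClass k).const,
    sub_zero, fundamentalCocycle_loop (f := f) ⟨f.1.continuous, f.2⟩, loopClass_genLoop]
  intro i _
  rw [h2 i 1 (Or.inr rfl), h2 i 0 (Or.inl rfl), sub_self, smul_zero]

end Degree

/-! ### Trivializations of bundles over cubes -/

section Trivial

lemma continuousOn_inter_union {X Y : Type*} [TopologicalSpace X] [TopologicalSpace Y] {f : X → Y}
    {D A B : Set X} (hA : IsClosed A) (hB : IsClosed B) (h1 : ContinuousOn f (D ∩ A))
    (h2 : ContinuousOn f (D ∩ B)) : ContinuousOn f (D ∩ (A ∪ B)) := by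
  have key : ∀ C : Set X, IsClosed C → ContinuousOn f (D ∩ C) → ∀ x ∈ D,
      ContinuousWithinAt f (D ∩ C) x := by
    intro C hC h x hx
    by_cases hxC : x ∈ C
    · exact h x ⟨hx, hxC⟩
    · exact continuousWithinAt_of_notMem_closure fun hc =>
        hxC ((hC.closure_subset_iff.2 Set.inter_subset_right) hc)
  rw [Set.inter_union_distrib_left]
  exact fun x hx => (key A hA h1 x (hx.elim And.left And.left)).union
    (key B hB h2 x (hx.elim And.left And.left))

variable {M E F X : Type*} [TopologicalSpace E] [TopologicalSpace F]
  [TopologicalSpace X]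

/-- The pullback of `p : E → M` along `c : X → M` is trivial over `S ⊆ X` with fiber `F`. -/
def TrivialOver (F : Type*) [TopologicalSpace F] (p : E → M) (c : X → M) (S : Set X) : Prop :=
  ∃ (θ : X × F → E) (ψ : X × E → F), ContinuousOn θ (S ×ˢ Set.univ) ∧
    ContinuousOn ψ {z | p z.2 = c z.1 ∧ z.1 ∈ S} ∧
    ∀ x ∈ S, (∀ v, p (θ (x, v)) = c x ∧ ψ (x, θ (x, v)) = v) ∧
      ∀ e, p e = c x → θ (x, ψ (x, e)) = e

lemma TrivialOver.mono {p : E → M} {c : X → M} {S S' : Set X} (h : TrivialOver F p c S)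
    (hS : S' ⊆ S) : TrivialOver F p c S' := by
  obtain ⟨θ, ψ, h1, h2, h3⟩ := h
  exact ⟨θ, ψ, h1.mono (Set.prod_mono hS subset_rfl), h2.mono fun z hz => ⟨hz.1, hS hz.2⟩,
    fun x hx => h3 x (hS hx)⟩

lemma trivialOver_preimage_baseSet [TopologicalSpace M] {p : E → M}
    (e : Bundle.Trivialization F p) {c : X → M} (hc : Continuous c) :
    TrivialOver F p c (c ⁻¹' e.baseSet) := by
  refine ⟨fun z => e.toOpenPartialHomeomorph.symm (c z.1, z.2), fun z => (e z.2).2, ?_, ?_, ?_⟩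
  · refine e.toOpenPartialHomeomorph.continuousOn_symm.comp (by fun_prop) ?_
    rintro ⟨x, v⟩ ⟨hx, -⟩
    exact e.mem_target.2 hx
  · have he : ContinuousOn e e.source := e.continuousOn_toFun
    refine continuous_snd.comp_continuousOn (he.comp continuous_snd.continuousOn ?_)
    rintro ⟨x, w⟩ ⟨h1, h2⟩
    refine e.mem_source.2 ?_
    rw [h1]; exact h2
  · refine fun x hx => ⟨fun v => ?_, fun w hw => ?_⟩
    · have hm : (c x, v) ∈ e.target := e.mem_target.2 hx
      refine ⟨e.proj_symm_apply hm, ?_⟩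
      dsimp only
      rw [e.apply_symm_apply hm]
    · have hw' : w ∈ e.source := e.mem_source.2 (by rw [hw]; exact hx)
      dsimp only
      rw [← hw]
      exact e.symm_apply_mk_proj hw'

/-- Over `S₂` the second trivialization is corrected by the transition function, which is extended
from `S₁ ∩ S₂` along the retraction `r`. The two then agree on the overlap. -/
lemma TrivialOver.union {p : E → M} {c : X → M} {S₁ S₂ : Set X} (h₁ : TrivialOver F p c S₁)
    (h₂ : TrivialOver F p c S₂) (hS₁ : IsClosed S₁) (hS₂ : IsClosed S₂) {r : X → X}
    (hr : Continuous r) (hrm : ∀ x ∈ S₂, r x ∈ S₁ ∩ S₂) (hri : ∀ x ∈ S₁ ∩ S₂, r x = x) :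
    TrivialOver F p c (S₁ ∪ S₂) := by
  classical
  obtain ⟨θ₁, ψ₁, hθ₁, hψ₁, h₁⟩ := h₁
  obtain ⟨θ₂, ψ₂, hθ₂, hψ₂, h₂⟩ := h₂
  let θ : X × F → E := fun z => if z.1 ∈ S₁ then θ₁ z else
    θ₂ (z.1, ψ₂ (r z.1, θ₁ (r z.1, z.2)))
  let ψ : X × E → F := fun z => if z.1 ∈ S₁ then ψ₁ z else
    ψ₁ (r z.1, θ₂ (r z.1, ψ₂ z))
  have eθ₁ : ∀ z : X × F, z.1 ∈ S₁ → θ z = θ₁ z := fun z hz => if_pos hz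
  have eψ₁ : ∀ z : X × E, z.1 ∈ S₁ → ψ z = ψ₁ z := fun z hz => if_pos hz
  have eθ₂ : ∀ z : X × F, z.1 ∈ S₂ → θ z = θ₂ (z.1, ψ₂ (r z.1, θ₁ (r z.1, z.2))) := by
    rintro ⟨x, v⟩ hz
    by_cases hx : x ∈ S₁
    · rw [eθ₁ _ hx, hri x ⟨hx, hz⟩, (h₂ x hz).2 _ ((h₁ x hx).1 v).1]
    · exact if_neg hx
  have eψ₂ : ∀ z : X × E, p z.2 = c z.1 → z.1 ∈ S₂ →
      ψ z = ψ₁ (r z.1, θ₂ (r z.1, ψ₂ z)) := by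
    rintro ⟨x, e⟩ he hz
    by_cases hx : x ∈ S₁
    · rw [eψ₁ _ hx, hri x ⟨hx, hz⟩, (h₂ x hz).2 _ he]
    · exact if_neg hx
  refine ⟨θ, ψ, ?_, ?_, ?_⟩
  · rw [Set.union_prod]
    refine ContinuousOn.union_of_isClosed (hθ₁.congr fun z hz => eθ₁ z hz.1) ?_
      (hS₁.prod isClosed_univ) (hS₂.prod isClosed_univ)
    refine ContinuousOn.congr ?_ fun z hz => eθ₂ z hz.1
    have hA : ContinuousOn (fun z : X × F => θ₁ (r z.1, z.2)) (S₂ ×ˢ Set.univ) :=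
      hθ₁.comp (by fun_prop) fun z hz => ⟨(hrm _ hz.1).1, trivial⟩
    have hB : ContinuousOn (fun z : X × F => ψ₂ (r z.1, θ₁ (r z.1, z.2))) (S₂ ×ˢ Set.univ) :=
      hψ₂.comp ((by fun_prop : ContinuousOn (fun z : X × F => r z.1) _).prodMk hA) fun z hz =>
        ⟨((h₁ _ (hrm _ hz.1).1).1 _).1, (hrm _ hz.1).2⟩
    exact hθ₂.comp (continuous_fst.continuousOn.prodMk hB) fun z hz => ⟨hz.1, trivial⟩
  · refine continuousOn_inter_union (hS₁.preimage continuous_fst) (hS₂.preimage continuous_fst)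
      (hψ₁.congr fun z hz => eψ₁ z hz.2) ?_
    refine ContinuousOn.congr ?_ fun z hz => eψ₂ z hz.1 hz.2
    have hA : ContinuousOn (fun z : X × E => θ₂ (r z.1, ψ₂ z)) {z | p z.2 = c z.1 ∧ z.1 ∈ S₂} :=
      hθ₂.comp ((by fun_prop : ContinuousOn (fun z : X × E => r z.1) _).prodMk hψ₂) fun z hz =>
        ⟨(hrm _ hz.2).2, trivial⟩
    exact hψ₁.comp ((by fun_prop : ContinuousOn (fun z : X × E => r z.1) _).prodMk hA) fun z hz =>
      ⟨((h₂ _ (hrm _ hz.2).2).1 _).1, (hrm _ hz.2).1⟩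
  · intro x hx
    by_cases hx₁ : x ∈ S₁
    · refine ⟨fun v => ?_, fun e he => ?_⟩
      · rw [eθ₁ _ hx₁, eψ₁ _ hx₁]
        exact (h₁ x hx₁).1 v
      · rw [eθ₁ _ hx₁, eψ₁ _ hx₁]
        exact (h₁ x hx₁).2 e he
    · have hx₂ : x ∈ S₂ := hx.resolve_left hx₁
      obtain ⟨hr₁, hr₂⟩ := hrm x hx₂
      refine ⟨fun v => ?_, fun e he => ?_⟩
      · have hp := ((h₂ x hx₂).1 (ψ₂ (r x, θ₁ (r x, v)))).1
        rw [eθ₂ _ hx₂, eψ₂ _ hp hx₂]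
        refine ⟨hp, ?_⟩
        dsimp only
        rw [((h₂ x hx₂).1 _).2, (h₂ _ hr₂).2 _ ((h₁ _ hr₁).1 v).1, ((h₁ _ hr₁).1 v).2]
      · rw [eψ₂ _ he hx₂, eθ₂ _ hx₂]
        dsimp only
        rw [(h₁ _ hr₁).2 _ ((h₂ _ hr₂).1 _).1, ((h₂ _ hr₂).1 _).2, (h₂ x hx₂).2 e he]

open Function in
/-- A locally trivial bundle over a cube is trivial. -/
theorem trivialOver_Icc [TopologicalSpace M] {ι : Type*} [Fintype ι] {p : E → M}
    (hp : ∀ x, ∃ e : Bundle.Trivialization F p, x ∈ e.baseSet) {c : (ι → ℝ) → M}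
    (hc : Continuous c) : TrivialOver F p c (Set.Icc 0 1) := by
  classical
  obtain ⟨δ, hδ, hball⟩ := lebesgue_number_lemma_of_metric
    (isCompact_Icc (a := (0 : ι → ℝ)) (b := 1))
    (c := fun e : Bundle.Trivialization F p => c ⁻¹' e.baseSet)
    (fun e => e.open_baseSet.preimage hc) fun x _ => Set.mem_iUnion.2 (hp (c x))
  -- `S` is the set of directions in which the box may be long. If `S` is empty, the box lies in a
  -- Lebesgue ball around `a` and hence over one chart.
  have key : ∀ S : Finset ι, ∀ a b : ι → ℝ, a ≤ b → 0 ≤ a → b ≤ 1 →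
      (∀ i, i ∉ S → b i - a i ≤ δ / 2) → TrivialOver F p c (Set.Icc a b) := by
    intro S
    induction S using Finset.induction_on with
    | empty =>
      intro a b hab ha hb hl
      obtain ⟨e, he⟩ := hball a ⟨ha, hab.trans hb⟩
      refine (trivialOver_preimage_baseSet e hc).mono (Set.Subset.trans (fun x hx => ?_) he)
      rw [Metric.mem_ball]
      refine lt_of_le_of_lt ((dist_pi_le_iff (by positivity : (0 : ℝ) ≤ δ / 2)).2 fun i => ?_)
        (half_lt_self hδ)
      rw [Real.dist_eq, abs_of_nonneg (sub_nonneg.2 (hx.1 i))]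
      have := hl i (Finset.notMem_empty i)
      have := hx.2 i
      linarith
    | insert i S hi ih =>
      have step : ∀ N : ℕ, ∀ a b : ι → ℝ, a ≤ b → 0 ≤ a → b ≤ 1 →
          (∀ j, j ∉ insert i S → b j - a j ≤ δ / 2) → b i - a i ≤ (N + 1) * (δ / 2) →
          TrivialOver F p c (Set.Icc a b) := by
        intro N
        induction N with
        | zero =>
          intro a b hab ha hb hl hN
          refine ih a b hab ha hb fun j hj => ?_
          rcases eq_or_ne j i with rfl | hji
          · simpa using hN
          · exact hl j (by simp [hji, hj])
        | succ N ihN =>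
          intro a b hab ha hb hl hN
          -- The wall `xᵢ = t` leaves an upper slab of thickness at most `δ / 2`, which is short in
          -- direction `i`, and a lower slab that needs one subdivision less. Setting the `i`-th
          -- coordinate to `t` retracts onto the wall.
          let t := max (a i) (b i - δ / 2)
          have hat : a i ≤ t := le_max_left _ _
          have htb : t ≤ b i := max_le (hab i) (by linarith)
          have hab1 : a ≤ update b i t := le_update_iff.2 ⟨hat, fun j _ => hab j⟩
          have hab2 : update a i t ≤ b := update_le_iff.2 ⟨htb, fun j _ => hab j⟩
          have hb1 : update b i t ≤ b := update_le_iff.2 ⟨htb, fun j _ => le_rfl⟩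
          have ha1 : a ≤ update a i t := le_update_iff.2 ⟨hat, fun j _ => le_rfl⟩
          have h1 : TrivialOver F p c (Set.Icc a (update b i t)) := by
            refine ihN a _ hab1 ha (hb1.trans hb) (fun j hj => ?_) ?_
            · rw [update_of_ne (by rintro rfl; simp at hj)]; exact hl j hj
            · rw [update_self]
              push_cast at hN
              have : t ≤ a i + (N + 1) * (δ / 2) :=
                max_le (by linarith [show 0 ≤ ((N : ℝ) + 1) * (δ / 2) by positivity]) (by linarith)
              linarith
          have h2 : TrivialOver F p c (Set.Icc (update a i t) b) := by
            refine ih _ b hab2 (ha.trans ha1) hb fun j hj => ?_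
            rcases eq_or_ne j i with rfl | hji
            · rw [update_self]
              linarith [le_max_right (a j) (b j - δ / 2)]
            · rw [update_of_ne hji]; exact hl j (by simp [hji, hj])
          have e : Set.Icc a b = Set.Icc a (update b i t) ∪ Set.Icc (update a i t) b := by
            ext x
            constructor
            · rintro ⟨hx1, hx2⟩
              rcases le_total (x i) t with h | h
              · exact Or.inl ⟨hx1, le_update_iff.2 ⟨h, fun j _ => hx2 j⟩⟩
              · exact Or.inr ⟨update_le_iff.2 ⟨h, fun j _ => hx1 j⟩, hx2⟩
            · rintro (⟨hx1, hx2⟩ | ⟨hx1, hx2⟩)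
              · exact ⟨hx1, hx2.trans hb1⟩
              · exact ⟨ha1.trans hx1, hx2⟩
          rw [e]
          refine h1.union h2 isClosed_Icc isClosed_Icc (r := fun x => update x i t)
            (continuous_id.update i continuous_const) ?_ ?_
          · rintro x ⟨hx1, hx2⟩
            refine ⟨⟨le_update_iff.2 ⟨hat, fun j _ => (ha1.trans hx1) j⟩,
              update_le_update_iff.2 ⟨le_rfl, fun j _ => hx2 j⟩⟩,
              update_le_update_iff.2 ⟨le_rfl, fun j _ => (ha1.trans hx1) j⟩,
              update_le_iff.2 ⟨htb, fun j _ => hx2 j⟩⟩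
          · rintro x ⟨⟨-, hx1⟩, hx2, -⟩
            have hxi : x i = t := le_antisymm (by simpa using hx1 i) (by simpa using hx2 i)
            rw [← hxi, update_eq_self]
      intro a b hab ha hb hl
      obtain ⟨N, hN⟩ := exists_nat_ge ((b i - a i) / (δ / 2))
      refine step N a b hab ha hb hl ?_
      rw [div_le_iff₀ (by positivity)] at hN
      linarith
  exact key Finset.univ 0 1 zero_le_one le_rfl le_rfl fun i hi => absurd (Finset.mem_univ i) hi

/-- A retraction of `ℝ^ι` onto the standard simplex. -/
lemma exists_retract_stdSimplex (ι : Type*) [Fintype ι] [Nonempty ι] :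
    ∃ r : (ι → ℝ) → stdSimplex ℝ ι, Continuous r ∧ ∀ x : stdSimplex ℝ ι, r x.1 = x := by
  let s : (ι → ℝ) → ℝ := fun x => ∑ i, max (x i) 0
  have hs : Continuous s := by fun_prop
  have hm : ∀ x, max 1 (s x) ≠ 0 := fun x => (lt_of_lt_of_le one_pos (le_max_left _ _)).ne'
  have hm0 : ∀ x, 0 < max 1 (s x) := fun x => lt_of_lt_of_le one_pos (le_max_left _ _)
  have hcard : (Fintype.card ι : ℝ) ≠ 0 := Nat.cast_ne_zero.2 Fintype.card_ne_zero
  -- A deficit of the sum of the positive parts is shared equally among the coordinates, and an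
  -- excess is divided out; points of the simplex are fixed.
  refine ⟨fun x => ⟨fun i => (max (x i) 0 + max 0 (1 - s x) / Fintype.card ι) / max 1 (s x),
    fun i => ?_, ?_⟩, ?_, ?_⟩
  · have := hm0 x
    positivity
  · rw [← Finset.sum_div, div_eq_one_iff_eq (hm x), Finset.sum_add_distrib, Finset.sum_const,
      Finset.card_univ, nsmul_eq_mul, mul_div_cancel₀ _ hcard]
    change s x + _ = _
    rcases le_total (s x) 1 with h | h
    · rw [max_eq_right (by linarith), max_eq_left h]; ring
    · rw [max_eq_left (by linarith), max_eq_right h]; ring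
  · refine Continuous.subtype_mk (continuous_pi fun i => ?_) _
    fun_prop (disch := exact hm)
  · rintro ⟨x, hx0, hx1⟩
    have h0 : ∀ i, max (x i) 0 = x i := fun i => max_eq_left (hx0 i)
    have h1 : s x = 1 := by simp only [s, h0, hx1]
    ext i
    simp [h0, h1]

end Trivial

/-! ### The topology of the geometric realization -/

section Topology

variable {V : Type*} {K : AbstractSimplicialComplex V}

lemma continuous_simplexMap (s : {s : Finset V // s ∈ K.faces}) : Continuous (simplexMap K s) :=
  continuous_iff_coinduced_le.2 (le_iSup (fun s : {s : Finset V // s ∈ K.faces} =>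
    TopologicalSpace.coinduced (simplexMap K s) inferInstance) s)

lemma isClosed_realization_iff {C : Set (Realization K)} :
    IsClosed C ↔ ∀ s, IsClosed (simplexMap K s ⁻¹' C) := by
  rw [isClosed_iSup_iff]
  simp only [isClosed_coinduced]

lemma continuous_realization_iff {Y : Type*} [TopologicalSpace Y] {f : Realization K → Y} :
    Continuous f ↔ ∀ s, Continuous (f ∘ simplexMap K s) := by
  rw [continuous_iSup_dom]
  simp only [continuous_coinduced_dom]

lemma simplexMap_of_mem (s : {s : Finset V // s ∈ K.faces}) (x : stdSimplex ℝ s.1) {v : V}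
    (hv : v ∈ s.1) : (simplexMap K s x).1 v = x.1 ⟨v, hv⟩ := dif_pos hv

lemma simplexMap_of_notMem (s : {s : Finset V // s ∈ K.faces}) (x : stdSimplex ℝ s.1) {v : V}
    (hv : v ∉ s.1) : (simplexMap K s x).1 v = 0 := dif_neg hv

lemma continuous_coord (v : V) : Continuous fun x : Realization K => x.1 v := by
  refine continuous_realization_iff.2 fun s => ?_
  by_cases hv : v ∈ s.1
  · have : (fun x : Realization K => x.1 v) ∘ simplexMap K s = fun x => x.1 ⟨v, hv⟩ :=
      funext fun x => simplexMap_of_mem s x hv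
    rw [this]
    exact (continuous_apply _).comp continuous_subtype_val
  · have : (fun x : Realization K => x.1 v) ∘ simplexMap K s = fun _ => 0 :=
      funext fun x => simplexMap_of_notMem s x hv
    rw [this]
    exact continuous_const

lemma isClosed_closedSimplex (s : Finset V) : IsClosed (closedSimplex K s) := by
  have : closedSimplex K s = ⋂ v, ⋂ (_ : v ∉ s), {x : Realization K | x.1 v = 0} := by
    ext x; simp [closedSimplex]
  rw [this]
  exact isClosed_iInter fun v => isClosed_iInter fun _ =>
    isClosed_eq (continuous_coord v) continuous_const

lemma simplexMap_mem (s : {s : Finset V // s ∈ K.faces}) (x : stdSimplex ℝ s.1) :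
    simplexMap K s x ∈ closedSimplex K s.1 := fun _ hv => simplexMap_of_notMem s x hv

lemma sum_eq_one_of_mem {s : Finset V} {x : Realization K} (hx : x ∈ closedSimplex K s) :
    ∑ v : s, x.1 v = 1 := by
  classical
  obtain ⟨-, t, ht, h0, h1⟩ := x.2
  rw [Finset.univ_eq_attach, Finset.sum_attach s fun v => x.1 v]
  refine Eq.trans ?_ h1
  rw [← Finset.sum_subset (Finset.inter_subset_left (s₁ := s) (s₂ := t)),
    ← Finset.sum_subset (Finset.inter_subset_right (s₁ := s) (s₂ := t))]
  · exact fun v hv hv' => hx v fun h => hv' (Finset.mem_inter.2 ⟨h, hv⟩)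
  · exact fun v hv hv' => h0 v fun h => hv' (Finset.mem_inter.2 ⟨hv, h⟩)

/-- The barycentric coordinates of a point of a closed simplex. -/
def baryCoord {s : Finset V} (x : closedSimplex K s) : stdSimplex ℝ s :=
  ⟨fun v => x.1.1 v, fun v => x.1.2.1 v, sum_eq_one_of_mem x.2⟩

lemma continuous_baryCoord {s : Finset V} : Continuous (baryCoord (K := K) (s := s)) :=
  Continuous.subtype_mk (f := fun (x : closedSimplex K s) (v : s) => x.1.1 v.1)
    (continuous_pi fun v : s => (continuous_coord v.1).comp continuous_subtype_val)
    fun x => (baryCoord x).2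

lemma simplexMap_baryCoord {s : Finset V} (hs : s ∈ K.faces) (x : closedSimplex K s) :
    simplexMap K ⟨s, hs⟩ (baryCoord x) = x := by
  refine Subtype.ext (funext fun v => ?_)
  by_cases hv : v ∈ s
  · rw [simplexMap_of_mem _ _ hv]; rfl
  · rw [simplexMap_of_notMem _ _ hv, x.2 v hv]

/-- The smallest simplex that contains the point `x`. -/
noncomputable def carrier (x : Realization K) : Finset V :=
  open Classical in x.2.2.choose.filter fun v => x.1 v ≠ 0

lemma mem_carrier {x : Realization K} {v : V} : v ∈ carrier x ↔ x.1 v ≠ 0 := by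
  classical
  simp only [carrier, Finset.mem_filter, and_iff_right_iff_imp]
  exact fun hv => by_contra fun h => hv (x.2.2.choose_spec.2.1 v h)

lemma mem_closedSimplex_iff {x : Realization K} {s : Finset V} :
    x ∈ closedSimplex K s ↔ carrier x ⊆ s :=
  ⟨fun h _ hv => by_contra fun hvs => mem_carrier.1 hv (h _ hvs),
    fun h _ hv => by_contra fun hx => hv (h (mem_carrier.2 hx))⟩

lemma mem_closedSimplex_carrier (x : Realization K) : x ∈ closedSimplex K (carrier x) :=
  mem_closedSimplex_iff.2 subset_rfl

lemma carrier_mem_faces (x : Realization K) : carrier x ∈ K.faces := by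
  obtain ⟨-, t, ht, h0, h1⟩ := x.2
  refine (K.isRelLowerSet_faces ht).2 (mem_closedSimplex_iff.1 h0) ?_
  by_contra hne
  rw [Finset.not_nonempty_iff_eq_empty] at hne
  have : ∑ v ∈ t, x.1 v = 0 := Finset.sum_eq_zero fun _ _ => by
    by_contra hv
    have := mem_carrier.2 hv
    simp [hne] at this
  rw [this] at h1
  exact zero_ne_one h1

lemma mem_skeleton_iff {x : Realization K} {m : ℕ} :
    x ∈ skeleton K m ↔ (carrier x).card ≤ m + 1 :=
  ⟨fun ⟨_, _, h1, h2⟩ => (Finset.card_le_card (mem_closedSimplex_iff.1 h2)).trans h1,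
    fun h => ⟨_, carrier_mem_faces x, h, mem_closedSimplex_carrier x⟩⟩

lemma closedSimplex_subset_skeleton {s : Finset V} (hs : s ∈ K.faces) {m : ℕ}
    (hm : s.card ≤ m + 1) : closedSimplex K s ⊆ skeleton K m := fun _ hx => ⟨s, hs, hm, hx⟩

/-- In the weak topology closedness is tested on one simplex at a time, where only the finitely many
faces of that simplex matter. -/
lemma continuousOn_skeleton {m : ℕ} {Y : Type*} [TopologicalSpace Y] {u : Realization K → Y}
    (h : ∀ s ∈ K.faces, s.card ≤ m + 1 → ContinuousOn u (closedSimplex K s)) :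
    ContinuousOn u (skeleton K m) := by
  classical
  rw [continuousOn_iff_isClosed]
  refine fun C hC => ⟨u ⁻¹' C ∩ skeleton K m, ?_, by rw [Set.inter_assoc, Set.inter_self]⟩
  refine isClosed_realization_iff.2 fun s => ?_
  have e : simplexMap K s ⁻¹' (u ⁻¹' C ∩ skeleton K m) =
      ⋃ t ∈ {t | t ∈ s.1.powerset ∧ t ∈ K.faces ∧ t.card ≤ m + 1},
        simplexMap K s ⁻¹' (closedSimplex K t ∩ u ⁻¹' C) := by
    ext x
    simp only [Set.mem_preimage, Set.mem_inter_iff, Set.mem_iUnion, Set.mem_ofPred_eq,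
      Finset.mem_powerset, exists_prop]
    constructor
    · rintro ⟨h1, h2⟩
      exact ⟨_, ⟨mem_closedSimplex_iff.1 (simplexMap_mem s x), carrier_mem_faces _,
        mem_skeleton_iff.1 h2⟩, mem_closedSimplex_carrier _, h1⟩
    · rintro ⟨t, ⟨-, ht, hc⟩, h1, h2⟩
      exact ⟨h2, t, ht, hc, h1⟩
  rw [e]
  refine Set.Finite.isClosed_biUnion ?_ fun t ht => ?_
  · exact (s.1.powerset.finite_toSet).subset fun t ht => ht.1
  · exact ((h t ht.2.1 ht.2.2).preimage_isClosed_of_isClosed (isClosed_closedSimplex t) hC).preimage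
      (continuous_simplexMap s)

end Topology

/-! ### Trivializations over simplices -/

section SimplexTrivialization

variable {V M E F : Type*} [TopologicalSpace M] [TopologicalSpace E] [TopologicalSpace F]
  {K : AbstractSimplicialComplex V} (T : Realization K ≃ₜ M)

lemma continuous_proj {p : E → M} (hp : ∀ x, ∃ e : Bundle.Trivialization F p, x ∈ e.baseSet) :
    Continuous p := continuous_iff_continuousAt.2 fun w => by
  obtain ⟨e, he⟩ := hp (p w)
  exact e.continuousAt_proj (e.mem_source.2 he)

/-- A trivialization of `p : E → M` over the set `S`. -/
structure SetTrivialization (F : Type*) [TopologicalSpace F] (p : E → M) (S : Set M) where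
  toE : M × F → E
  toF : E → F
  continuousOn_toE : ContinuousOn toE (S ×ˢ Set.univ)
  continuousOn_toF : ContinuousOn toF (p ⁻¹' S)
  proj_toE : ∀ x ∈ S, ∀ v, p (toE (x, v)) = x
  toF_toE : ∀ x ∈ S, ∀ v, toF (toE (x, v)) = v
  toE_toF : ∀ e, p e ∈ S → toE (p e, toF e) = e

/-- The bundle is pulled back to `ℝ^s` along the retraction onto the simplex and trivialized over
the unit cube, which contains all barycentric coordinates. -/
theorem nonempty_setTrivialization {p : E → M}
    (hp : ∀ x, ∃ e : Bundle.Trivialization F p, x ∈ e.baseSet) {s : Finset V} (hs : s ∈ K.faces) :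
    Nonempty (SetTrivialization F p (T '' closedSimplex K s)) := by
  have hne : Nonempty s := (K.isRelLowerSet_faces hs).1.to_subtype
  obtain ⟨r, hr, hri⟩ := exists_retract_stdSimplex s
  obtain ⟨θ, ψ, hθ, hψ, h⟩ := trivialOver_Icc hp
    (T.continuous.comp ((continuous_simplexMap ⟨s, hs⟩).comp hr))
  let B : M → (s → ℝ) := fun x v => (T.symm x).1 v
  have hB : Continuous B := continuous_pi fun v => (continuous_coord v.1).comp T.symm.continuous
  have hcB : ∀ x ∈ T '' closedSimplex K s, (T ∘ simplexMap K ⟨s, hs⟩ ∘ r) (B x) = x := by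
    rintro _ ⟨x, hx, rfl⟩
    have : B (T x) = (baryCoord ⟨x, hx⟩).1 := by ext v; simp [B, baryCoord]
    simp only [Function.comp_apply]
    rw [this, hri, simplexMap_baryCoord]
  have hBI : ∀ x ∈ T '' closedSimplex K s, B x ∈ Set.Icc (0 : s → ℝ) 1 := by
    rintro _ ⟨x, hx, rfl⟩
    have : B (T x) = (baryCoord ⟨x, hx⟩).1 := by ext v; simp [B, baryCoord]
    rw [this]
    have h2 := (baryCoord ⟨x, hx⟩).2
    exact ⟨fun v => h2.1 v, fun v => by
      rw [Pi.one_apply, ← h2.2]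
      exact Finset.single_le_sum (fun w _ => h2.1 w) (Finset.mem_univ v)⟩
  exact ⟨{
    toE := fun z => θ (B z.1, z.2)
    toF := fun e => ψ (B (p e), e)
    continuousOn_toE := hθ.comp (by fun_prop) fun z hz => ⟨hBI _ hz.1, trivial⟩
    continuousOn_toF := hψ.comp ((hB.comp (continuous_proj hp)).prodMk continuous_id).continuousOn
      fun e he => ⟨(hcB _ he).symm, hBI _ he⟩
    proj_toE := fun x hx v => by rw [((h _ (hBI x hx)).1 v).1, hcB x hx]
    toF_toE := fun x hx v => by
      dsimp only
      rw [((h _ (hBI x hx)).1 v).1, hcB x hx, ((h _ (hBI x hx)).1 v).2]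
    toE_toF := fun e he => (h _ (hBI _ he)).2 e (hcB _ he).symm }⟩

end SimplexTrivialization

/-! ### The cubical parametrization of simplices -/

section CubeCoord

variable {m : ℕ}

lemma continuous_cubeCoord (i : Fin (m + 1)) : Continuous fun y : Fin m → I => cubeCoord y i := by
  unfold cubeCoord
  split_ifs <;> fun_prop

/-- `yᵢ = 1` removes the factor `yᵢ` from the later coordinates and kills the coordinate `1 - yᵢ`,
leaving the parametrization of the face opposite to vertex `i`. -/
lemma cubeCoord_face_one (i : Fin (m + 1)) (y : Fin m → I) :
    cubeCoord (face i 1 y) i.castSucc = 0 ∧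
      ∀ l, cubeCoord (face i 1 y) (i.castSucc.succAbove l) = cubeCoord y l := by
  induction m with
  | zero =>
    obtain rfl : i = 0 := Fin.ext (by omega)
    refine ⟨by rw [Fin.castSucc_zero, cubeCoord_zero, face_same]; simp, fun l => ?_⟩
    rw [Fin.castSucc_zero, Fin.succAbove_zero, cubeCoord_succ, face_same]
    simp only [face_zero_succ, Set.Icc.coe_one, one_mul]
  | succ m ih =>
    induction i using Fin.cases with
    | zero =>
      refine ⟨by rw [Fin.castSucc_zero, cubeCoord_zero, face_same]; simp, fun l => ?_⟩
      rw [Fin.castSucc_zero, Fin.succAbove_zero, cubeCoord_succ, face_same]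
      simp only [face_zero_succ, Set.Icc.coe_one, one_mul]
    | succ i =>
      obtain ⟨h1, h2⟩ := ih i fun j => y j.succ
      rw [← Fin.succ_castSucc]
      refine ⟨?_, fun l => ?_⟩
      · rw [cubeCoord_succ]
        simp only [face_succ_succ, h1, mul_zero]
      · induction l using Fin.cases with
        | zero => rw [Fin.succ_succAbove_zero, cubeCoord_zero, face_succ_zero, cubeCoord_zero]
        | succ l =>
          rw [Fin.succ_succAbove_succ, cubeCoord_succ, cubeCoord_succ, face_succ_zero]
          simp only [face_succ_succ, h2]

/-- All coordinates after the `i`-th contain the factor `yᵢ`. -/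
lemma cubeCoord_face_zero_of_lt {i : Fin (m + 1)} (y : Fin m → I) {j : Fin (m + 2)}
    (hj : i.castSucc < j) : cubeCoord (face i 0 y) j = 0 := by
  rw [cubeCoord, Finset.prod_eq_zero (i := i), zero_mul]
  · simpa using hj
  · simp

lemma cubeCoord_face_last (y : Fin m → I) (l : Fin (m + 1)) :
    cubeCoord (face (Fin.last m) 0 y) l.castSucc = cubeCoord y l := by
  induction m with
  | zero =>
    obtain rfl : l = 0 := Fin.ext (by omega)
    rw [Fin.castSucc_zero, cubeCoord_zero, show (0 : Fin (0 + 1)) = Fin.last 0 from rfl, face_same]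
    simp [cubeCoord]
  | succ m ih =>
    rw [← Fin.succ_last]
    induction l using Fin.cases with
    | zero => rw [Fin.castSucc_zero, cubeCoord_zero, face_succ_zero, cubeCoord_zero]
    | succ l =>
      rw [← Fin.succ_castSucc, cubeCoord_succ, cubeCoord_succ, face_succ_zero]
      simp only [face_succ_succ, ih]

lemma exists_cubeCoord_eq_zero_iff {y : Fin m → I} :
    (∃ j, cubeCoord y j = 0) ↔ y ∈ Cube.boundary (Fin m) := by
  constructor
  · rintro ⟨j, hj⟩
    by_contra hb
    have h : ∀ i, y i ≠ 0 ∧ y i ≠ 1 := fun i =>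
      ⟨fun h => hb ⟨i, Or.inl h⟩, fun h => hb ⟨i, Or.inr h⟩⟩
    rw [cubeCoord, mul_eq_zero, Finset.prod_eq_zero_iff] at hj
    rcases hj with ⟨i, -, hi⟩ | hj
    · exact (h i).1 (Subtype.ext hi)
    · split_ifs at hj with hlt
      · exact (h ⟨j, hlt⟩).2 (Subtype.ext (sub_eq_zero.1 hj).symm)
      · exact one_ne_zero hj
  · rintro ⟨i, hi | hi⟩
    · refine ⟨Fin.last m, ?_⟩
      rw [cubeCoord, Finset.prod_eq_zero (i := i), zero_mul]
      · simp
      · rw [hi]; rfl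
    · refine ⟨i.castSucc, ?_⟩
      rw [cubeCoord, dif_pos (by simp)]
      simp [hi]

/-- The first coordinate determines `y₀`, and away from the boundary `y₀` can be divided out of the
others. -/
lemma cubeCoord_injOn {y y' : Fin m → I} (hy : y ∉ Cube.boundary (Fin m))
    (h : ∀ j, cubeCoord y j = cubeCoord y' j) : y = y' := by
  induction m with
  | zero => exact Subsingleton.elim _ _
  | succ m ih =>
    have h0 : y 0 = y' 0 := by
      have := h 0
      rw [cubeCoord_zero, cubeCoord_zero] at this
      exact Subtype.ext (by linarith)
    have hne : (y 0 : ℝ) ≠ 0 := fun h => hy ⟨0, Or.inl (Subtype.ext h)⟩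
    have ht := ih (y := fun j => y j.succ) (y' := fun j => y' j.succ)
      (fun ⟨i, hi⟩ => hy ⟨i.succ, hi⟩) fun j => by
        have := h j.succ
        rw [cubeCoord_succ, cubeCoord_succ, ← h0] at this
        exact mul_left_cancel₀ hne this
    ext1 j
    induction j using Fin.cases with
    | zero => exact h0
    | succ j => exact congrFun ht j

lemma exists_cubeCoord_eq {x : Fin (m + 1) → ℝ} (h0 : ∀ j, 0 ≤ x j) (h1 : ∑ j, x j = 1) :
    ∃ y : Fin m → I, ∀ j, cubeCoord y j = x j := by
  induction m with
  | zero =>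
    refine ⟨fun j => j.elim0, fun j => ?_⟩
    obtain rfl : j = 0 := Fin.ext (by omega)
    rw [Fin.sum_univ_one] at h1
    rw [h1]
    simp [cubeCoord]
  | succ m ih =>
    rw [Fin.sum_univ_succ] at h1
    have hs : 0 ≤ ∑ j : Fin (m + 1), x j.succ := Finset.sum_nonneg fun j _ => h0 _
    have hle : x 0 ≤ 1 := by linarith
    let t : I := ⟨1 - x 0, by linarith, by linarith [h0 0]⟩
    -- If `x 0 = 1` the remaining coordinates vanish, so they cannot be normalized, and the tail of
    -- `y` is arbitrary.
    rcases eq_or_ne (x 0) 1 with hx | hx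
    · refine ⟨face 0 t fun _ => 0, fun j => ?_⟩
      have hz : ∀ j : Fin (m + 1), x j.succ = 0 := fun j =>
        (Finset.sum_eq_zero_iff_of_nonneg fun j _ => h0 _).1 (by linarith) j (Finset.mem_univ j)
      induction j using Fin.cases with
      | zero => rw [cubeCoord_zero, face_same]; simp [t]
      | succ j => rw [cubeCoord_succ, face_same, hz]; simp [t, hx]
    · have hpos : 0 < 1 - x 0 := sub_pos.2 (lt_of_le_of_ne hle hx)
      obtain ⟨y, hy⟩ := ih (x := fun j => x j.succ / (1 - x 0))
        (fun j => div_nonneg (h0 _) hpos.le)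
        (by rw [← Finset.sum_div, div_eq_one_iff_eq hpos.ne']; linarith)
      refine ⟨face 0 t y, fun j => ?_⟩
      induction j using Fin.cases with
      | zero => rw [cubeCoord_zero, face_same]; simp [t]
      | succ j =>
        rw [cubeCoord_succ, face_same]
        simp only [face_zero_succ, hy, t]
        field_simp

end CubeCoord

/-! ### Faces and fibers of the cubical parametrization -/

section CubeMap

variable {V : Type*} [LinearOrder V] {K : AbstractSimplicialComplex V} {m : ℕ}

lemma cubeMap_vertex (s : Simplices K m) (y : Fin m → I) (i : Fin (m + 1)) :
    (cubeMap s y).1 (vertex s i) = cubeCoord y i := by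
  rw [cubeMap, simplexMap_of_mem _ _ (vertex_mem s i)]
  exact congrArg (cubeCoord y) ((s.1.orderIsoOfFin s.2.2).symm_apply_apply i)

lemma cubeMap_mem (s : Simplices K m) (y : Fin m → I) : cubeMap s y ∈ closedSimplex K s.1 :=
  simplexMap_mem ⟨s.1, s.2.1⟩ _

lemma exists_vertex {s : Simplices K m} {v : V} (hv : v ∈ s.1) : ∃ i, vertex s i = v := by
  have : v ∈ Set.range (s.1.orderEmbOfFin s.2.2) := by rwa [Finset.range_orderEmbOfFin]
  exact this

lemma vertex_injective (s : Simplices K m) : Function.Injective (vertex s) :=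
  (s.1.orderEmbOfFin s.2.2).injective

lemma eq_of_vertex {s : Simplices K m} {x x' : Realization K} (hx : x ∈ closedSimplex K s.1)
    (hx' : x' ∈ closedSimplex K s.1) (h : ∀ i, x.1 (vertex s i) = x'.1 (vertex s i)) : x = x' := by
  refine Subtype.ext (funext fun v => ?_)
  by_cases hv : v ∈ s.1
  · obtain ⟨i, rfl⟩ := exists_vertex hv
    exact h i
  · rw [hx v hv, hx' v hv]

lemma continuous_cubeMap (s : Simplices K m) : Continuous (cubeMap s) :=
  (continuous_simplexMap _).comp (Continuous.subtype_mk
    (continuous_pi fun v => continuous_cubeCoord ((s.1.orderIsoOfFin s.2.2).symm v)) _)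

lemma vertex_oppositeFace (s : Simplices K (m + 1)) (i : Fin (m + 2)) (l : Fin (m + 1)) :
    vertex (oppositeFace s i) l = vertex s (i.succAbove l) := by
  have h := Finset.orderEmbOfFin_unique' (oppositeFace s i).2.2
    (f := (Fin.succAboveOrderEmb i).trans (s.1.orderEmbOfFin s.2.2)) fun x =>
      Finset.mem_erase.2 ⟨fun h => Fin.succAbove_ne i x (vertex_injective s h), vertex_mem s _⟩
  exact (DFunLike.congr_fun h l).symm

lemma closedSimplex_oppositeFace_subset (s : Simplices K (m + 1)) (i : Fin (m + 2)) :
    closedSimplex K (oppositeFace s i).1 ⊆ closedSimplex K s.1 := fun _ hx v hv =>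
  hx v fun h => hv (Finset.mem_of_mem_erase h)

lemma cubeMap_eq_cubeMap_oppositeFace (s : Simplices K (m + 1)) (i : Fin (m + 2))
    {z : Fin (m + 1) → I} {y : Fin m → I} (h0 : cubeCoord z i = 0)
    (h1 : ∀ l, cubeCoord z (i.succAbove l) = cubeCoord y l) :
    cubeMap s z = cubeMap (oppositeFace s i) y := by
  refine eq_of_vertex (cubeMap_mem s _)
    (closedSimplex_oppositeFace_subset s _ (cubeMap_mem _ y)) fun j => ?_
  rw [cubeMap_vertex]
  rcases Fin.eq_self_or_eq_succAbove i j with rfl | ⟨l, rfl⟩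
  · rw [h0, cubeMap_mem (oppositeFace s j) y _ (Finset.notMem_erase _ _)]
  · rw [h1, ← vertex_oppositeFace, cubeMap_vertex]

lemma cubeMap_face_one (s : Simplices K (m + 1)) (i : Fin (m + 1)) (y : Fin m → I) :
    cubeMap s (face i 1 y) = cubeMap (oppositeFace s i.castSucc) y :=
  cubeMap_eq_cubeMap_oppositeFace s _ (cubeCoord_face_one i y).1 (cubeCoord_face_one i y).2

lemma cubeMap_face_last (s : Simplices K (m + 1)) (y : Fin m → I) :
    cubeMap s (face (Fin.last m) 0 y) = cubeMap (oppositeFace s (Fin.last (m + 1))) y :=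
  cubeMap_eq_cubeMap_oppositeFace s _ (cubeCoord_face_zero_of_lt y (Fin.castSucc_lt_last _))
    fun l => by rw [Fin.succAbove_last, cubeCoord_face_last]

/-- This face collapses onto the simplex spanned by the first `i + 1` vertices. For `i` not the last
index it drops at least one dimension, which is why it contributes no obstruction. -/
lemma cubeMap_face_zero_mem_skeleton (s : Simplices K (m + 1)) (i : Fin (m + 1)) (y : Fin m → I) :
    cubeMap s (face i 0 y) ∈ skeleton K i := by
  classical
  rw [mem_skeleton_iff]
  have : carrier (cubeMap s (face i 0 y)) ⊆ (Finset.Iic i.castSucc).image (vertex s) := by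
    intro v hv
    obtain ⟨j, rfl⟩ := exists_vertex (mem_closedSimplex_iff.1 (cubeMap_mem s _) hv)
    rw [mem_carrier, cubeMap_vertex] at hv
    refine Finset.mem_image_of_mem _ (Finset.mem_Iic.2 (not_lt.1 fun h => hv ?_))
    exact cubeCoord_face_zero_of_lt y h
  refine (Finset.card_le_card this).trans (Finset.card_image_le.trans ?_)
  simp

lemma carrier_cubeMap_card_le_iff (s : Simplices K m) (y : Fin m → I) :
    (carrier (cubeMap s y)).card ≤ m ↔ y ∈ Cube.boundary (Fin m) := by
  rw [← exists_cubeCoord_eq_zero_iff]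
  have hsub := mem_closedSimplex_iff.1 (cubeMap_mem s y)
  constructor
  · intro h
    have : ∃ v ∈ s.1, v ∉ carrier (cubeMap s y) := by
      by_contra! hc
      have := Finset.card_le_card hc
      rw [s.2.2] at this
      omega
    obtain ⟨v, hv, hvc⟩ := this
    obtain ⟨i, rfl⟩ := exists_vertex hv
    refine ⟨i, ?_⟩
    rwa [mem_carrier, cubeMap_vertex, not_not] at hvc
  · rintro ⟨i, hi⟩
    have : carrier (cubeMap s y) ⊂ s.1 := by
      refine ⟨hsub, fun h => ?_⟩
      have := h (vertex_mem s i)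
      rw [mem_carrier, cubeMap_vertex] at this
      exact this hi
    have := Finset.card_lt_card this
    rw [s.2.2] at this
    omega

lemma cubeMap_injOn {s : Simplices K m} {y y' : Fin m → I} (hy : y ∉ Cube.boundary (Fin m))
    (h : cubeMap s y = cubeMap s y') : y = y' :=
  cubeCoord_injOn hy fun j => by rw [← cubeMap_vertex s, h, cubeMap_vertex]

lemma exists_cubeMap_eq {s : Simplices K m} {x : Realization K} (hx : x ∈ closedSimplex K s.1) :
    ∃ y, cubeMap s y = x := by
  obtain ⟨y, hy⟩ := exists_cubeCoord_eq (m := m) (x := fun i => x.1 (vertex s i))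
    (fun i => x.2.1 _)
    (((s.1.orderIsoOfFin s.2.2).toEquiv.sum_comp fun v : s.1 => x.1 v).trans
      (sum_eq_one_of_mem hx))
  exact ⟨y, eq_of_vertex (cubeMap_mem s y) hx fun i => by rw [cubeMap_vertex, hy]⟩

end CubeMap

/-- The smallest simplex that contains the point `x`, as a simplex of dimension `m`. -/
noncomputable def carrierSimplex {V : Type*} {K : AbstractSimplicialComplex V} {m : ℕ}
    {x : Realization K} (h : (carrier x).card = m + 1) : Simplices K m :=
  ⟨carrier x, carrier_mem_faces x, h⟩

/-! ### Constructing maps skeleton by skeleton -/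

section Skeletal

variable {V : Type*} [LinearOrder V] {K : AbstractSimplicialComplex V}

/-- Barycentric coordinates are continuous and separate points. This makes images of compact cubes
closed. -/
instance : T2Space (Realization K) :=
  T2Space.of_injective_continuous (f := fun x : Realization K => x.1) Subtype.val_injective
    (continuous_pi continuous_coord)

/-- A continuous map from a compact cube to a Hausdorff space is closed, so `cubeMap s` is a
quotient map onto the closed simplex. -/
lemma continuousOn_of_comp_cubeMap {m : ℕ} {Y : Type*} [TopologicalSpace Y] {s : Simplices K m}
    {u : Realization K → Y} (h : Continuous (u ∘ cubeMap s)) :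
    ContinuousOn u (closedSimplex K s.1) := by
  rw [continuousOn_iff_isClosed]
  refine fun C hC => ⟨cubeMap s '' ((u ∘ cubeMap s) ⁻¹' C),
    ((hC.preimage h).isCompact.image (continuous_cubeMap s)).isClosed, ?_⟩
  ext x
  constructor
  · rintro ⟨h1, h2⟩
    obtain ⟨y, rfl⟩ := exists_cubeMap_eq h2
    exact ⟨⟨y, h1, rfl⟩, h2⟩
  · rintro ⟨⟨y, h1, rfl⟩, h2⟩
    exact ⟨h1, h2⟩

/-- A map on a skeleton, with values restricted by the relation `R`, can be constructed cell by
cell. -/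
theorem exists_skeletal_map {Y : Type*} [TopologicalSpace Y] [Nonempty Y]
    (R : Realization K → Y → Prop) (N : ℕ)
    (hext : ∀ m ≤ N, ∀ (s : Simplices K m) (g : (Fin m → I) → Y),
      ContinuousOn g (Cube.boundary (Fin m)) →
      (∀ y ∈ Cube.boundary (Fin m), R (cubeMap s y) (g y)) →
      ∃ G, Continuous G ∧ Set.EqOn G g (Cube.boundary (Fin m)) ∧ ∀ y, R (cubeMap s y) (G y)) :
    ∃ u : Realization K → Y, ContinuousOn u (skeleton K N) ∧ ∀ x ∈ skeleton K N, R x (u x) := by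
  classical
  suffices H : ∀ n ≤ N + 1, ∃ u : Realization K → Y,
      (∀ s ∈ K.faces, s.card ≤ n → ContinuousOn u (closedSimplex K s)) ∧
        ∀ x, (carrier x).card ≤ n → R x (u x) by
    obtain ⟨u, h1, h2⟩ := H (N + 1) le_rfl
    exact ⟨u, continuousOn_skeleton h1, fun x hx => h2 x (mem_skeleton_iff.1 hx)⟩
  intro n
  induction n with
  | zero =>
    intro _
    have h0 : ∀ s ∈ K.faces, ¬ s.card ≤ 0 := fun s hs hc => by
      have := (K.isRelLowerSet_faces hs).1
      rw [Finset.card_eq_zero.1 (Nat.le_zero.1 hc)] at this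
      exact Finset.not_nonempty_empty this
    exact ⟨fun _ => Classical.arbitrary Y, fun s hs hc => absurd hc (h0 s hs),
      fun x hx => absurd hx (h0 _ (carrier_mem_faces x))⟩
  | succ n ih =>
    intro hn
    obtain ⟨u, hu, huR⟩ := ih (by omega)
    have hlow : ∀ s : Simplices K n,
        ContinuousOn (u ∘ cubeMap s) (Cube.boundary (Fin n)) := by
      intro s
      cases n with
      | zero => exact fun y hy => hy.choose.elim0
      | succ m =>
        exact (continuousOn_skeleton hu).comp (continuous_cubeMap s).continuousOn fun y hy =>
          mem_skeleton_iff.2 ((carrier_cubeMap_card_le_iff s y).2 hy)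
    choose G hG hGu hGR using fun s : Simplices K n =>
      hext n (by omega) s _ (hlow s) fun y hy =>
        huR _ ((carrier_cubeMap_card_le_iff s y).2 hy)
    -- A point with carrier of dimension `n` is interior to a unique `n`-simplex and has a unique
    -- cubical preimage there, so the choice is harmless.
    let u' : Realization K → Y := fun x => if h : (carrier x).card = n + 1 then
      G (carrierSimplex h) (exists_cubeMap_eq (s := carrierSimplex h)
        (mem_closedSimplex_carrier x)).choose else u x
    have hu' : ∀ x, (carrier x).card ≤ n → u' x = u x := fun x hx => dif_neg (by omega)
    have hG' : ∀ (s : Simplices K n) y, u' (cubeMap s y) = G s y := by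
      intro s y
      by_cases hy : y ∈ Cube.boundary (Fin n)
      · rw [hu' _ ((carrier_cubeMap_card_le_iff s y).2 hy), hGu s hy]
        rfl
      · have hc : ¬ (carrier (cubeMap s y)).card ≤ n := fun h =>
          hy ((carrier_cubeMap_card_le_iff s y).1 h)
        have hsub := mem_closedSimplex_iff.1 (cubeMap_mem s y)
        have he : carrier (cubeMap s y) = s.1 :=
          Finset.eq_of_subset_of_card_le hsub (by rw [s.2.2]; omega)
        have hcard : (carrier (cubeMap s y)).card = n + 1 := by rw [he, s.2.2]
        have hs : carrierSimplex hcard = s :=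
          Subtype.ext he
        have key : ∀ (s' : Simplices K n) (h : ∃ y', cubeMap s' y' = cubeMap s y), s' = s →
            G s' h.choose = G s y := by
          rintro s' h rfl
          exact congrArg (G s') (cubeMap_injOn hy h.choose_spec.symm).symm
        simp only [u']
        rw [dif_pos hcard]
        exact key _ _ hs
    refine ⟨u', fun s hs hc => ?_, fun x hx => ?_⟩
    · rcases hc.lt_or_eq with hlt | heq
      · refine (hu s hs (by omega)).congr fun x hx => hu' x ?_
        exact (Finset.card_le_card (mem_closedSimplex_iff.1 hx)).trans (by omega)
      · refine continuousOn_of_comp_cubeMap (s := ⟨s, hs, heq⟩) ?_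
        exact (hG ⟨s, hs, heq⟩).congr fun y => (hG' _ y).symm
    · by_cases h : (carrier x).card = n + 1
      · obtain ⟨y, hy⟩ := exists_cubeMap_eq (s := carrierSimplex h)
          (mem_closedSimplex_carrier x)
        have h1 := hGR (carrierSimplex h) y
        rw [← hG' (carrierSimplex h) y, hy] at h1
        exact h1
      · simp only [u']
        rw [dif_neg h]
        exact huR x (by omega)

end Skeletal

/-! ### Homotopies on subsets -/

section HomotopicOn

variable {X Y Z : Type*} [TopologicalSpace X] [TopologicalSpace Y] [TopologicalSpace Z]

/-- The restrictions of `f` and `g` to `D` are homotopic as maps to `S`. -/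
def HomotopicOn (D : Set X) (S : Set Y) (f g : X → Y) : Prop :=
  ∃ H : I × X → Y, ContinuousOn H (Set.univ ×ˢ D) ∧ (∀ t, ∀ x ∈ D, H (t, x) ∈ S) ∧
    (∀ x ∈ D, H (0, x) = f x) ∧ ∀ x ∈ D, H (1, x) = g x

variable {D : Set X} {S : Set Y} {f g h : X → Y}

lemma HomotopicOn.refl (hf : ContinuousOn f D) (hS : Set.MapsTo f D S) : HomotopicOn D S f f :=
  ⟨fun z => f z.2, hf.comp continuous_snd.continuousOn fun _ hz => hz.2, fun _ _ hx => hS hx,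
    fun _ _ => rfl, fun _ _ => rfl⟩

lemma HomotopicOn.congr {f' g' : X → Y} (h : HomotopicOn D S f g) (hf : Set.EqOn f f' D)
    (hg : Set.EqOn g g' D) : HomotopicOn D S f' g' := by
  obtain ⟨H, h1, h2, h3, h4⟩ := h
  exact ⟨H, h1, h2, fun x hx => (h3 x hx).trans (hf hx), fun x hx => (h4 x hx).trans (hg hx)⟩

lemma HomotopicOn.symm (h : HomotopicOn D S f g) : HomotopicOn D S g f := by
  obtain ⟨H, h1, h2, h3, h4⟩ := h
  refine ⟨fun z => H (unitInterval.symm z.1, z.2), h1.comp (by fun_prop) fun z hz =>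
    ⟨trivial, hz.2⟩, fun t x hx => h2 _ x hx, fun x hx => ?_, fun x hx => ?_⟩
  · simpa using h4 x hx
  · simpa using h3 x hx

lemma HomotopicOn.trans (hfg : HomotopicOn D S f g) (hgh : HomotopicOn D S g h) :
    HomotopicOn D S f h := by
  classical
  obtain ⟨H, h1, h2, h3, h4⟩ := hfg
  obtain ⟨H', h1', h2', h3', h4'⟩ := hgh
  let a : I → I := fun t => Set.projIcc 0 1 zero_le_one (2 * (t : ℝ))
  let a' : I → I := fun t => Set.projIcc 0 1 zero_le_one (2 * (t : ℝ) - 1)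
  have ha : Continuous a := continuous_projIcc.comp (by fun_prop)
  have ha' : Continuous a' := continuous_projIcc.comp (by fun_prop)
  let G : I × X → Y := fun z => if (z.1 : ℝ) ≤ 1 / 2 then H (a z.1, z.2) else H' (a' z.1, z.2)
  have e1 : ∀ z : I × X, (z.1 : ℝ) ≤ 1 / 2 → G z = H (a z.1, z.2) := fun z hz => if_pos hz
  have e2 : ∀ z : I × X, z.2 ∈ D → 1 / 2 ≤ (z.1 : ℝ) → G z = H' (a' z.1, z.2) := by
    intro z hD hz
    by_cases hle : (z.1 : ℝ) ≤ 1 / 2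
    · have : (z.1 : ℝ) = 1 / 2 := le_antisymm hle hz
      rw [e1 z hle]
      have a1 : a z.1 = 1 := Set.projIcc_of_right_le zero_le_one (by rw [this]; norm_num)
      have a2 : a' z.1 = 0 := Set.projIcc_of_le_left zero_le_one (by rw [this]; norm_num)
      rw [a1, a2, h4 _ hD, h3' _ hD]
    · exact if_neg hle
  refine ⟨G, ?_, fun t x hx => ?_, fun x hx => ?_, fun x hx => ?_⟩
  · have hu : (Set.univ : Set I) ×ˢ D = (Set.univ ×ˢ D) ∩
        ({z : I × X | (z.1 : ℝ) ≤ 1 / 2} ∪ {z : I × X | 1 / 2 ≤ (z.1 : ℝ)}) := by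
      rw [eq_comm, Set.inter_eq_left]
      exact fun z _ => le_total (z.1 : ℝ) (1 / 2)
    rw [hu]
    refine continuousOn_inter_union (isClosed_le (by fun_prop) continuous_const)
      (isClosed_le continuous_const (by fun_prop)) ?_ ?_
    · refine ContinuousOn.congr ?_ fun z hz => e1 z hz.2
      exact h1.comp ((ha.comp continuous_fst).prodMk continuous_snd).continuousOn fun z hz =>
        ⟨trivial, hz.1.2⟩
    · refine ContinuousOn.congr ?_ fun z hz => e2 z hz.1.2 hz.2
      exact h1'.comp ((ha'.comp continuous_fst).prodMk continuous_snd).continuousOn fun z hz =>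
        ⟨trivial, hz.1.2⟩
  · simp only [G]
    split_ifs
    · exact h2 _ x hx
    · exact h2' _ x hx
  · rw [e1 _ (by norm_num)]
    have : a 0 = 0 := Set.projIcc_of_le_left zero_le_one (by norm_num)
    simp only [this, h3 x hx]
  · rw [e2 _ hx (by norm_num)]
    have : a' 1 = 1 := Set.projIcc_of_right_le zero_le_one (by norm_num)
    simp only [this, h4' x hx]

lemma HomotopicOn.postcomp {S' : Set Z} (h : HomotopicOn D S f g) {φ : Y → Z}
    (hφ : ContinuousOn φ S) (hS : Set.MapsTo φ S S') : HomotopicOn D S' (φ ∘ f) (φ ∘ g) := by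
  obtain ⟨H, h1, h2, h3, h4⟩ := h
  exact ⟨fun z => φ (H z), hφ.comp h1 fun z hz => h2 _ _ hz.2, fun t x hx => hS (h2 t x hx),
    fun x hx => congrArg φ (h3 x hx), fun x hx => congrArg φ (h4 x hx)⟩

lemma HomotopicOn.precomp {D' : Set Z} (h : HomotopicOn D S f g) {φ : Z → X}
    (hφ : ContinuousOn φ D') (hD : Set.MapsTo φ D' D) : HomotopicOn D' S (f ∘ φ) (g ∘ φ) := by
  obtain ⟨H, h1, h2, h3, h4⟩ := h
  exact ⟨fun z => H (z.1, φ z.2), h1.comp (continuous_fst.continuousOn.prodMk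
    (hφ.comp continuous_snd.continuousOn fun z hz => hz.2)) fun z hz => ⟨trivial, hD hz.2⟩,
    fun t x hx => h2 t _ (hD hx), fun x hx => h3 _ (hD hx), fun x hx => h4 _ (hD hx)⟩

lemma homotopicOn_of_subtype (H : C(I × D, Y)) (hS : ∀ z, H z ∈ S)
    (h0 : ∀ x : D, H (0, x) = f x) (h1 : ∀ x : D, H (1, x) = g x) : HomotopicOn D S f g := by
  classical
  refine ⟨fun z => if h : z.2 ∈ D then H (z.1, ⟨z.2, h⟩) else f z.2, ?_, fun t x hx => ?_,
    fun x hx => ?_, fun x hx => ?_⟩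
  · rw [continuousOn_iff_continuous_domRestrict]
    have : Continuous fun z : ((Set.univ : Set I) ×ˢ D : Set (I × X)) =>
        H (z.1.1, ⟨z.1.2, z.2.2⟩) := by fun_prop
    refine this.congr fun z => ?_
    change _ = if h : z.1.2 ∈ D then H (z.1.1, ⟨z.1.2, h⟩) else f z.1.2
    rw [dif_pos z.2.2]
  · dsimp only
    rw [dif_pos hx]; exact hS _
  · dsimp only
    rw [dif_pos hx]; exact h0 ⟨x, hx⟩
  · dsimp only
    rw [dif_pos hx]; exact h1 ⟨x, hx⟩

lemma HomotopicOn.exists_subtype (h : HomotopicOn D S f g) :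
    ∃ H : C(I × D, Y), (∀ z, H z ∈ S) ∧ (∀ x : D, H (0, x) = f x) ∧
      ∀ x : D, H (1, x) = g x := by
  obtain ⟨H, h1, h2, h3, h4⟩ := h
  exact ⟨⟨fun z => H (z.1, z.2), h1.comp_continuous (by fun_prop) fun z => ⟨trivial, z.2.2⟩⟩,
    fun z => h2 _ _ z.2.2, fun x => h3 _ x.2, fun x => h4 _ x.2⟩

lemma degree_eq_of_homotopicOn {k : ℕ} {f g : (Fin (k + 2) → I) → Sph (k + 2)}
    (h : HomotopicOn (Cube.boundary (Fin (k + 2))) Set.univ f g) : degree f = degree g := by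
  obtain ⟨H, h1, -, h3, h4⟩ := h
  rw [← degree_congr h3, degree_homotopy h1, degree_congr h4]

/-- Every map from the boundary of a cube to a path connected space is homotopic to a map that is
constant away from one face. -/
theorem exists_homotopicOn_onCubeBoundary {d : ℕ} (hX : CubeExtension X 1) (b : X)
    {g : (Fin (d + 1) → I) → X} (hg : ContinuousOn g (Cube.boundary (Fin (d + 1)))) :
    ∃ f : GenLoop (Fin d) X b,
      HomotopicOn (Cube.boundary (Fin (d + 1))) Set.univ g (onCubeBoundary f) := by
  classical
  -- `J` is the boundary without the open face `y₀ = 1`. It contracts to the origin: first `y₀`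
  -- shrinks to `0`, then the other coordinates do. Hence `g` on `J` deforms to a constant, which a
  -- path moves to `b`.
  let J : Set (Fin (d + 1) → I) := {y | y 0 = 0 ∨ (fun j : Fin d => y j.succ) ∈ Cube.boundary _}
  have hJ : J ⊆ Cube.boundary (Fin (d + 1)) := fun y hy => by
    rw [← face_zero_tail y, face_zero_mem_boundary_iff]
    exact hy.imp Or.inl id
  have hJc : IsClosed J := (isClosed_eq (continuous_apply 0) continuous_const).union
    ((isClosed_boundary d).preimage continuous_tail)
  have c1 : HomotopicOn J J id fun y => face 0 0 fun j => y j.succ := by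
    refine ⟨fun z => face 0 (unitInterval.symm z.1 * z.2 0) fun j => z.2 j.succ,
      (continuous_face_zero.comp (by fun_prop : Continuous fun z : I × (Fin (d + 1) → I) =>
        (unitInterval.symm z.1 * z.2 0, fun j : Fin d => z.2 j.succ))).continuousOn, ?_, ?_, ?_⟩
    · rintro t y (hy | hy)
      · exact Or.inl (by simp [hy])
      · exact Or.inr (by simpa using hy)
    · intro y _; simpa using face_zero_tail y
    · intro y _; simp
  have c2 : HomotopicOn J J (fun y => face 0 0 fun j => y j.succ) fun _ _ => 0 := by
    refine ⟨fun z => face 0 0 fun j => unitInterval.symm z.1 * z.2 j.succ,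
      ((continuous_face 0 0).comp (by fun_prop)).continuousOn, ?_, ?_, ?_⟩
    · exact fun t y _ => Or.inl (face_same _ _ _)
    · intro y _; simp
    · intro y _
      ext1 j
      induction j using Fin.cases <;> simp
  have c3 : HomotopicOn J Set.univ g fun _ => g fun _ => 0 :=
    (c1.trans c2).postcomp (hg.mono hJ) fun _ _ => trivial
  have c4 : HomotopicOn J Set.univ (fun _ => g fun _ => 0) fun _ => b := by
    obtain ⟨P, hP, h0, h1, -⟩ := hX.prism (m := 0) (g₀ := fun _ => g fun _ => 0)
      (g₁ := fun _ => b) continuous_const continuous_const (H := fun _ => b) continuousOn_const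
      (fun y hy => hy.choose.elim0) (fun y hy => hy.choose.elim0)
    exact ⟨fun z => P (z.1, fun j => j.elim0), (hP.comp (by fun_prop)).continuousOn,
      fun _ _ _ => trivial, fun _ _ => h0 _, fun _ _ => h1 _⟩
  obtain ⟨H, hH, -, H0, H1⟩ := c3.trans c4
  have hfJ : ∀ y : Fin d → I, y ∈ Cube.boundary (Fin d) → face 0 1 y ∈ J := fun y hy =>
    Or.inr (by simpa using hy)
  -- The deformation on `J` is extended over the remaining face; its end on that face is the
  -- required based map.
  obtain ⟨G, hG, G0, GH⟩ := exists_homotopy_extension (g := fun y => g (face 0 1 y))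
    (H := fun z => H (z.1, face 0 1 z.2))
    (hg.comp_continuous (continuous_face 0 1) fun y => face_mem_boundary 0 (Or.inr rfl) y)
    (hH.comp (by fun_prop) fun z hz => ⟨trivial, hfJ _ hz.2⟩) fun y hy => H0 _ (hfJ y hy)
  let f : GenLoop (Fin d) X b := ⟨⟨fun y => G (1, y), hG.comp (by fun_prop)⟩, fun y hy =>
    (GH 1 y hy).trans (H1 _ (hfJ y hy))⟩
  let L : I × (Fin (d + 1) → I) → X := fun z =>
    if z.2 0 = 1 then G (z.1, fun j => z.2 j.succ) else H z
  have L1 : ∀ z : I × (Fin (d + 1) → I), z.2 0 = 1 → L z = G (z.1, fun j => z.2 j.succ) :=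
    fun z hz => if_pos hz
  have LJ : ∀ z : I × (Fin (d + 1) → I), z.2 ∈ J → L z = H z := by
    rintro ⟨t, y⟩ hz
    by_cases hy : y 0 = 1
    · rw [L1 _ hy]
      rcases hz with hz | hz
      · exact absurd (hz.symm.trans hy) zero_ne_one
      · have e := face_zero_tail y
        rw [hy] at e
        exact (GH t _ hz).trans (by rw [e])
    · exact if_neg hy
  have hcase : ∀ y ∈ Cube.boundary (Fin (d + 1)), y 0 = 1 ∨ y ∈ J := fun y hy => by
    rw [← face_zero_tail y, face_zero_mem_boundary_iff] at hy
    rcases hy with (hy | hy) | hy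
    · exact Or.inr (Or.inl hy)
    · exact Or.inl hy
    · exact Or.inr (Or.inr hy)
  refine ⟨f, L, ?_, fun _ _ _ => trivial, fun y hy => ?_, fun y hy => ?_⟩
  · have hu : (Set.univ : Set I) ×ˢ Cube.boundary (Fin (d + 1)) =
        (Set.univ ×ˢ Cube.boundary (Fin (d + 1))) ∩ ({z | z.2 0 = 1} ∪ {z | z.2 ∈ J}) := by
      rw [eq_comm, Set.inter_eq_left]
      exact fun z hz => hcase _ hz.2
    rw [hu]
    refine continuousOn_inter_union (isClosed_eq (by fun_prop) continuous_const)
      (hJc.preimage continuous_snd) ?_ ?_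
    · exact (hG.comp (by fun_prop : Continuous fun z : I × (Fin (d + 1) → I) =>
        (z.1, fun j : Fin d => z.2 j.succ))).continuousOn.congr fun z hz => L1 z hz.2
    · exact (hH.mono fun z hz => ⟨trivial, hz.2⟩).congr fun z hz => LJ z hz.2
  · rcases hcase y hy with h | h
    · rw [L1 _ h, G0]
      have e := face_zero_tail y
      rw [h] at e
      rw [e]
    · rw [LJ _ h, H0 y h]
  · by_cases h : y 0 = 1
    · rw [L1 _ h, onCubeBoundary, if_pos h]
      rfl
    · rw [LJ _ ((hcase y hy).resolve_left h), H1 _ ((hcase y hy).resolve_left h), onCubeBoundary,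
        if_neg h]

end HomotopicOn

/-! ### Obstruction cochains -/

section Obstruction

variable {M E V : Type*} [TopologicalSpace M] [TopologicalSpace E]
  {K : AbstractSimplicialComplex V} (T : Realization K ≃ₜ M) {k : ℕ} (p : E → M)
  (J : M → Set (Sph (k + 2) → E))

/-- With respect to a family `J` of oriented maps from the sphere to the fibers of `p`: the map `r`
is, over the simplex `s`, a left homotopy inverse of the oriented maps. -/
structure OrientedRetraction (s : Finset V) (r : E → Sph (k + 2)) : Prop where
  continuousOn : ContinuousOn r (p ⁻¹' (T '' closedSimplex K s))
  homotopicOn : ∀ x ∈ T '' closedSimplex K s, ∀ j ∈ J x, HomotopicOn Set.univ Set.univ (r ∘ j) id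

/-- Over each simplex, the oriented maps have homotopy inverses. -/
def HasRetractions : Prop :=
  ∀ s ∈ K.faces, ∀ x ∈ T '' closedSimplex K s, ∃ r, OrientedRetraction T p J s r ∧
    ∃ j ∈ J x, Continuous j ∧ (∀ v, p (j v) = x) ∧
      HomotopicOn (p ⁻¹' (T '' closedSimplex K s)) (p ⁻¹' (T '' closedSimplex K s)) id (j ∘ r)

lemma image_closedSimplex_mono {s s' : Finset V} (h : s ⊆ s') :
    T '' closedSimplex K s ⊆ T '' closedSimplex K s' :=
  Set.image_mono fun _ hx v hv => hx v fun hs => hv (h hs)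

variable {T p J}

/-- `r ∘ g` is homotopic to `r ∘ j ∘ r' ∘ g`, and `r ∘ j` is homotopic to the identity. Hence the
degree may be computed with a retraction over a face or over the whole simplex. -/
lemma OrientedRetraction.degree_comp_eq {s s' : Finset V} {r r' : E → Sph (k + 2)} {x : M}
    {j : Sph (k + 2) → E} (hr : OrientedRetraction T p J s r)
    (hr' : OrientedRetraction T p J s' r') (hs : s' ⊆ s) (hx : x ∈ T '' closedSimplex K s')
    (hj : j ∈ J x)
    (hjr : HomotopicOn (p ⁻¹' (T '' closedSimplex K s')) (p ⁻¹' (T '' closedSimplex K s')) id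
      (j ∘ r')) {g : (Fin (k + 2) → I) → E} (hg : ContinuousOn g (Cube.boundary (Fin (k + 2))))
    (hgs : Set.MapsTo g (Cube.boundary (Fin (k + 2))) (p ⁻¹' (T '' closedSimplex K s'))) :
    degree (r ∘ g) = degree (r' ∘ g) := by
  have hs' := image_closedSimplex_mono T hs
  refine degree_eq_of_homotopicOn (HomotopicOn.trans (g := r ∘ j ∘ r' ∘ g) ?_ ?_)
  · exact (hjr.precomp hg hgs).postcomp (hr.continuousOn.mono (Set.preimage_mono hs'))
      fun _ _ => trivial
  · exact (hr.homotopicOn x (hs' hx) j hj).precomp (hr'.continuousOn.comp hg hgs) fun _ _ => trivial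

variable [LinearOrder V]

variable (T p J) in
/-- The class `α` is the obstruction to extending the section `s` over the simplex `τ`. -/
def Represents (s : Realization K → E) (τ : Simplices K (k + 2)) (α : SphereCoeff k) : Prop :=
  ∃ f, SphereCoeff.mk f = α ∧ ∃ j ∈ J (T (cubeMap τ fun _ => 0)),
    HomotopicOn (Cube.boundary (Fin (k + 2))) (p ⁻¹' (T '' closedSimplex K τ.1)) (s ∘ cubeMap τ)
      (j ∘ onCubeBoundary f)

lemma mem_image_cubeMap {m : ℕ} (τ : Simplices K m) (y : Fin m → I) :
    T (cubeMap τ y) ∈ T '' closedSimplex K τ.1 := ⟨_, cubeMap_mem τ y, rfl⟩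

/-- An oriented retraction turns the homotopy in the definition of `Represents` into one of maps to
the sphere; in particular, given such a retraction, `α` is determined by `s` and `τ`. -/
lemma Represents.degree_eq {s : Realization K → E} {τ : Simplices K (k + 2)} {α : SphereCoeff k}
    (h : Represents T p J s τ α) {σ' : Finset V} (hτ : τ.1 ⊆ σ') {r : E → Sph (k + 2)}
    (hr : OrientedRetraction T p J σ' r) : degree (r ∘ s ∘ cubeMap τ) = α := by
  obtain ⟨f, rfl, j, hj, h⟩ := h
  have hs' := image_closedSimplex_mono T hτ
  rw [← degree_onCubeBoundary]
  refine degree_eq_of_homotopicOn (HomotopicOn.trans (g := r ∘ j ∘ onCubeBoundary f) ?_ ?_)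
  · exact h.postcomp (hr.continuousOn.mono (Set.preimage_mono hs')) fun _ _ => trivial
  · exact (hr.homotopicOn _ (hs' (mem_image_cubeMap τ _)) j hj).precomp
      (continuousOn_onCubeBoundary f) fun _ _ => trivial

lemma cubeMap_mem_skeleton {m : ℕ} (τ : Simplices K m) {N : ℕ} (hm : m ≤ N) (y : Fin m → I) :
    cubeMap τ y ∈ skeleton K N :=
  closedSimplex_subset_skeleton τ.2.1 (by rw [τ.2.2]; omega) (cubeMap_mem τ y)

lemma mapsTo_cubeMap_boundary {m : ℕ} (τ : Simplices K (m + 1)) :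
    Set.MapsTo (cubeMap τ) (Cube.boundary (Fin (m + 1))) (skeleton K m) := fun y hy =>
  mem_skeleton_iff.2 ((carrier_cubeMap_card_le_iff τ y).2 hy)

lemma HasRetractions.exists_represents (hJ : HasRetractions T p J) {s : Realization K → E}
    (hs : IsSkeletonSection T p (k + 1) s) (τ : Simplices K (k + 2)) :
    ∃ α, Represents T p J s τ α := by
  obtain ⟨r, hr, j, hj, hjc, hjx, hjr⟩ := hJ τ.1 τ.2.1 _ (mem_image_cubeMap (T := T) τ fun _ => 0)
  have hc : ContinuousOn (s ∘ cubeMap τ) (Cube.boundary (Fin (k + 2))) :=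
    hs.1.comp (continuous_cubeMap τ).continuousOn (mapsTo_cubeMap_boundary τ)
  have hm : Set.MapsTo (s ∘ cubeMap τ) (Cube.boundary (Fin (k + 2)))
      (p ⁻¹' (T '' closedSimplex K τ.1)) := fun y hy => by
    change p (s (cubeMap τ y)) ∈ T '' closedSimplex K τ.1
    rw [hs.2 _ (mapsTo_cubeMap_boundary τ hy)]
    exact mem_image_cubeMap τ y
  obtain ⟨f, hf⟩ := exists_homotopicOn_onCubeBoundary (cubeExtension_sphere (by omega))
    (basePt (k + 1)) (hr.continuousOn.comp hc hm)
  refine ⟨_, f, rfl, j, hj, HomotopicOn.trans (g := j ∘ r ∘ s ∘ cubeMap τ) ?_ ?_⟩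
  · exact hjr.precomp hc hm
  · refine hf.postcomp hjc.continuousOn fun v _ => ?_
    rw [Set.mem_preimage, hjx]
    exact mem_image_cubeMap τ _

/-- The simplicial coboundary in the shape of a cubical one: the last simplicial face is paired with
the last face `y = 0`, using `(-1)^(m+1) = -(-1)^m`, and all other faces `yᵢ = 0` count as zero. -/
lemma coboundary_apply_eq {A : Type*} [AddCommGroup A] {m : ℕ} (f : Simplices K m → A)
    (σ' : Simplices K (m + 1)) :
    coboundary K A m f σ' = ∑ i : Fin (m + 1),
      (-1 : ℤ) ^ (i : ℕ) • (f (oppositeFace σ' i.castSucc) -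
      if i = Fin.last m then f (oppositeFace σ' (Fin.last (m + 1))) else 0) := by
  simp_rw [smul_sub, Finset.sum_sub_distrib]
  change ∑ i : Fin (m + 2), _ = _
  rw [Fin.sum_univ_castSucc]
  simp [pow_succ, sub_eq_add_neg]

lemma oppositeFace_subset {m : ℕ} (σ' : Simplices K (m + 1)) (i : Fin (m + 2)) :
    (oppositeFace σ' i).1 ⊆ σ'.1 := Finset.erase_subset _ _

/-- Obstruction cochains are cocycles. -/
theorem HasRetractions.mem_cocycles (hJ : HasRetractions T p J) {s : Realization K → E}
    (hs : IsSkeletonSection T p (k + 1) s) {z : Simplices K (k + 2) → SphereCoeff k}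
    (hz : ∀ τ, Represents T p J s τ (z τ)) : z ∈ cocycles K (SphereCoeff k) (k + 2) := by
  refine (AddMonoidHom.mem_ker).2 (funext fun ς => ?_)
  -- A single retraction over the whole simplex computes the obstructions on all its faces, so they
  -- can be compared in one cube.
  obtain ⟨r, hr, -⟩ := hJ ς.1 ς.2.1 _ (mem_image_cubeMap (T := T) ς fun _ => 0)
  rw [coboundary_apply_eq]
  refine Eq.trans ?_ (cubeD_degree (r ∘ s ∘ cubeMap ς))
  refine Finset.sum_congr rfl fun i _ => ?_
  congr 2
  · have : (r ∘ s ∘ cubeMap ς) ∘ face i 1 = r ∘ s ∘ cubeMap (oppositeFace ς i.castSucc) :=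
      funext fun y => congrArg (fun x => r (s x)) (cubeMap_face_one ς i y)
    rw [this, (hz _).degree_eq (oppositeFace_subset ς _) hr]
  · split_ifs with hi
    · subst hi
      have : (r ∘ s ∘ cubeMap ς) ∘ face (Fin.last _) 0 =
          r ∘ s ∘ cubeMap (oppositeFace ς (Fin.last _)) :=
        funext fun y => congrArg (fun x => r (s x)) (cubeMap_face_last ς y)
      rw [this, (hz _).degree_eq (oppositeFace_subset ς _) hr]
    -- A collapsed face lies in the `(n-1)`-skeleton, so the section is continuous on all of it and
    -- the degree vanishes.
    · have hsk : ∀ y, cubeMap ς (face i 0 y) ∈ skeleton K (k + 1) := fun y => by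
        have h1 := mem_skeleton_iff.1 (cubeMap_face_zero_mem_skeleton ς i y)
        have h2 : (i : ℕ) < k + 2 := Fin.val_lt_last hi
        exact mem_skeleton_iff.2 (by omega)
      have hc : Continuous fun y => s (cubeMap ς (face i 0 y)) :=
        hs.1.comp_continuous ((continuous_cubeMap ς).comp (continuous_face i 0)) hsk
      exact (degree_eq_zero (hr.continuousOn.comp_continuous hc fun y => by
        rw [Set.mem_preimage, hs.2 _ (hsk y)]
        exact mem_image_cubeMap ς _)).symm

end Obstruction

/-! ### Sections over skeleta, and homotopies between them -/

section Slab

variable {X E : Type*} [TopologicalSpace E]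

/-- The map on `I × X` that is `s` and `s'` at the ends and `u` in between. -/
noncomputable def slab (s s' : X → E) (u : X → C(I, E)) (t : I)
    (x : X) : E :=
  open Classical in if t = 0 then s x else if t = 1 then s' x else u x t

lemma slab_zero (s s' : X → E) (u : X → C(I, E)) : slab s s' u 0 = s :=
  funext fun _ => if_pos rfl

lemma slab_one (s s' : X → E) (u : X → C(I, E)) : slab s s' u 1 = s' :=
  funext fun _ => (if_neg one_ne_zero).trans (if_pos rfl)

lemma slab_eq {s s' : X → E} {u : X → C(I, E)} {x : X}
    (h0 : u x 0 = s x) (h1 : u x 1 = s' x) (t : I) : slab s s' u t x = u x t := by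
  unfold slab
  split_ifs with h h'
  · rw [h, h0]
  · rw [h', h1]
  · rfl

end Slab

/-! ### Existence of sections and the difference cochain -/

section Sections

variable {M E F V : Type*} [TopologicalSpace M] [TopologicalSpace E] [TopologicalSpace F]
  [LinearOrder V] {K : AbstractSimplicialComplex V} {T : Realization K ≃ₜ M} {p : E → M}

lemma SetTrivialization.continuous_toE_comp {X : Type*} [TopologicalSpace X] {S : Set M}
    (S' : SetTrivialization F p S) {c : X → M} (hc : Continuous c) (hS : ∀ x, c x ∈ S) {f : X → F}
    (hf : Continuous f) : Continuous fun x => S'.toE (c x, f x) :=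
  S'.continuousOn_toE.comp_continuous (hc.prodMk hf) fun x => ⟨hS x, trivial⟩

/-- Over a simplex the bundle is trivial, so extending a section over a cell amounts to extending a
map from its boundary to the fiber. -/
theorem exists_isSkeletonSection [Nonempty F]
    (hp : ∀ x, ∃ e : Bundle.Trivialization F p, x ∈ e.baseSet) {N : ℕ}
    (hF : ∀ m ≤ N, CubeExtension F m) : ∃ s, IsSkeletonSection T p N s := by
  rcases isEmpty_or_nonempty (Realization K) with h | ⟨⟨x⟩⟩
  · exact ⟨isEmptyElim, (continuous_of_const fun x => isEmptyElim x).continuousOn,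
      fun x => isEmptyElim x⟩
  have hE : Nonempty E := by
    obtain ⟨e, -⟩ := hp (T x)
    exact ⟨fiberMap e (T x) (Classical.arbitrary F)⟩
  refine exists_skeletal_map (fun x e => p e = T x) N fun m hm τ g hg hgp => ?_
  obtain ⟨S⟩ := nonempty_setTrivialization T hp τ.2.1
  have hS : ∀ y, T (cubeMap τ y) ∈ T '' closedSimplex K τ.1 := mem_image_cubeMap τ
  obtain ⟨G, hG, hGg⟩ := hF m hm (S.toF ∘ g) (S.continuousOn_toF.comp hg fun y hy => by
    rw [Set.mem_preimage, hgp y hy]; exact hS y)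
  refine ⟨fun y => S.toE (T (cubeMap τ y), G y),
    S.continuous_toE_comp (T.continuous.comp (continuous_cubeMap τ)) hS hG, fun y hy => ?_,
    fun y => S.proj_toE _ (hS y) _⟩
  dsimp only
  rw [hGg hy, ← hgp y hy]
  exact S.toE_toF _ (by rw [hgp y hy]; exact hS y)

/-- A homotopy is treated as a map into the path space `C(I, E)`, so that it can be built cell by
cell. On an `m`-cell the prism must be filled, whence the extension property in dimension `m + 1`.
-/
theorem exists_skeletal_homotopy
    (hp : ∀ x, ∃ e : Bundle.Trivialization F p, x ∈ e.baseSet) {N : ℕ}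
    (hF : ∀ m ≤ N, CubeExtension F (m + 1)) {s s' : Realization K → E}
    (hs : IsSkeletonSection T p N s) (hs' : IsSkeletonSection T p N s') :
    ∃ u : Realization K → C(I, E), ContinuousOn u (skeleton K N) ∧
      ∀ x ∈ skeleton K N, (∀ t, p (u x t) = T x) ∧ u x 0 = s x ∧ u x 1 = s' x := by
  rcases isEmpty_or_nonempty (Realization K) with h | ⟨⟨x⟩⟩
  · exact ⟨isEmptyElim, (continuous_of_const fun x => isEmptyElim x).continuousOn,
      fun x => isEmptyElim x⟩
  have hE : Nonempty C(I, E) := ⟨ContinuousMap.const I (s x)⟩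
  refine exists_skeletal_map (fun x (w : C(I, E)) => (∀ t, p (w t) = T x) ∧ w 0 = s x ∧ w 1 = s' x)
    N fun m hm τ g hg hgp => ?_
  obtain ⟨S⟩ := nonempty_setTrivialization T hp τ.2.1
  have hS : ∀ y, T (cubeMap τ y) ∈ T '' closedSimplex K τ.1 := mem_image_cubeMap τ
  have hsk : ∀ y, cubeMap τ y ∈ skeleton K N := cubeMap_mem_skeleton τ hm
  have hc : ∀ s : Realization K → E, IsSkeletonSection T p N s →
      Continuous fun y => S.toF (s (cubeMap τ y)) := fun s hs =>
    S.continuousOn_toF.comp_continuous (hs.1.comp_continuous (continuous_cubeMap τ) hsk) fun y => by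
      rw [Set.mem_preimage, hs.2 _ (hsk y)]; exact hS y
  have ht : ∀ s : Realization K → E, IsSkeletonSection T p N s → ∀ y,
      S.toE (T (cubeMap τ y), S.toF (s (cubeMap τ y))) = s (cubeMap τ y) := fun s hs y => by
    rw [← hs.2 _ (hsk y)]
    exact S.toE_toF _ (by rw [hs.2 _ (hsk y)]; exact hS y)
  obtain ⟨G, hG, G0, G1, Gb⟩ := (hF m hm).prism (hc s hs) (hc s' hs')
    (H := fun z => S.toF (g z.2 z.1))
    (S.continuousOn_toF.comp ((hg.comp continuous_snd.continuousOn fun z hz => hz.2).eval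
      continuous_fst.continuousOn) fun z hz => by
        rw [Set.mem_preimage, (hgp _ hz.2).1]; exact hS _)
    (fun y hy => by simp only [(hgp y hy).2.1]) (fun y hy => by simp only [(hgp y hy).2.2])
  have hL : Continuous fun z : (Fin m → I) × I => S.toE (T (cubeMap τ z.1), G (z.2, z.1)) :=
    S.continuous_toE_comp (T.continuous.comp ((continuous_cubeMap τ).comp continuous_fst))
      (fun z => hS z.1) (by fun_prop)
  refine ⟨fun y => ⟨fun t => S.toE (T (cubeMap τ y), G (t, y)),
      hL.comp (by fun_prop : Continuous fun t : I => (y, t))⟩,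
    ContinuousMap.continuous_of_continuous_uncurry _ hL, fun y hy => ?_,
    fun y => ⟨fun t => ?_, ?_, ?_⟩⟩
  · ext1 t
    change S.toE (T (cubeMap τ y), G (t, y)) = g y t
    rw [Gb t y hy, ← (hgp y hy).1 t]
    exact S.toE_toF _ (by rw [(hgp y hy).1]; exact hS y)
  · exact S.proj_toE _ (hS y) _
  · change S.toE (T (cubeMap τ y), G (0, y)) = _
    rw [G0, ht s hs]
  · change S.toE (T (cubeMap τ y), G (1, y)) = _
    rw [G1, ht s' hs']

variable {k : ℕ} {J : M → Set (Sph (k + 2) → E)}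

/-- The obstruction cochains of any two sections are cohomologous. -/
theorem HasRetractions.sub_mem_coboundaries (hJ : HasRetractions T p J)
    (hp : ∀ x, ∃ e : Bundle.Trivialization F p, x ∈ e.baseSet)
    (hF : ∀ m ≤ k + 1, CubeExtension F m) {s s' : Realization K → E}
    (hs : IsSkeletonSection T p (k + 1) s) (hs' : IsSkeletonSection T p (k + 1) s')
    {z z' : Simplices K (k + 2) → SphereCoeff k} (hz : ∀ τ, Represents T p J s τ (z τ))
    (hz' : ∀ τ, Represents T p J s' τ (z' τ)) :
    z' - z ∈ coboundaries K (SphereCoeff k) (k + 2) := by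
  have hsk : skeleton K k ⊆ skeleton K (k + 1) := fun x hx => by
    rw [mem_skeleton_iff] at hx ⊢; omega
  obtain ⟨u, hu, hus⟩ := exists_skeletal_homotopy (N := k) (T := T) hp
    (fun m hm => hF (m + 1) (by omega)) ⟨hs.1.mono hsk, fun x hx => hs.2 x (hsk hx)⟩
    ⟨hs'.1.mono hsk, fun x hx => hs'.2 x (hsk hx)⟩
  -- The prism over `ρ`, with time as coordinate `0`: the two sections at its ends and the homotopy
  -- `u` in between. Above the `(n-2)`-skeleton its interior values mean nothing.
  let g : {m : ℕ} → Simplices K m → (Fin (m + 1) → I) → E := fun ρ w =>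
    slab s s' u (w 0) (cubeMap ρ fun j => w j.succ)
  have hslab : ∀ x ∈ skeleton K k, ∀ t, slab s s' u t x = u x t := fun x hx t =>
    slab_eq (hus x hx).2.1 (hus x hx).2.2 t
  have hgc : ∀ ρ : Simplices K (k + 1), ContinuousOn (g ρ) (Cube.boundary (Fin (k + 2))) := by
    refine fun ρ => continuousOn_boundary fun i ε hε => ?_
    induction i using Fin.cases with
    | zero =>
      simp only [g, face_same, face_zero_succ]
      rcases hε with rfl | rfl
      · rw [slab_zero]
        exact hs.1.comp_continuous (continuous_cubeMap ρ) (cubeMap_mem_skeleton ρ le_rfl)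
      · rw [slab_one]
        exact hs'.1.comp_continuous (continuous_cubeMap ρ) (cubeMap_mem_skeleton ρ le_rfl)
    | succ l =>
      simp only [g, face_succ_zero, face_succ_succ]
      have hm : ∀ y : Fin (k + 1) → I, cubeMap ρ (face l ε fun j => y j.succ) ∈ skeleton K k :=
        fun y => mapsTo_cubeMap_boundary ρ (face_mem_boundary l hε _)
      have : ∀ y : Fin (k + 1) → I, slab s s' u (y 0) (cubeMap ρ (face l ε fun j => y j.succ)) =
          u (cubeMap ρ (face l ε fun j => y j.succ)) (y 0) := fun y => hslab _ (hm y) _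
      simp only [this]
      exact (hu.comp_continuous ((continuous_cubeMap ρ).comp ((continuous_face l ε).comp
        continuous_tail)) hm).eval (continuous_apply 0)
  have hgm : ∀ ρ : Simplices K (k + 1), Set.MapsTo (g ρ) (Cube.boundary (Fin (k + 2)))
      (p ⁻¹' (T '' closedSimplex K ρ.1)) := by
    intro ρ w hw
    rw [← face_zero_tail w, face_zero_mem_boundary_iff] at hw
    have hps : ∀ t, slab s s' u t (cubeMap ρ fun j => w j.succ) = g ρ w →
      p (slab s s' u t (cubeMap ρ fun j => w j.succ)) = T (cubeMap ρ fun j => w j.succ) →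
      g ρ w ∈ p ⁻¹' (T '' closedSimplex K ρ.1) := fun t h1 h2 => by
        rw [Set.mem_preimage, ← h1, h2]; exact mem_image_cubeMap ρ _
    rcases hw with (hw | hw) | hw
    · refine hps 0 (by simp only [g, hw]) ?_
      rw [slab_zero]; exact hs.2 _ (cubeMap_mem_skeleton ρ le_rfl _)
    · refine hps 1 (by simp only [g, hw]) ?_
      rw [slab_one]; exact hs'.2 _ (cubeMap_mem_skeleton ρ le_rfl _)
    · refine hps (w 0) rfl ?_
      have hm := mapsTo_cubeMap_boundary ρ hw
      rw [hslab _ hm]; exact (hus _ hm).1 _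
  choose r hr j hj _ _ hjr using fun ρ : Simplices K (k + 1) =>
    hJ ρ.1 ρ.2.1 _ (mem_image_cubeMap (T := T) ρ fun _ => 0)
  -- The difference cochain: the degree on the boundary of the prism over an `(n-1)`-simplex. Each
  -- `ρ` has its own retraction, and `hd` compares it with the one over `τ`.
  refine ⟨fun ρ => degree (r ρ ∘ g ρ), funext fun τ => ?_⟩
  obtain ⟨r', hr', -⟩ := hJ τ.1 τ.2.1 _ (mem_image_cubeMap (T := T) τ fun _ => 0)
  have hd : ∀ i, degree (r' ∘ g (oppositeFace τ i)) =
      degree (r (oppositeFace τ i) ∘ g (oppositeFace τ i)) := fun i =>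
    hr'.degree_comp_eq (hr _) (oppositeFace_subset τ i) (mem_image_cubeMap _ _) (hj _) (hjr _)
      (hgc _) (hgm _)
  have key := cubeD_degree (r' ∘ g τ)
  rw [cubeD, Fin.sum_univ_succ] at key
  have e0 : (r' ∘ g τ) ∘ face 0 0 = r' ∘ s ∘ cubeMap τ := by
    ext1 y
    simp only [Function.comp_apply, g, face_same, face_zero_succ, slab_zero]
  have e1 : (r' ∘ g τ) ∘ face 0 1 = r' ∘ s' ∘ cubeMap τ := by
    ext1 y
    simp only [Function.comp_apply, g, face_same, face_zero_succ, slab_one]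
  rw [e0, e1, (hz τ).degree_eq subset_rfl hr', (hz' τ).degree_eq subset_rfl hr'] at key
  rw [coboundary_apply_eq]
  refine Eq.trans ?_ (neg_eq_of_add_eq_zero_left (a := (z' - z) τ) (b := ?_) ?_)
  rotate_left
  · exact ∑ i : Fin (k + 2), (-1 : ℤ) ^ (i.succ : ℕ) • (degree ((r' ∘ g τ) ∘ face i.succ 1) -
      degree ((r' ∘ g τ) ∘ face i.succ 0))
  · simpa using key
  rw [← Finset.sum_neg_distrib]
  refine Finset.sum_congr rfl fun i _ => ?_
  -- The time coordinate comes first and shifts the other directions by one; this sign cancels the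
  -- one from moving the terms across the equation.
  rw [Fin.val_succ, pow_succ, mul_neg_one, neg_smul, neg_neg]
  congr 2
  · rw [← hd]
    congr 1
    ext1 y
    simp only [Function.comp_apply, g, face_succ_zero, face_succ_succ, cubeMap_face_one]
  · split_ifs with hi
    · subst hi
      rw [← hd]
      congr 1
      ext1 y
      simp only [Function.comp_apply, g, face_succ_zero, face_succ_succ, cubeMap_face_last]
    · have hm : ∀ y, cubeMap τ (face i 0 y) ∈ skeleton K k := fun y => by
        have h1 := mem_skeleton_iff.1 (cubeMap_face_zero_mem_skeleton τ i y)
        have h2 : (i : ℕ) < k + 1 := Fin.val_lt_last hi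
        exact mem_skeleton_iff.2 (by omega)
      have hc : Continuous fun y : Fin (k + 2) → I =>
          u (cubeMap τ (face i 0 fun j => y j.succ)) (y 0) :=
        (hu.comp_continuous ((continuous_cubeMap τ).comp ((continuous_face i 0).comp
          continuous_tail)) fun y => hm _).eval (continuous_apply 0)
      have e : (r' ∘ g τ) ∘ face i.succ 0 =
          r' ∘ fun y => u (cubeMap τ (face i 0 fun j => y j.succ)) (y 0) := by
        ext1 y
        simp only [Function.comp_apply, g, face_succ_zero, face_succ_succ, hslab _ (hm _)]
      rw [e]
      exact (degree_eq_zero (hr'.continuousOn.comp_continuous hc fun y => by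
        rw [Set.mem_preimage, (hus _ (hm _)).1]
        exact mem_image_cubeMap τ _)).symm

end Sections

/-! ### Existence of oriented retractions -/

section Retractions

variable {M E F V : Type*} [TopologicalSpace M] [TopologicalSpace E] [TopologicalSpace F]
  {K : AbstractSimplicialComplex V} {T : Realization K ≃ₜ M} {k : ℕ} {p : E → M}
  {J : M → Set (Sph (k + 2) → E)}

lemma HomotopicOn.mono_codomain {X Y : Type*} [TopologicalSpace X] [TopologicalSpace Y] {D : Set X}
    {S S' : Set Y} {f g : X → Y} (h : HomotopicOn D S f g) (hS : S ⊆ S') : HomotopicOn D S' f g :=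
  h.postcomp continuousOn_id hS

/-- The closed simplices are contractible to each of their points. -/
lemma homotopicOn_closedSimplex {s : Finset V} (hs : s ∈ K.faces) {x₀ : Realization K}
    (hx₀ : x₀ ∈ closedSimplex K s) :
    HomotopicOn (closedSimplex K s) (closedSimplex K s) id fun _ => x₀ := by
  let b₀ : stdSimplex ℝ s := baryCoord ⟨x₀, hx₀⟩
  let c : I → stdSimplex ℝ s → stdSimplex ℝ s := fun t b =>
    ⟨(1 - (t : ℝ)) • b.1 + (t : ℝ) • b₀.1, convex_stdSimplex ℝ s b.2 b₀.2
      (sub_nonneg.2 t.2.2) t.2.1 (by ring)⟩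
  have hc : Continuous fun z : I × stdSimplex ℝ s => c z.1 z.2 :=
    Continuous.subtype_mk (by fun_prop) _
  refine homotopicOn_of_subtype ⟨fun z => simplexMap K ⟨s, hs⟩ (c z.1 (baryCoord z.2)),
    (continuous_simplexMap _).comp (hc.comp (continuous_fst.prodMk
      (continuous_baryCoord.comp continuous_snd)))⟩ (fun z => simplexMap_mem ⟨s, hs⟩ _)
    (fun x => ?_) fun x => ?_
  · have : c 0 (baryCoord x) = baryCoord x := Subtype.ext (by simp [c])
    exact (congrArg _ this).trans (simplexMap_baryCoord hs x)
  · have : c 1 (baryCoord x) = b₀ := Subtype.ext (by simp [c])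
    exact (congrArg _ this).trans (simplexMap_baryCoord hs ⟨x₀, hx₀⟩)

variable (p J) in
/-- A family of maps from the sphere to the fibers of `p`, unique up to homotopy and locally
represented by continuous families. -/
structure IsOrientation : Prop where
  continuous : ∀ x, ∀ j ∈ J x, Continuous j
  proj : ∀ x, ∀ j ∈ J x, ∀ v, p (j v) = x
  homotopicOn : ∀ x, ∀ j ∈ J x, ∀ j' ∈ J x, HomotopicOn Set.univ (p ⁻¹' {x}) j j'
  exists_local : ∀ x, ∃ U ∈ 𝓝 x, ∃ φ : M × Sph (k + 2) → E, ContinuousOn φ (U ×ˢ Set.univ) ∧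
    ∀ x' ∈ U, (fun v => φ (x', v)) ∈ J x'

/-- The relation `P` is symmetric, transitive and holds near each point of the line, hence
everywhere by connectedness. Transitivity uses that `exists_local` supplies an element of `J` at the
middle point. -/
lemma IsOrientation.homotopicOn_path (hJ : IsOrientation p J) {S : Set M} {X : Type*}
    [TopologicalSpace X] {ψ : E → X} (hψ : ContinuousOn ψ (p ⁻¹' S)) {c : ℝ → M} (hc : Continuous c)
    (hcS : ∀ t, c t ∈ S) (t t' : ℝ) : ∀ j ∈ J (c t), ∀ j' ∈ J (c t'),
      HomotopicOn Set.univ Set.univ (ψ ∘ j) (ψ ∘ j') := by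
  let P : ℝ → ℝ → Prop := fun t t' => ∀ j ∈ J (c t), ∀ j' ∈ J (c t'),
      HomotopicOn Set.univ Set.univ (ψ ∘ j) (ψ ∘ j')
  have hfib : ∀ t, p ⁻¹' {c t} ⊆ p ⁻¹' S := fun t =>
    Set.preimage_mono (Set.singleton_subset_iff.2 (hcS t))
  have : Std.Symm P := ⟨fun t t' h j hj j' hj' => (h j' hj' j hj).symm⟩
  have htr : IsTrans ℝ P := ⟨fun t₁ t₂ t₃ h h' j hj j' hj' => by
    obtain ⟨U, hU, φ, -, hφ⟩ := hJ.exists_local (c t₂)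
    have hm := hφ _ (mem_of_mem_nhds hU)
    exact (h j hj _ hm).trans (h' _ hm j' hj')⟩
  refine PreconnectedSpace.induction₂ P (fun t => ?_) htr t t'
  obtain ⟨U, hU, φ, hφc, hφ⟩ := hJ.exists_local (c t)
  obtain ⟨W, ⟨hW, hWc⟩, hWU⟩ := (path_connected_basis t).mem_iff.1
    (hc.continuousAt.preimage_mem_nhds hU)
  filter_upwards [hW] with t' ht' j hj j' hj'
  obtain ⟨γ, hγ⟩ := hWc.joinedIn t (mem_of_mem_nhds hW) t' ht'
  have hφJ : ∀ τ, (fun v => φ (c (γ τ), v)) ∈ J (c (γ τ)) := fun τ => hφ _ (hWU (hγ τ))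
  have h1 := (hJ.homotopicOn _ j hj _ (hφ _ (mem_of_mem_nhds hU))).postcomp (S' := Set.univ)
    (hψ.mono (hfib t)) fun _ _ => trivial
  have h2 := (hJ.homotopicOn _ _ (hφ _ (hWU ht')) j' hj').postcomp (S' := Set.univ)
    (hψ.mono (hfib t')) fun _ _ => trivial
  refine h1.trans (HomotopicOn.trans ?_ h2)
  refine ⟨fun z => ψ (φ (c (γ z.1), z.2)), ?_, fun _ _ _ => trivial, fun v _ => ?_, fun v _ => ?_⟩
  · refine (hψ.comp_continuous (hφc.comp_continuous
      ((hc.comp (γ.continuous.comp continuous_fst)).prodMk continuous_snd)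
      fun z => ⟨hWU (hγ z.1), trivial⟩) fun z => ?_).continuousOn
    rw [Set.mem_preimage]
    have := hJ.proj _ _ (hφJ z.1) z.2
    dsimp only [Function.comp_def] at this ⊢
    rw [this]
    exact hcS _
  · simp
  · simp

/-- Homotopy inverses on single fibers suffice: contracting the simplex to `x₀` in a trivialization
pushes everything into the fiber over `x₀`, where `r` is given. The orientations at other points are
compared along the path of the contraction. -/
theorem IsOrientation.hasRetractions (hJ : IsOrientation p J)
    (hp : ∀ x, ∃ e : Bundle.Trivialization F p, x ∈ e.baseSet)
    (hr : ∀ x, ∃ j ∈ J x, ∃ r : E → Sph (k + 2), ContinuousOn r (p ⁻¹' {x}) ∧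
      HomotopicOn Set.univ Set.univ (r ∘ j) id ∧
      HomotopicOn (p ⁻¹' {x}) (p ⁻¹' {x}) id (j ∘ r)) : HasRetractions T p J := by
  intro s hs x₀ hx₀
  obtain ⟨S⟩ := nonempty_setTrivialization T hp hs
  obtain ⟨j, hj, r, hrc, hrj, hjr⟩ := hr x₀
  have hpc := continuous_proj hp
  have hTs : T.symm x₀ ∈ closedSimplex K s := by
    obtain ⟨x, hx, rfl⟩ := hx₀
    rwa [T.symm_apply_apply]
  have hsT : Set.MapsTo T.symm (T '' closedSimplex K s) (closedSimplex K s) := by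
    rintro _ ⟨x, hx, rfl⟩
    rwa [T.symm_apply_apply]
  have hC : HomotopicOn (T '' closedSimplex K s) (T '' closedSimplex K s) id fun _ => x₀ :=
    (((homotopicOn_closedSimplex hs hTs).precomp T.symm.continuous.continuousOn hsT).postcomp
      T.continuous.continuousOn (Set.mapsTo_image _ _)).congr (fun x _ => T.apply_symm_apply x)
      fun x _ => T.apply_symm_apply x₀
  obtain ⟨C, hCc, hCm, hC0, hC1⟩ := hC
  let π : E → E := fun e => S.toE (x₀, S.toF e)
  have hπ : ContinuousOn π (p ⁻¹' (T '' closedSimplex K s)) :=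
    S.continuousOn_toE.comp (continuousOn_const.prodMk S.continuousOn_toF) fun _ _ => ⟨hx₀, trivial⟩
  have hπm : Set.MapsTo π (p ⁻¹' (T '' closedSimplex K s)) (p ⁻¹' {x₀}) := fun e _ =>
    S.proj_toE _ hx₀ _
  have hfib : p ⁻¹' {x₀} ⊆ p ⁻¹' (T '' closedSimplex K s) :=
    Set.preimage_mono (Set.singleton_subset_iff.2 hx₀)
  have hid : HomotopicOn (p ⁻¹' (T '' closedSimplex K s))
      (p ⁻¹' (T '' closedSimplex K s)) id π := by
    refine ⟨fun z => S.toE (C (z.1, p z.2), S.toF z.2), ?_, fun t e he => ?_, fun e he => ?_,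
      fun e he => ?_⟩
    · exact S.continuousOn_toE.comp ((hCc.comp (by fun_prop) fun z hz => ⟨trivial, hz.2⟩).prodMk
        (S.continuousOn_toF.comp continuousOn_snd fun z hz => hz.2))
        fun z hz => ⟨hCm _ _ hz.2, trivial⟩
    · rw [Set.mem_preimage, S.proj_toE _ (hCm _ _ he)]
      exact hCm _ _ he
    · dsimp only
      rw [hC0 _ he]
      exact S.toE_toF e he
    · dsimp only
      rw [hC1 _ he]
  refine ⟨r ∘ π, ⟨hrc.comp hπ hπm, fun x hx j' hj' => ?_⟩, j, hj, hJ.continuous _ j hj,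
    hJ.proj _ j hj, hid.trans ((hjr.precomp hπ hπm).mono_codomain hfib)⟩
  -- The path of the contraction from `x` to `x₀`, extended to the line by constants.
  let c : ℝ → M := fun t => C (Set.projIcc 0 1 zero_le_one t, x)
  have hc : Continuous c := hCc.comp_continuous (continuous_projIcc.prodMk continuous_const)
    fun _ => ⟨trivial, hx⟩
  have c0 : c 0 = x := by simp only [c, Set.projIcc_left]; exact hC0 x hx
  have c1 : c 1 = x₀ := by simp only [c, Set.projIcc_right]; exact hC1 x hx
  have h := hJ.homotopicOn_path (hrc.comp hπ hπm) hc (fun t => hCm _ _ hx) 0 1 j' (by rwa [c0]) j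
    (by rwa [c1])
  refine h.trans (hrj.congr (fun v _ => ?_) fun _ _ => rfl)
  have : π (j v) = j v := by
    have h1 := hJ.proj _ j hj v
    have h2 := S.toE_toF (j v) (by rw [h1]; exact hx₀)
    rwa [h1] at h2
  simp only [Function.comp_apply, this]

end Retractions

/-! ### Oriented sphere bundles -/

section SphereBundles

variable {M E F : Type*} [TopologicalSpace M] [TopologicalSpace E] [TopologicalSpace F]
  {p : E → M}

lemma continuousOn_fiberMap (e : Bundle.Trivialization F p) :
    ContinuousOn (fun z : M × F => fiberMap e z.1 z.2) (e.baseSet ×ˢ Set.univ) :=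
  e.toOpenPartialHomeomorph.continuousOn_symm.mono fun _ hz => e.mem_target.2 hz.1

lemma continuous_fiberMap {e : Bundle.Trivialization F p} {x : M} (hx : x ∈ e.baseSet) :
    Continuous (fiberMap e x) :=
  (continuousOn_fiberMap e).comp_continuous (by fun_prop : Continuous fun v : F => (x, v))
    fun _ => ⟨hx, trivial⟩

lemma proj_fiberMap {e : Bundle.Trivialization F p} {x : M} (hx : x ∈ e.baseSet) (v : F) :
    p (fiberMap e x v) = x := e.proj_symm_apply' hx

lemma apply_fiberMap {e : Bundle.Trivialization F p} {x : M} (hx : x ∈ e.baseSet) (v : F) :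
    e (fiberMap e x v) = (x, v) := e.apply_symm_apply' hx

lemma fiberMap_apply {e : Bundle.Trivialization F p} {w : E} (hw : p w ∈ e.baseSet) :
    fiberMap e (p w) (e w).2 = w := e.symm_apply_mk_proj (e.mem_source.2 hw)

lemma continuousOn_snd_apply {e : Bundle.Trivialization F p} {x : M} (hx : x ∈ e.baseSet) :
    ContinuousOn (fun w => (e w).2) (p ⁻¹' {x}) := by
  have he : ContinuousOn e e.source := e.continuousOn_toFun
  exact (continuous_snd.comp_continuousOn he).mono fun w hw => by
    rw [Set.mem_preimage, Set.mem_singleton_iff] at hw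
    exact e.mem_source.2 (by rwa [hw])

lemma FiberHomotopic.homotopicOn {M E F : Type*} [TopologicalSpace E] [TopologicalSpace F]
    {p : E → M} {x : M} {f g : F → E} (h : FiberHomotopic p x f g) :
    HomotopicOn Set.univ (p ⁻¹' {x}) f g := by
  obtain ⟨H, h1, h2, h3⟩ := h
  exact ⟨H, H.continuous.continuousOn, fun t v _ => h1 t v, fun v _ => h2 v, fun v _ => h3 v⟩

variable {k : ℕ} (ξ : OrientedSphereBundle (k + 2) p)

/-- The oriented parametrizations of the fibers. -/
def OrientedSphereBundle.orientedMaps (x : M) : Set (Sph (k + 2) → E) :=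
  {j | ∃ e ∈ ξ.charts, x ∈ e.baseSet ∧ j = fiberMap e x}

lemma OrientedSphereBundle.exists_trivialization {n : ℕ} (ξ : OrientedSphereBundle n p) (x : M) :
    ∃ e : Bundle.Trivialization (Sph n) p, x ∈ e.baseSet :=
  (ξ.exists_chart x).imp fun _ h => h.2

lemma OrientedSphereBundle.isOrientation : IsOrientation p ξ.orientedMaps where
  continuous := by
    rintro x _ ⟨e, -, hx, rfl⟩
    exact continuous_fiberMap hx
  proj := by
    rintro x _ ⟨e, -, hx, rfl⟩ v
    exact proj_fiberMap hx v
  homotopicOn := by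
    rintro x _ ⟨e, he, hx, rfl⟩ _ ⟨e', he', hx', rfl⟩
    exact (ξ.oriented e he e' he' x ⟨hx, hx'⟩).homotopicOn
  exists_local x := by
    obtain ⟨e, he, hx⟩ := ξ.exists_chart x
    exact ⟨e.baseSet, e.open_baseSet.mem_nhds hx, _, continuousOn_fiberMap e,
      fun x' hx' => ⟨e, he, hx', rfl⟩⟩

variable {V : Type*} {K : AbstractSimplicialComplex V} {T : Realization K ≃ₜ M}

lemma OrientedSphereBundle.hasRetractions : HasRetractions T p ξ.orientedMaps := by
  refine ξ.isOrientation.hasRetractions ξ.exists_trivialization fun x => ?_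
  obtain ⟨e, he, hx⟩ := ξ.exists_chart x
  refine ⟨_, ⟨e, he, hx, rfl⟩, fun w => (e w).2, continuousOn_snd_apply hx, ?_, ?_⟩
  · refine (HomotopicOn.refl continuousOn_id (Set.mapsTo_univ _ _)).congr (fun v _ => ?_)
      fun _ _ => rfl
    simp [apply_fiberMap hx]
  · refine (HomotopicOn.refl continuousOn_id (Set.mapsTo_id _)).congr (fun _ _ => rfl)
      fun w hw => ?_
    obtain rfl : p w = x := hw
    exact (fiberMap_apply hx).symm

lemma IsSkeletonSection.postcomp {E' : Type*} [TopologicalSpace E'] {p' : E' → M} {φ : E → E'}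
    (hφ : Continuous φ) (hp : ∀ w, p' (φ w) = p w) {m : ℕ} {s : Realization K → E}
    (h : IsSkeletonSection T p m s) : IsSkeletonSection T p' m (φ ∘ s) :=
  ⟨hφ.comp_continuousOn h.1, fun x hx => (hp _).trans (h.2 x hx)⟩

variable [LinearOrder V]

lemma isObstruction_iff_represents {s : Realization K → E} {τ : Simplices K (k + 2)}
    {α : SphereCoeff k} :
    IsObstruction T ξ s τ α ↔ Represents T p ξ.orientedMaps s τ α := by
  constructor
  · rintro ⟨f, hf, e, he, hx, H, h1, h2, h3⟩
    exact ⟨f, hf, _, ⟨e, he, hx, rfl⟩, homotopicOn_of_subtype H (fun z => h1 z.1 z.2) h2 h3⟩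
  · rintro ⟨f, hf, _, ⟨e, he, hx, rfl⟩, h⟩
    obtain ⟨H, h1, h2, h3⟩ := h.exists_subtype
    exact ⟨f, hf, e, he, hx, H, fun t y => h1 (t, y), h2, h3⟩

/-- Pushing a section forward along a fiberwise map that respects orientations preserves its
obstructions; for the inclusions of the ends this moves the computation into the bordism. -/
lemma Represents.postcomp {E' : Type*} [TopologicalSpace E'] {p' : E' → M}
    {J : M → Set (Sph (k + 2) → E)} {J' : M → Set (Sph (k + 2) → E')} {φ : E → E'}
    (hφ : Continuous φ) (hp : ∀ w, p' (φ w) = p w) (hJ : ∀ x, ∀ j ∈ J x, φ ∘ j ∈ J' x)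
    {s : Realization K → E} {τ : Simplices K (k + 2)} {α : SphereCoeff k}
    (h : Represents T p J s τ α) : Represents T p' J' (φ ∘ s) τ α := by
  obtain ⟨f, hf, j, hj, h⟩ := h
  exact ⟨f, hf, _, hJ _ j hj, h.postcomp hφ.continuousOn fun w hw => by
    rw [Set.mem_preimage, hp]; exact hw⟩

end SphereBundles

/-! ### Oriented bordisms -/

section OrientedBordism

variable {M E₀ E₁ W : Type*} [TopologicalSpace M] [TopologicalSpace E₀] [TopologicalSpace E₁]
  [TopologicalSpace W] {k : ℕ} {p₀ : E₀ → M} {p₁ : E₁ → M} {q : W → M}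

/-- The map from `E₀` to the total space of the bordism. -/
def FiberwiseBordism.incl₀ {F : Type*} [TopologicalSpace F] (B : FiberwiseBordism F p₀ p₁ q)
    (z : E₀) : W := B.iso₀ z

/-- The map from `E₁` to the total space of the bordism. -/
def FiberwiseBordism.incl₁ {F : Type*} [TopologicalSpace F] (B : FiberwiseBordism F p₀ p₁ q)
    (z : E₁) : W := B.iso₁ z

variable (B : FiberwiseBordism (Sph (k + 2)) p₀ p₁ q)
  (ξ₀ : OrientedSphereBundle (k + 2) p₀) (ξ₁ : OrientedSphereBundle (k + 2) p₁)

lemma FiberwiseBordism.continuous_incl₀ {F : Type*} [TopologicalSpace F]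
    (B : FiberwiseBordism F p₀ p₁ q) : Continuous B.incl₀ :=
  continuous_subtype_val.comp B.iso₀.continuous

lemma FiberwiseBordism.continuous_incl₁ {F : Type*} [TopologicalSpace F]
    (B : FiberwiseBordism F p₀ p₁ q) : Continuous B.incl₁ :=
  continuous_subtype_val.comp B.iso₁.continuous

/-- The maps from the sphere to the fibers of the bordism given by the oriented parametrizations of
its ends. -/
def FiberwiseBordism.orientedMaps (x : M) : Set (Sph (k + 2) → W) :=
  (B.incl₀ ∘ ·) '' ξ₀.orientedMaps x ∪ (B.incl₁ ∘ ·) '' ξ₁.orientedMaps x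

variable {B ξ₀ ξ₁}

/-- Homotopies between parametrizations of different ends are exactly what `hB` provides; those of
one end come from its own orientation. -/
lemma FiberwiseBordism.IsOriented.isOrientation (hB : B.IsOriented ξ₀ ξ₁) :
    IsOrientation q (B.orientedMaps ξ₀ ξ₁) where
  continuous := by
    rintro x _ (⟨j, hj, rfl⟩ | ⟨j, hj, rfl⟩)
    · exact B.continuous_incl₀.comp (ξ₀.isOrientation.continuous x j hj)
    · exact B.continuous_incl₁.comp (ξ₁.isOrientation.continuous x j hj)
  proj := by
    rintro x _ (⟨j, hj, rfl⟩ | ⟨j, hj, rfl⟩) v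
    · exact (B.proj_iso₀ _).trans (ξ₀.isOrientation.proj x j hj v)
    · exact (B.proj_iso₁ _).trans (ξ₁.isOrientation.proj x j hj v)
  homotopicOn x := by
    have h₀ : Set.MapsTo B.incl₀ (p₀ ⁻¹' {x}) (q ⁻¹' {x}) := fun z hz => (B.proj_iso₀ z).trans hz
    have h₁ : Set.MapsTo B.incl₁ (p₁ ⁻¹' {x}) (q ⁻¹' {x}) := fun z hz => (B.proj_iso₁ z).trans hz
    have h₂ : ∀ j ∈ ξ₀.orientedMaps x, ∀ j' ∈ ξ₁.orientedMaps x,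
        HomotopicOn Set.univ (q ⁻¹' {x}) (B.incl₀ ∘ j) (B.incl₁ ∘ j') := by
      rintro _ ⟨e, he, hx, rfl⟩ _ ⟨e', he', hx', rfl⟩
      exact (hB e he e' he' x ⟨hx, hx'⟩).homotopicOn
    rintro _ (⟨j, hj, rfl⟩ | ⟨j, hj, rfl⟩) _ (⟨j', hj', rfl⟩ | ⟨j', hj', rfl⟩)
    · exact (ξ₀.isOrientation.homotopicOn x j hj j' hj').postcomp B.continuous_incl₀.continuousOn h₀
    · exact h₂ j hj j' hj'
    · exact (h₂ j' hj' j hj).symm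
    · exact (ξ₁.isOrientation.homotopicOn x j hj j' hj').postcomp B.continuous_incl₁.continuousOn h₁
  exists_local x := by
    obtain ⟨U, hU, φ, hφ, hφJ⟩ := ξ₀.isOrientation.exists_local x
    exact ⟨U, hU, B.incl₀ ∘ φ, B.continuous_incl₀.comp_continuousOn hφ, fun x' hx' =>
      Or.inl ⟨_, hφJ x' hx', rfl⟩⟩

lemma IntervalBundle.apply_eq_zero {F : Type*} [TopologicalSpace F] {ω : IntervalBundle F q}
    {w : W} (hw : w ∈ ω.endSet 0) {e : Bundle.Trivialization (F × I) q} (he : e ∈ ω.charts)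
    (hq : q w ∈ e.baseSet) : (e w).2.2 = 0 := by
  obtain ⟨e', he', hq', h0⟩ := hw
  exact (ω.preserves_ends e he e' he' w ⟨hq, hq'⟩).1.2 h0

lemma FiberwiseBordism.exists_trivialization {F : Type*} [TopologicalSpace F]
    (B : FiberwiseBordism F p₀ p₁ q) (x : M) :
    ∃ e : Bundle.Trivialization (F × I) q, x ∈ e.baseSet :=
  (B.exists_chart x).imp fun _ h => h.2

/-- The fiber is collapsed onto its end `0`, which is identified with the fiber of `E₀` and then
with the sphere by an oriented chart. -/
lemma FiberwiseBordism.IsOriented.hasRetractions (hB : B.IsOriented ξ₀ ξ₁) {V : Type*}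
    {K : AbstractSimplicialComplex V} {T : Realization K ≃ₜ M} :
    HasRetractions T q (B.orientedMaps ξ₀ ξ₁) := by
  refine hB.isOrientation.hasRetractions B.exists_trivialization fun x => ?_
  obtain ⟨e, he, hx⟩ := B.exists_chart x
  obtain ⟨e₀, he₀, hx₀⟩ := ξ₀.exists_chart x
  let a : Sph (k + 2) → B.endSet 0 := fun v => ⟨fiberMap e x (v, 0), e, he, by
    rwa [proj_fiberMap hx], by rw [apply_fiberMap hx]⟩
  have ha : Continuous a := Continuous.subtype_mk ((continuous_fiberMap hx).comp (by fun_prop)) _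
  have hap : ∀ v, p₀ (B.iso₀.symm (a v)) = x := fun v => by
    rw [← B.proj_iso₀, B.iso₀.apply_symm_apply]
    exact proj_fiberMap hx _
  let b : W → E₀ := fun w => B.iso₀.symm (a (e w).2.1)
  have hb : ContinuousOn b (q ⁻¹' {x}) := (B.iso₀.symm.continuous.comp ha).comp_continuousOn
    (continuous_fst.comp_continuousOn (continuousOn_snd_apply hx))
  have hbi : ∀ w, B.incl₀ (b w) = fiberMap e x ((e w).2.1, 0) := fun w =>
    congrArg Subtype.val (B.iso₀.apply_symm_apply _)
  have hib : ∀ z, p₀ z = x → b (B.incl₀ z) = z := fun z hz => by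
    have hq : q (B.incl₀ z) = x := (B.proj_iso₀ z).trans hz
    have h0 := IntervalBundle.apply_eq_zero (B.iso₀ z).2 he (by
      change q (B.incl₀ z) ∈ _; rwa [hq])
    refine (B.iso₀.symm_apply_eq).2 (Subtype.ext ?_)
    change fiberMap e x ((e (B.incl₀ z)).2.1, 0) = B.incl₀ z
    have h1 := fiberMap_apply (e := e) (w := B.incl₀ z) (by rwa [hq])
    rw [hq] at h1
    conv_rhs => rw [← h1]
    exact congrArg (fiberMap e x) (Prod.ext rfl h0.symm)
  refine ⟨_, Or.inl ⟨_, ⟨e₀, he₀, hx₀, rfl⟩, rfl⟩, fun w => (e₀ (b w)).2,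
    (continuousOn_snd_apply hx₀).comp hb fun w _ => hap _, ?_, ?_⟩
  · refine (HomotopicOn.refl continuousOn_id (Set.mapsTo_univ _ _)).congr (fun v _ => ?_)
      fun _ _ => rfl
    simp [hib _ (proj_fiberMap hx₀ v), apply_fiberMap hx₀]
  -- The interval coordinate is scaled to `0`, which deforms the fiber of `W` onto its end.
  · refine ⟨fun z => fiberMap e x ((e z.2).2.1, unitInterval.symm z.1 * (e z.2).2.2), ?_,
      fun t w hw => proj_fiberMap hx _, fun w hw => ?_, fun w hw => ?_⟩
    · have hc : ContinuousOn (fun z : I × W => (e z.2).2) (Set.univ ×ˢ (q ⁻¹' {x})) :=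
        (continuousOn_snd_apply hx).comp continuousOn_snd fun z hz => hz.2
      exact (continuous_fiberMap hx).comp_continuousOn ((by fun_prop :
        Continuous fun z : I × (Sph (k + 2) × I) => (z.2.1,
          unitInterval.symm z.1 * z.2.2)).comp_continuousOn
          (continuousOn_fst.prodMk hc))
    · obtain rfl : q w = x := hw
      simpa using fiberMap_apply hx
    · have h1 := fiberMap_apply (e := e₀) (w := b w) (by rw [hap]; exact hx₀)
      rw [hap] at h1
      simp only [Function.comp_apply, h1, hbi, unitInterval.symm_one, zero_mul]

variable {V : Type*} [LinearOrder V] {K : AbstractSimplicialComplex V} {T : Realization K ≃ₜ M}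

lemma OrientedSphereBundle.isEulerClass {E : Type*} [TopologicalSpace E] {p : E → M}
    (ξ : OrientedSphereBundle (k + 2) p) {c : Cohomology K (SphereCoeff k) (k + 2)}
    (h : ∀ s, IsSkeletonSection T p (k + 1) s → ∀ z,
      (∀ τ, Represents T p ξ.orientedMaps s τ (z τ)) →
      ∃ hz : z ∈ cocycles K (SphereCoeff k) (k + 2), QuotientAddGroup.mk ⟨z, hz⟩ = c) :
    IsEulerClass T ξ c := by
  have : Nonempty (Sph (k + 2)) := ⟨basePt (k + 1)⟩
  refine ⟨exists_isSkeletonSection ξ.exists_trivialization fun m hm => cubeExtension_sphere hm,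
    fun s hs => ⟨?_, fun z hz => h s hs z fun τ => (isObstruction_iff_represents ξ).1 (hz τ)⟩⟩
  choose z hz using ξ.hasRetractions.exists_represents hs
  exact ⟨z, fun τ => (isObstruction_iff_represents ξ).2 (hz τ)⟩

end OrientedBordism

end EulerBordism

/-! ### Equality of the Euler classes -/

/-- Fiberwise bordant oriented `S^{n-1}`-bundles over a triangulated space `M` have the same Euler
class in `H^n(M; π_{n-1}(S^{n-1}))`. Here `n = k + 2` is an arbitrary integer `≥ 2`. -/
theorem lemma4p1 {M E₀ E₁ W V : Type*}
    [TopologicalSpace M] [TopologicalSpace E₀] [TopologicalSpace E₁] [TopologicalSpace W]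
    [LinearOrder V] (K : AbstractSimplicialComplex V) (T : EulerBordism.Realization K ≃ₜ M)
    (k : ℕ) {p₀ : E₀ → M} {p₁ : E₁ → M} {q : W → M}
    (ξ₀ : EulerBordism.OrientedSphereBundle (k + 2) p₀)
    (ξ₁ : EulerBordism.OrientedSphereBundle (k + 2) p₁)
    (B : EulerBordism.FiberwiseBordism (EulerBordism.Sph (k + 2)) p₀ p₁ q)
    (hB : B.IsOriented ξ₀ ξ₁) :
    ∃ c : EulerBordism.Cohomology K (EulerBordism.SphereCoeff k) (k + 2),
      EulerBordism.IsEulerClass T ξ₀ c ∧ EulerBordism.IsEulerClass T ξ₁ c := by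
  open EulerBordism in
  have : Nonempty (Sph (k + 2)) := ⟨basePt (k + 1)⟩
  have hF : ∀ m ≤ k + 1, CubeExtension (Sph (k + 2) × unitInterval) m := fun m hm =>
    (cubeExtension_sphere hm).prod (cubeExtension_unitInterval m)
  have hW : HasRetractions T q (B.orientedMaps ξ₀ ξ₁) := hB.hasRetractions
  -- The common class comes from any section of `q`; it need not come from either end.
  obtain ⟨s, hs⟩ := exists_isSkeletonSection (T := T) B.exists_trivialization hF
  choose z hz using hW.exists_represents hs
  have key : ∀ s', IsSkeletonSection T q (k + 1) s' → ∀ z',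
      (∀ τ, Represents T q (B.orientedMaps ξ₀ ξ₁) s' τ (z' τ)) →
      ∃ hz' : z' ∈ cocycles K (SphereCoeff k) (k + 2),
        (QuotientAddGroup.mk ⟨z', hz'⟩ : Cohomology K (SphereCoeff k) (k + 2)) =
          QuotientAddGroup.mk ⟨z, hW.mem_cocycles hs hz⟩ := by
    intro s' hs' z' hz'
    refine ⟨hW.mem_cocycles hs' hz', QuotientAddGroup.eq.2 (AddSubgroup.mem_addSubgroupOf.2 ?_)⟩
    -- Equality in the quotient asks for `-z' + z`, which fixes the order of the two sections.
    have h := hW.sub_mem_coboundaries B.exists_trivialization hF hs' hs hz' hz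
    rwa [sub_eq_neg_add] at h
  refine ⟨_, ξ₀.isEulerClass fun s' hs' z' hz' => key _
    (hs'.postcomp B.continuous_incl₀ B.proj_iso₀) z'
    fun τ => (hz' τ).postcomp B.continuous_incl₀ B.proj_iso₀ fun x j hj => Or.inl ⟨j, hj, rfl⟩,
    ξ₁.isEulerClass fun s' hs' z' hz' => key _ (hs'.postcomp B.continuous_incl₁ B.proj_iso₁) z'
    fun τ => (hz' τ).postcomp B.continuous_incl₁ B.proj_iso₁ fun x j hj => Or.inr ⟨j, hj, rfl⟩⟩
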